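/- **Setting.** Let $X$ be a (real) Banach space, $t_0<T$, and consider the initial value problem $$u'(t)=f(u(t))=Lu(t)+N(u(t)),\qquad u(t_0)=u_0,\qquad t_0\le t\le T,$$ where $L$ is a linear operator on $X$ with domain $D(L)$ and $N:X\to X$. Put $J(x)=L+N'(x)$, with domain $D(L)$. Let $\varphi_k(z)=\int_0^1 e^{(1-\theta)z}\frac{\theta^{k-1}}{(k-1)!}\,d\theta$ for $k\ge1$; for the generator $A$ of a strongly continuous semigroup and $\tau\ge0$, $\varphi_k(\tau A)$ is defined by this formula with the semigroup $e^{tA}$. **Method.** An $s$-stage explicit EPIRK method with step size $h_n>0$ computes, with $J_n=J(u_n)$ and $r(y)=f(y)-f(u_n)-J_n(y-u_n)=N(y)-N(u_n)-N'(u_n)(y-u_n)$, $$U_{ni}=u_n+\alpha_{i1}\psi_{i1}(g_{i1}h_nJ_n)h_nf(u_n)+h_n\sum_{j=2}^{i-1}a_{ij}(h_nJ_n)r(U_{nj}),\quad 2\le i\le s,$$ $$u_{n+1}=u_n+\varphi_1(h_nJ_n)h_nf(u_n)+h_n\sum_{i=2}^{s}b_i(h_nJ_n)r(U_{ni}),$$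 where $\psi_{i1}(z)=\sum_{k=1}^{K}p_{i1k}\varphi_k(z)$, $g_{i1}\ge0$, and $a_{ij}(z)$, $b_i(z)$ are finite real linear combinations of functions $\varphi_k(gz)$ with $k\ge1$, $g\ge0$. Put $\mathbb P_{iq}=\sum_{k=1}^{K}\frac{p_{i1k}}{(k+q-1)!}$ and $$\Psi_i(z)=\tfrac12\sum_{j=2}^{i-1}\alpha_{j1}^2\mathbb P_{j1}^2a_{ij}(z)-\alpha_{i1}g_{i1}^2\sum_{k=1}^{K}p_{i1k}\varphi_{k+2}(g_{i1}z).$$ **Assumptions on the problem.** 1. $L$ is the generator of a strongly continuous semigroup on $X$. 2. The problem has a solution $u\in C^5([t_0,T];X)$, and $N$ is five times continuously Fréchet differentiable in a strip $\{x:\operatorname{dist}(x,u([t_0,T]))<\delta\}$, $\delta>0$. 3. (Additional regularity.) For $t\in[t_0,T]$ write $\tilde u=u(t)$, $\tilde u^{(k)}=u^{(k)}(t)$, $\tilde J=J(\tilde u)$ and $\tilde N(y)=N(y)-N'(\tilde u)y$. There is $H>0$ such that the vectors $$\tilde N''(\tilde u)(\tilde u',\tilde u'''),\quad \tilde N''(\tilde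 u)(\tilde u'',\tilde u''),\quad \tilde N'''(\tilde u)(\tilde u',\tilde u',\tilde u''),\quad \tilde N^{(4)}(\tilde u)(\tilde u',\tilde u',\tilde u',\tilde u'),$$ $$\tilde N''(\tilde u)\bigl(\tilde u',\Psi_i(h\tilde J)\tilde N''(\tilde u)(\tilde u',\tilde u')\bigr)$$ lie in $D(L)$ and their images under $L$ are bounded, uniformly in $t\in[t_0,T]$, $0<h\le H$ and $2\le i\le s$. **Assumptions on the method.** For all $2\le i\le s$, $1\le k\le K$: $\alpha_{i1}p_{i1k}=g_{i1}$ or $\alpha_{i1}=g_{i1}$ or $p_{i1k}=g_{i1}$. Moreover, for all real square matrices $Z$ and $Q$ of the same size, * (C1) $\sum_{i=2}^s b_i(Z)\alpha_{i1}^2\mathbb P_{i1}^2=2\varphi_3(Z)$, * (C2) $\sum_{i=2}^s b_i(Z)\alpha_{i1}^2g_{i1}\mathbb P_{i1}\mathbb P_{i2}=3\varphi_4(Z)$, * (C3) $\sum_{i=2}^s b_i(Z)\alpha_{i1}^3\mathbb P_{i1}^3=3!\,\varphi_4(Z)$, * (C4*) $\sum_{i=2}^s b_i(0)g_{i1}^2\alpha_{i1}^2\mathbb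 P_{i1}\mathbb P_{i3}=4\varphi_5(0)$, * (C5*) $\sum_{i=2}^s b_i(0)\alpha_{i1}^2g_{i1}^2\mathbb P_{i2}^2=3!\,\varphi_5(0)$, * (C6*) $\sum_{i=2}^s b_i(0)g_{i1}\alpha_{i1}^3\mathbb P_{i1}^2\mathbb P_{i2}=12\,\varphi_5(0)$, * (C7*) $\sum_{i=2}^s b_i(0)\alpha_{i1}^4\mathbb P_{i1}^4=4!\,\varphi_5(0)$, * (C8*) $\sum_{i=2}^s b_i(0)\alpha_{i1}\mathbb P_{i1}\,Q\,\Psi_i(Z)=0$. **Theorem.** Let all these assumptions hold and let $C_S$ be a constant. Then there are $\bar h>0$ and $C$ such that the following holds for every number of steps $M$ and all step sizes $0<h_\nu\le\bar h$ ($0\le\nu<M$), with grid points $t_n=t_0+\sum_{\nu<n}h_\nu$, $t_M\le T$, that satisfy the stability assumption $$\bigl\|e^{h_{n}J(u(t_{n}))}\cdots e^{h_{k+1}J(u(t_{k+1}))}e^{h_kJ(u(t_k))}\bigr\|\le C_S,\qquad 0\le k\le n<M.$$ The numerical solution $u_0=u(t_0),u_1,\dots,u_M$ (with $u_n\in D(L)$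 for $n<M$, so that $f(u_n)$ is defined) satisfies $$\|u_n-u(t_n)\|\le C\sum_{\nu=0}^{n-1}h_\nu^6,\qquad 0\le n\le M,$$ and in particular the method converges with order $5$: $\|u_n-u(t_n)\|\le C\,(\max_\nu h_\nu)^5$. The constant $C$ does not depend on the step size sequence. If only functions $\varphi_k(gz)$ with $g>0$ occur in $b_2,\dots,b_s$, then this numerical solution exists. -/

import Mathlib

open Set Filter Topology
open scoped NNReal Nat

namespace EPIRKConv

noncomputable section

/-! ### Strongly continuous semigroups and their generators -/

section Semigroup

variable {X : Type*} [NormedAddCommGroup X] [NormedSpace ℝ X]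

/-- `S` is a strongly continuous semigroup of bounded operators on `X`; only the values `S t` with
`0 ≤ t` are meaningful. -/
structure IsC0Semigroup (S : ℝ → X →L[ℝ] X) : Prop where
  map_zero : S 0 = ContinuousLinearMap.id ℝ X
  map_add : ∀ s t : ℝ, 0 ≤ s → 0 ≤ t → S (s + t) = (S s).comp (S t)
  tendsto_zero : ∀ x : X, Tendsto (fun t : ℝ => S t x) (𝓝[>] 0) (𝓝 x)

/-- The (possibly unbounded) operator `A` is the infinitesimal generator of `S`: its domain consists
of all `x` for which `lim_{t ↓ 0} (S t x - x) / t` exists, and `A x` is this limit. -/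
def IsInfinitesimalGenerator (A : X →ₗ.[ℝ] X) (S : ℝ → X →L[ℝ] X) : Prop :=
  ∀ x y : X, (x, y) ∈ A.graph ↔
    Tendsto (fun t : ℝ => t⁻¹ • (S t x - x)) (𝓝[>] 0) (𝓝 y)

/-- `A` is the generator of a strongly continuous semigroup. -/
def GeneratesC0Semigroup (A : X →ₗ.[ℝ] X) : Prop :=
  ∃ S : ℝ → X →L[ℝ] X, IsC0Semigroup S ∧ IsInfinitesimalGenerator A S

open Classical in
/-- `opExp A t = e^{tA}`, `t ≥ 0`, is the strongly continuous semigroup generated by `A` (which is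
unique; the value is `0` if `A` is not a generator). -/
def opExp (A : X →ₗ.[ℝ] X) : ℝ → X →L[ℝ] X :=
  if h : GeneratesC0Semigroup A then h.choose else fun _ => 0

/-- `phiOp k A τ v = φ_k(τ A) v = ∫₀¹ θ^{k-1} / (k-1)! e^{(1-θ) τ A} v dθ`, for `k ≥ 1`, `τ ≥ 0`. -/
def phiOp (k : ℕ+) (A : X →ₗ.[ℝ] X) (τ : ℝ) (v : X) : X :=
  ∫ θ in (0 : ℝ)..1, (θ ^ ((k : ℕ) - 1) / (((k : ℕ) - 1)! : ℝ)) • opExp A (τ * (1 - θ)) v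

end Semigroup

/-! ### Linear combinations of `φ`-functions -/

/-- The entire function `φ_k(z) = ∑ₙ zⁿ / (n + k)!`, at an element of a topological `ℝ`-algebra
(a real number or a square matrix); for `k ≥ 1` it is
`∫₀¹ e^{(1-θ) z} θ^{k-1} / (k-1)! dθ`. -/
def phi {R : Type*} [Ring R] [Algebra ℝ R] [TopologicalSpace R] (k : ℕ) (z : R) : R :=
  ∑' n : ℕ, (((n + k)! : ℝ)⁻¹) • z ^ n

/-- A finite linear combination `c(z) = ∑ w φ_k(g z)`, with `k ≥ 1`, `g ≥ 0` and real weights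
`w = c (k, g)`. -/
abbrev PhiComb : Type := (ℕ+ × ℝ≥0) →₀ ℝ

/-- `c(z)` for a real number or a square matrix `z`. -/
def PhiComb.eval {R : Type*} [Ring R] [Algebra ℝ R] [TopologicalSpace R] (c : PhiComb) (z : R) : R :=
  c.sum fun kg w => w • phi (kg.1 : ℕ) ((kg.2 : ℝ) • z)

/-- `c(τ A) v` for the generator `A` of a strongly continuous semigroup and `τ ≥ 0`. -/
def PhiComb.op {X : Type*} [NormedAddCommGroup X] [NormedSpace ℝ X]
    (c : PhiComb) (A : X →ₗ.[ℝ] X) (τ : ℝ) (v : X) : X :=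
  c.sum fun kg w => w • phiOp kg.1 A ((kg.2 : ℝ) * τ) v

/-! ### EPIRK methods -/

/-- The coefficients of an `s`-stage explicit (unpartitioned) EPIRK method
`U_{ni} = u_n + α_{i1} ψ_{i1}(g_{i1} h_n J_n) h_n f(u_n) + h_n ∑_{j=2}^{i-1} a_{ij}(h_n J_n) r(U_{nj})`,
`2 ≤ i ≤ s`,
`u_{n+1} = u_n + φ_1(h_n J_n) h_n f(u_n) + h_n ∑_{i=2}^{s} b_i(h_n J_n) r(U_{ni})`,
where `ψ_{i1}(z) = ∑_{k=1}^{K} p_{i1k} φ_k(z)`, and `a_{ij}`, `b_i` are arbitrary linear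
combinations of functions `φ_k(g z)`. Here `α i`, `g i`, `p i k` stand for `α_{i1}`, `g_{i1}`,
`p_{i1k}`. Only the values with `2 ≤ i ≤ s`, `2 ≤ j < i`, `1 ≤ k ≤ K` are used. -/
structure Method where
  s : ℕ
  K : ℕ+
  α : ℕ → ℝ
  g : ℕ → ℝ≥0
  p : ℕ → ℕ+ → ℝ
  a : ℕ → ℕ → PhiComb
  b : ℕ → PhiComb

namespace Method

variable (m : Method)

/-- `ψ_{i1}(g_{i1} z)`. -/
def psi (i : ℕ) : PhiComb :=
  ∑ k ∈ Finset.Icc 1 m.K, Finsupp.single (k, m.g i) (m.p i k)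

/-- `ℙ_{iq} = ∑_{k=1}^{K} p_{i1k} / (k + q - 1)!`, for `q = 1, 2, 3`. -/
def P (i q : ℕ) : ℝ :=
  ∑ k ∈ Finset.Icc 1 m.K, m.p i k / (((k : ℕ) + (q - 1))! : ℝ)

/-- `Ψ_i(z) = 1/2 ∑_{j=2}^{i-1} α_{j1}² ℙ_{j1}² a_{ij}(z)
  - α_{i1} g_{i1}² ∑_{k=1}^{K} p_{i1k} φ_{k+2}(g_{i1} z)`. -/
def bigPsi (i : ℕ) : PhiComb :=
  (1 / 2 : ℝ) • ∑ j ∈ Finset.Ico 2 i, (m.α j ^ 2 * m.P j 1 ^ 2) • m.a i j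
    - (m.α i * (m.g i : ℝ) ^ 2) •
        ∑ k ∈ Finset.Icc 1 m.K, Finsupp.single (k + 2, m.g i) (m.p i k)

/-- The restriction on the coefficients of the first terms of the internal stages. -/
def CoeffRestriction : Prop :=
  ∀ i ∈ Finset.Icc 2 m.s, ∀ k ∈ Finset.Icc 1 m.K,
    m.α i * m.p i k = m.g i ∨ m.α i = m.g i ∨ m.p i k = m.g i

/-- Conditions C1-C3 (for all square matrices `Z`) and the simplified conditions C4*-C8*
(for all square matrices `Z`, `Q` of the same size in C8*). -/
structure SimplifiedOrderConditions : Prop where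
  C1 : ∀ (d : ℕ) (Z : Matrix (Fin d) (Fin d) ℝ),
    ∑ i ∈ Finset.Icc 2 m.s, (m.α i ^ 2 * m.P i 1 ^ 2) • (m.b i).eval Z = (2 : ℝ) • phi 3 Z
  C2 : ∀ (d : ℕ) (Z : Matrix (Fin d) (Fin d) ℝ),
    ∑ i ∈ Finset.Icc 2 m.s, (m.α i ^ 2 * m.g i * m.P i 1 * m.P i 2) • (m.b i).eval Z
      = (3 : ℝ) • phi 4 Z
  C3 : ∀ (d : ℕ) (Z : Matrix (Fin d) (Fin d) ℝ),
    ∑ i ∈ Finset.Icc 2 m.s, (m.α i ^ 3 * m.P i 1 ^ 3) • (m.b i).eval Z = (3 ! : ℝ) • phi 4 Z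
  C4s : ∑ i ∈ Finset.Icc 2 m.s,
      (m.b i).eval (0 : ℝ) * (m.g i : ℝ) ^ 2 * m.α i ^ 2 * m.P i 1 * m.P i 3
    = 4 * phi 5 (0 : ℝ)
  C5s : ∑ i ∈ Finset.Icc 2 m.s,
      (m.b i).eval (0 : ℝ) * m.α i ^ 2 * (m.g i : ℝ) ^ 2 * m.P i 2 ^ 2
    = (3 ! : ℝ) * phi 5 (0 : ℝ)
  C6s : ∑ i ∈ Finset.Icc 2 m.s,
      (m.b i).eval (0 : ℝ) * m.g i * m.α i ^ 3 * m.P i 1 ^ 2 * m.P i 2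
    = 12 * phi 5 (0 : ℝ)
  C7s : ∑ i ∈ Finset.Icc 2 m.s, (m.b i).eval (0 : ℝ) * m.α i ^ 4 * m.P i 1 ^ 4
    = (4 ! : ℝ) * phi 5 (0 : ℝ)
  C8s : ∀ (d : ℕ) (Z Q : Matrix (Fin d) (Fin d) ℝ),
    ∑ i ∈ Finset.Icc 2 m.s,
      ((m.b i).eval (0 : ℝ) * m.α i * m.P i 1) • (Q * (m.bigPsi i).eval Z) = 0

end Method

/-! ### The initial value problem `u' = f(u) = L u + N(u)` and its discretization -/

section Problem

variable {X : Type*} [NormedAddCommGroup X] [NormedSpace ℝ X]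

/-- `f(x) = L x + N(x)`, for `x ∈ D(L)`. -/
def rhs (L : X →ₗ.[ℝ] X) (N : X → X) (x : L.domain) : X := L x + N x

/-- The Jacobian `J(x) = L + N'(x)`, with domain `D(L)`. -/
def jacobian (L : X →ₗ.[ℝ] X) (N : X → X) (x : X) : X →ₗ.[ℝ] X where
  domain := L.domain
  toFun := L.toFun + (fderiv ℝ N x : X →ₗ[ℝ] X).domRestrict L.domain

/-- The remainder `r(y) = f(y) - f(x) - J(x) (y - x) = N(y) - N(x) - N'(x) (y - x)` of the
linearization at `x`. The second expression makes sense for all `y`. -/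
def remainder (N : X → X) (x y : X) : X := N y - N x - fderiv ℝ N x (y - x)

/-- One step of the method `m` with step size `h` leads from `x ∈ D(L)` to `x'`. The vectors `U i`,
`2 ≤ i ≤ s`, are the internal stages. -/
def Method.IsStep (m : Method) (L : X →ₗ.[ℝ] X) (N : X → X) (h : ℝ) (x : L.domain) (x' : X) : Prop :=
  ∃ U : ℕ → X,
    (∀ i ∈ Finset.Icc 2 m.s,
      U i = (x : X) + (m.α i * h) • (m.psi i).op (jacobian L N x) h (rhs L N x)
        + h • ∑ j ∈ Finset.Ico 2 i, (m.a i j).op (jacobian L N x) h (remainder N x (U j))) ∧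
    x' = (x : X) + h • phiOp 1 (jacobian L N x) h (rhs L N x)
      + h • ∑ i ∈ Finset.Icc 2 m.s, (m.b i).op (jacobian L N x) h (remainder N x (U i))

/-- The grid points `t_n = t₀ + ∑_{ν < n} h_ν`. -/
def gridTime (t₀ : ℝ) (h : ℕ → ℝ) (n : ℕ) : ℝ := t₀ + ∑ ν ∈ Finset.range n, h ν

/-- `v 0, …, v M` is the numerical solution with initial value `u₀` and step sizes
`h 0, …, h (M - 1)`. As `f(v n)` has to be defined, `v n ∈ D(L)` for `n < M`. -/
def Method.IsNumericalSolution (m : Method) (L : X →ₗ.[ℝ] X) (N : X → X) (u₀ : X)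
    (M : ℕ) (h : ℕ → ℝ) (v : ℕ → X) : Prop :=
  v 0 = u₀ ∧ ∀ n < M, ∃ hn : v n ∈ L.domain, m.IsStep L N (h n) ⟨v n, hn⟩ (v (n + 1))

/-- The initial value problem possesses the solution `u` on `[t₀, T]`, which is five times
continuously differentiable in `X`, and `N` is five times continuously Fréchet differentiable in a
strip along `u`. -/
structure SmoothSolution (L : X →ₗ.[ℝ] X) (N : X → X) (t₀ T : ℝ) (u : ℝ → X) : Prop where
  smooth : ContDiffOn ℝ 5 u (Icc t₀ T)
  solves : ∀ t ∈ Icc t₀ T, ∃ ht : u t ∈ L.domain,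
    HasDerivWithinAt u (rhs L N ⟨u t, ht⟩) (Icc t₀ T) t
  strip : ∃ δ > 0, ContDiffOn ℝ 5 N (Metric.thickening δ (u '' Icc t₀ T))

/-- `x ∈ D(L)` and `‖L x‖ ≤ B`. -/
def LBound (L : X →ₗ.[ℝ] X) (B : ℝ) (x : X) : Prop := ∃ hx : x ∈ L.domain, ‖L ⟨x, hx⟩‖ ≤ B

/-- `Ñ(y) = f(y) - J(x) y = N(y) - N'(x) y`, the nonlinearity of the linearization at `x`. -/
def nonlin (N : X → X) (x y : X) : X := N y - fderiv ℝ N x y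

/-- The additional regularity: `L` applied to each of the elementary differentials below is bounded,
uniformly in `t ∈ [t₀, T]` and, for the last one, in the stage index and in the step sizes
`0 < h ≤ H`. -/
def AdditionalRegularity (m : Method) (L : X →ₗ.[ℝ] X) (N : X → X) (t₀ T : ℝ) (u : ℝ → X) : Prop :=
  ∃ B : ℝ, ∃ H > 0, ∀ t ∈ Icc t₀ T,
    let x : X := u t
    let d : ℕ → X := fun k => iteratedDerivWithin k u (Icc t₀ T) t
    let D2 := iteratedFDeriv ℝ 2 (nonlin N x) x
    let D3 := iteratedFDeriv ℝ 3 (nonlin N x) x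
    let D4 := iteratedFDeriv ℝ 4 (nonlin N x) x
    LBound L B (D2 ![d 1, d 3]) ∧
    LBound L B (D2 ![d 2, d 2]) ∧
    LBound L B (D3 ![d 1, d 1, d 2]) ∧
    LBound L B (D4 ![d 1, d 1, d 1, d 1]) ∧
    ∀ i ∈ Finset.Icc 2 m.s, ∀ h : ℝ, 0 < h → h ≤ H →
      LBound L B (D2 ![d 1, (m.bigPsi i).op (jacobian L N x) h (D2 ![d 1, d 1])])

/-- The discrete evolution operator
`e^{h_{k+l-1} J̃_{k+l-1}} ⋯ e^{h_{k+1} J̃_{k+1}} e^{h_k J̃_k}` (with `l` factors) along the exact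
solution, where `J̃_n = J(u(t_n))`. -/
def evolution (L : X →ₗ.[ℝ] X) (N : X → X) (t₀ : ℝ) (u : ℝ → X) (h : ℕ → ℝ) (k : ℕ) :
    ℕ → X →L[ℝ] X
  | 0 => ContinuousLinearMap.id ℝ X
  | l + 1 => (opExp (jacobian L N (u (gridTime t₀ h (k + l)))) (h (k + l))).comp
      (evolution L N t₀ u h k l)

/-- The stability assumption: all discrete evolution operators that belong to the `M` steps are
bounded by `Cs`. -/
def Stable (L : X →ₗ.[ℝ] X) (N : X → X) (t₀ : ℝ) (u : ℝ → X) (M : ℕ) (h : ℕ → ℝ) (Cs : ℝ) : Prop :=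
  ∀ k l : ℕ, 1 ≤ l → k + l ≤ M → ‖evolution L N t₀ u h k l‖ ≤ Cs

end Problem

end

end EPIRKConv

/-! The argument is consistency plus stability, arranged so that estimates only ever involve bounded
operators, because `L`, and with it `f`, is unbounded. Every `J(x)` is a bounded perturbation of
`L`. It therefore generates a semigroup (`generatesC0Semigroup_perturb`), and on a short time
interval these semigroups are uniformly bounded and Lipschitz in the perturbation
(`exists_uniform_opExp_bound`). So the operators `φ_k(g h J)` are uniformly bounded, and linear
relations between functions `φ_k(g z)` on the real line persist at `h J` (`PhiComb.opL_eq_zero`).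
All `O(hⁿ)` terms are taken along filters on `(t, h)` or `(t, h, y)`, which makes the constants
uniform in `t`.

Local error. Put `x = u(t)`, with `u', u'', u'''` taken at `t`. Variation of constants for the
problem linearized at `x`, together with Taylor's formula, gives `u(t + h) = x + h φ₁ u' + h³ φ₃
N''(u', u') + h⁴ φ₄ (3 N''(u', u'') + N'''(u', u', u')) + h⁵ φ₅ W + O(h⁶)`, with every `φ_k` taken
at `h J(x)`. Differentiating `L u = u' - N(u)` yields `J u' = u''`, `J u'' = u''' - N''(u', u')` and
a bounded `J u'''`. Hence the stages have an expansion whose `h³` coefficient contains `Ψ_i(h J)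
N''(u', u')` (`SolutionFamily.stage_expansion`), and the numerical solution acquires the same
structure with sums of `b_i(h J)` in place of the `φ_k`. C1-C3 match the orders `h³` and `h⁴`
exactly. At order `h⁵` the additional regularity allows `b_i(h J)` and `φ₅(h J)` to be replaced by
their values at `0` at the price of a factor `h` (`BddImage.opL_sub_opow`), after which C4*-C8*
suffice. This is `SmoothSolution.local_error`.

Propagation. Starting a step at `y` instead of `x` changes the result by `e^{h J(x)} (y - x) + O(h
‖y - x‖)` (`NearbyFamily.step_sub`). The difference of `f(y)` and `f(x)` is not controlled by `‖y -
x‖`; but `f(y) = J(y) y + nonlin N y y`, and `z φ_{k+1}(z) = φ_k(z) - 1/k!` trades the unbounded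
factor for bounded operators applied to `y`. If `g_{i1} = 0` this is impossible, and the restriction
on the coefficients removes the term.

Thus the global error satisfies `e_{n+1} = e^{h_n J} e_n + defect`, with defect `O(h_n ‖e_n‖ +
h_n⁶)`. The stability assumption sums the defects, and a discrete Gronwall argument, which also
keeps the numerical solution near the exact one, concludes (`sum_le_of_recursive_bound`). -/

namespace EPIRKConv

/-! ### Basic properties of strongly continuous semigroups -/

section SemigroupBasics

variable {X : Type*} [NormedAddCommGroup X] [NormedSpace ℝ X]

namespace IsC0Semigroup

variable {S : ℝ → X →L[ℝ] X}

theorem map_zero_apply (hS : IsC0Semigroup S) (x : X) : S 0 x = x := by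
  simp [hS.map_zero]

theorem map_add_apply (hS : IsC0Semigroup S) {s t : ℝ} (hs : 0 ≤ s) (ht : 0 ≤ t) (x : X) :
    S (s + t) x = S s (S t x) := by
  simp [hS.map_add s t hs ht]

theorem comm_apply (hS : IsC0Semigroup S) {s t : ℝ} (hs : 0 ≤ s) (ht : 0 ≤ t) (x : X) :
    S s (S t x) = S t (S s x) := by
  rw [← hS.map_add_apply hs ht, ← hS.map_add_apply ht hs, add_comm]

/-- Nothing is known about `S t` for `t < 0`. Truncating time at `0` gives a function on the whole
line, so that ordinary continuity can be used. -/
theorem tendsto_zero_max (hS : IsC0Semigroup S) (x : X) :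
    Tendsto (fun t => S (max t 0) x) (𝓝 0) (𝓝 x) := by
  have h1 : Tendsto (fun r => S r x) (𝓝[≥] 0) (𝓝 x) := by
    rw [← Ioi_insert, nhdsWithin_insert, tendsto_sup]
    refine ⟨?_, hS.tendsto_zero x⟩
    rw [tendsto_pure_left]
    intro s hs
    rw [hS.map_zero_apply]
    exact mem_of_mem_nhds hs
  refine h1.comp (tendsto_nhdsWithin_iff.2 ⟨?_, Eventually.of_forall fun t => le_max_right t 0⟩)
  have : Continuous fun t : ℝ => max t 0 := by fun_prop
  simpa using this.tendsto 0

/-- Otherwise there are `t n → 0` with `‖S (t n)‖ > n`, although `S (t n) x` converges for every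
`x`; this contradicts the uniform boundedness principle. -/
theorem exists_bound_near_zero [CompleteSpace X] (hS : IsC0Semigroup S) :
    ∃ δ > 0, ∃ M : ℝ, ∀ t ∈ Icc 0 δ, ‖S t‖ ≤ M := by
  by_contra! hcon
  have h1 : ∀ n : ℕ, ∃ t ∈ Icc (0 : ℝ) (1 / ((n : ℝ) + 1)), (n : ℝ) < ‖S t‖ := fun n =>
    hcon _ Nat.one_div_pos_of_nat n
  choose t ht hnt using h1
  have hlim : Tendsto t atTop (𝓝 0) :=
    squeeze_zero (fun n => (ht n).1) (fun n => (ht n).2) tendsto_one_div_add_atTop_nhds_zero_nat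
  have hbd : ∀ x : X, ∃ C, ∀ n, ‖S (t n) x‖ ≤ C := by
    intro x
    have hx' : Tendsto (fun n => S (t n) x) atTop (𝓝 x) :=
      ((hS.tendsto_zero_max x).comp hlim).congr fun n => by simp [max_eq_left (ht n).1]
    obtain ⟨C, hC⟩ := hx'.norm.bddAbove_range
    exact ⟨C, fun n => hC ⟨n, rfl⟩⟩
  obtain ⟨C, hC⟩ := banach_steinhaus hbd
  obtain ⟨n, hn⟩ := exists_nat_gt C
  exact absurd (hC n) (not_le.2 (hn.trans (hnt n)))

theorem exists_exp_bound [CompleteSpace X] (hS : IsC0Semigroup S) :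
    ∃ M : ℝ, 1 ≤ M ∧ ∃ ω : ℝ, 0 ≤ ω ∧ ∀ t, 0 ≤ t → ‖S t‖ ≤ M * Real.exp (ω * t) := by
  obtain ⟨δ, hδ, M₀, hM₀⟩ := hS.exists_bound_near_zero
  set M := max M₀ 1 with hMdef
  have hM1 : 1 ≤ M := le_max_right _ _
  have hMpos : 0 < M := by linarith
  have hM : ∀ t ∈ Icc 0 δ, ‖S t‖ ≤ M := fun t ht => (hM₀ t ht).trans (le_max_left _ _)
  have hlog : 0 ≤ Real.log M := Real.log_nonneg hM1
  have key : ∀ n : ℕ, ∀ r ∈ Icc 0 δ, ‖S (n * δ + r)‖ ≤ M ^ n * M := by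
    intro n
    induction n with
    | zero => intro r hr; simpa using hM r hr
    | succ n ih =>
      intro r hr
      have : ((n + 1 : ℕ) : ℝ) * δ + r = δ + (n * δ + r) := by push_cast; ring
      rw [this, hS.map_add _ _ hδ.le (by have := hr.1; positivity)]
      refine (ContinuousLinearMap.opNorm_comp_le _ _).trans ?_
      calc ‖S δ‖ * ‖S (n * δ + r)‖ ≤ M * (M ^ n * M) :=
            mul_le_mul (hM δ ⟨hδ.le, le_rfl⟩) (ih r hr) (norm_nonneg _) hMpos.le
        _ = M ^ (n + 1) * M := by ring
  -- With `t = n δ + r`, the bound `M ^ n * M` becomes exponential because `M ^ n = exp (n log M)`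
  -- and `n ≤ t / δ`; `1 ≤ M` makes the rate nonnegative.
  refine ⟨M, hM1, Real.log M / δ, by positivity, fun t ht => ?_⟩
  set n := ⌊t / δ⌋₊
  have h1 : (n : ℝ) * δ ≤ t := by
    rw [← le_div_iff₀ hδ]; exact Nat.floor_le (by positivity)
  have h2 : t < (n + 1 : ℝ) * δ := by
    rw [← div_lt_iff₀ hδ]; exact Nat.lt_floor_add_one _
  have h3 := key n (t - n * δ) ⟨by linarith, by linarith⟩
  rw [add_sub_cancel] at h3
  refine h3.trans ?_
  rw [mul_comm]
  refine mul_le_mul_of_nonneg_left ?_ hMpos.le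
  rw [← Real.exp_log hMpos, ← Real.exp_nat_mul, Real.log_exp]
  refine Real.exp_le_exp.2 ?_
  have : (n : ℝ) ≤ t / δ := by rwa [le_div_iff₀ hδ]
  calc (n : ℝ) * Real.log M ≤ t / δ * Real.log M := by gcongr
    _ = Real.log M / δ * t := by ring

theorem exists_bound [CompleteSpace X] (hS : IsC0Semigroup S) (a : ℝ) :
    ∃ M : ℝ, 0 ≤ M ∧ ∀ t ∈ Icc 0 a, ‖S t‖ ≤ M := by
  obtain ⟨M, hM, ω, hω, h⟩ := hS.exists_exp_bound
  refine ⟨M * Real.exp (ω * a), by positivity, fun t ht => (h t ht.1).trans ?_⟩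
  have := ht.2
  gcongr

/-- The semigroup at the smaller of the two times factors out. The redundant maximum matches
`tendsto_zero_max`. -/
theorem norm_sub_le (hS : IsC0Semigroup S) {M s t : ℝ} (hs : 0 ≤ s) (ht : 0 ≤ t)
    (hsM : ‖S s‖ ≤ M) (htM : ‖S t‖ ≤ M) (x : X) :
    ‖S s x - S t x‖ ≤ M * ‖S (max |s - t| 0) x - x‖ := by
  rw [max_eq_left (abs_nonneg _)]
  rcases le_total s t with h | h
  · have h1 : S t x = S s (S (t - s) x) := by
      rw [← hS.map_add_apply hs (sub_nonneg.2 h)]; congr 2; ring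
    rw [abs_sub_comm, abs_of_nonneg (sub_nonneg.2 h), h1, ← map_sub, norm_sub_rev (S (t - s) x)]
    exact (S s).le_of_opNorm_le hsM _
  · have h1 : S s x = S t (S (s - t) x) := by
      rw [← hS.map_add_apply ht (sub_nonneg.2 h)]; congr 2; ring
    rw [abs_of_nonneg (sub_nonneg.2 h), h1, ← map_sub]
    exact (S t).le_of_opNorm_le htM _

/-- Strong continuity and local boundedness give joint continuity, by splitting `S(s) y - S(t) x`
into `S(s) (y - x)` and `S(s) x - S(t) x`. -/
theorem continuous_max [CompleteSpace X] (hS : IsC0Semigroup S) :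
    Continuous fun p : ℝ × X => S (max p.1 0) p.2 := by
  rw [continuous_iff_continuousAt]
  rintro ⟨t, x⟩
  obtain ⟨M, hM0, hM⟩ := hS.exists_bound (max t 0 + 1)
  have hmax : Continuous fun p : ℝ × X => max p.1 0 := by fun_prop
  have hev : ∀ᶠ p : ℝ × X in 𝓝 (t, x), max p.1 0 < max t 0 + 1 :=
    (hmax.tendsto (t, x)).eventually (gt_mem_nhds (by simp))
  rw [ContinuousAt, tendsto_iff_norm_sub_tendsto_zero]
  have h1 : Tendsto (fun p : ℝ × X => S (max |max p.1 0 - max t 0| 0) x - x) (𝓝 (t, x))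
      (𝓝 0) := by
    rw [← sub_self x]
    refine Tendsto.sub_const ((hS.tendsto_zero_max x).comp ?_) x
    have : Continuous fun p : ℝ × X => |max p.1 0 - max t 0| := by fun_prop
    simpa using this.tendsto (t, x)
  have h2 : Tendsto (fun p : ℝ × X => p.2 - x) (𝓝 (t, x)) (𝓝 0) := by
    have : Continuous fun p : ℝ × X => p.2 - x := by fun_prop
    simpa using this.tendsto (t, x)
  have h3 : Tendsto (fun p : ℝ × X => M * ‖p.2 - x‖
      + M * ‖S (max |max p.1 0 - max t 0| 0) x - x‖) (𝓝 (t, x)) (𝓝 0) := by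
    simpa using (h2.norm.const_mul M).add (h1.norm.const_mul M)
  refine squeeze_zero' (Eventually.of_forall fun _ => norm_nonneg _) ?_ h3
  filter_upwards [hev] with p hp
  have hpM := hM (max p.1 0) ⟨le_max_right _ _, hp.le⟩
  have htM := hM (max t 0) ⟨le_max_right _ _, by simp⟩
  calc ‖S (max p.1 0) p.2 - S (max t 0) x‖
      = ‖S (max p.1 0) (p.2 - x) + (S (max p.1 0) x - S (max t 0) x)‖ := by
        rw [map_sub]; congr 1; abel
    _ ≤ _ := (norm_add_le _ _).trans (add_le_add ((S _).le_of_opNorm_le hpM _)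
        (hS.norm_sub_le (le_max_right _ _) (le_max_right _ _) hpM htM x))

theorem continuousOn_apply [CompleteSpace X] (hS : IsC0Semigroup S) {Y : Type*}
    [TopologicalSpace Y] {s : Set Y} {τ : Y → ℝ} {w : Y → X} (hτ : ContinuousOn τ s)
    (hτ0 : ∀ y ∈ s, 0 ≤ τ y) (hw : ContinuousOn w s) :
    ContinuousOn (fun y => S (τ y) (w y)) s := by
  refine (hS.continuous_max.comp_continuousOn (hτ.prodMk hw)).congr fun y hy => ?_
  simp [max_eq_left (hτ0 y hy)]

theorem intervalIntegrable_apply [CompleteSpace X] (hS : IsC0Semigroup S) {a b : ℝ}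
    (ha : 0 ≤ a) (hb : 0 ≤ b) (x : X) :
    IntervalIntegrable (fun s => S s x) MeasureTheory.volume a b :=
  (hS.continuousOn_apply continuousOn_id (fun _ hy => (le_min ha hb).trans hy.1)
    continuousOn_const).intervalIntegrable

end IsC0Semigroup

/-! ### Generators: closedness, density of the domain, differentiability of orbits. -/

namespace IsInfinitesimalGenerator

variable {S : ℝ → X →L[ℝ] X} {A : X →ₗ.[ℝ] X}

theorem map_mem_graph (hA : IsInfinitesimalGenerator A S) {C : X →L[ℝ] X}
    (hC : ∀ t, 0 ≤ t → ∀ x, C (S t x) = S t (C x)) {x y : X} (h : (x, y) ∈ A.graph) :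
    (C x, C y) ∈ A.graph := by
  rw [hA] at h ⊢
  refine ((C.continuous.tendsto y).comp h).congr' ?_
  filter_upwards [self_mem_nhdsWithin] with t ht
  simp [hC t (le_of_lt ht)]

theorem semigroup_mem_graph (hA : IsInfinitesimalGenerator A S) (hS : IsC0Semigroup S) {t : ℝ}
    (ht : 0 ≤ t) {x y : X} (h : (x, y) ∈ A.graph) : (S t x, S t y) ∈ A.graph :=
  hA.map_mem_graph (fun _ hs x => hS.comm_apply ht hs x) h

/-- The definition of the generator yields only right derivatives of the orbit, and a fundamental
theorem of calculus for right derivatives suffices. -/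
theorem sub_eq_integral [CompleteSpace X] (hA : IsInfinitesimalGenerator A S)
    (hS : IsC0Semigroup S) {t : ℝ} (ht : 0 ≤ t) {x y : X} (h : (x, y) ∈ A.graph) :
    S t x - x = ∫ s in (0 : ℝ)..t, S s y := by
  have hr : ∀ s ∈ Ioo (min 0 t) (max 0 t), HasDerivWithinAt (fun r => S r x) (S s y) (Ioi s) s := by
    intro s hs
    rw [min_eq_left ht] at hs
    have h1 := (hA _ _).1 (hA.semigroup_mem_graph hS hs.1.le h)
    rw [hasDerivWithinAt_iff_tendsto_slope' (by simp)]
    have h2 : Tendsto (fun r : ℝ => r - s) (𝓝[>] s) (𝓝[>] 0) := by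
      refine tendsto_nhdsWithin_iff.2 ⟨?_, ?_⟩
      · have : Continuous fun r : ℝ => r - s := by fun_prop
        exact (by simpa using this.tendsto s : Tendsto _ _ _).mono_left nhdsWithin_le_nhds
      · filter_upwards [self_mem_nhdsWithin] with r hr
        simpa using hr
    refine (h1.comp h2).congr' ?_
    filter_upwards [self_mem_nhdsWithin] with r hr
    have hr : s < r := hr
    simp only [Function.comp, slope, vsub_eq_sub]
    rw [← hS.map_add_apply (by linarith) hs.1.le]
    simp
  have := intervalIntegral.integral_eq_sub_of_hasDeriv_right (a := 0) (b := t) ?_ hr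
    (hS.intervalIntegrable_apply le_rfl ht y)
  · rw [this, hS.map_zero_apply]
  · exact hS.continuousOn_apply continuousOn_id
      (fun s hs => by rw [uIcc_of_le ht] at hs; exact hs.1) continuousOn_const

theorem tendsto_average [CompleteSpace X] (hS : IsC0Semigroup S) {y : ℝ → X} (hy : Continuous y) :
    Tendsto (fun t : ℝ => t⁻¹ • ∫ s in (0 : ℝ)..t, S (max s 0) (y s)) (𝓝[>] 0) (𝓝 (y 0)) := by
  have hc : Continuous fun s : ℝ => S (max s 0) (y s) :=
    hS.continuous_max.comp (continuous_id.prodMk hy)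
  have h1 := (hc.integral_hasStrictDerivAt 0 0).hasDerivAt.hasDerivWithinAt (s := Ioi 0)
  rw [hasDerivWithinAt_iff_tendsto_slope' (by simp)] at h1
  rw [max_self, hS.map_zero_apply] at h1
  exact h1.congr fun t => by simp [slope]

theorem mem_graph_of_sub_eq_integral [CompleteSpace X] (hA : IsInfinitesimalGenerator A S)
    (hS : IsC0Semigroup S) {x y : X} (h : ∀ t, 0 < t → S t x - x = ∫ s in (0 : ℝ)..t, S s y) :
    (x, y) ∈ A.graph := by
  rw [hA]
  refine (tendsto_average hS (continuous_const (y := y))).congr' ?_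
  filter_upwards [self_mem_nhdsWithin] with t ht
  have ht : 0 < t := ht
  rw [h t ht]
  congr 1
  refine intervalIntegral.integral_congr fun s hs => ?_
  rw [uIcc_of_le ht.le] at hs
  simp [max_eq_left hs.1]

/-- By the integrated identity, membership in the graph is a family of equations between continuous
functions of `(x, y)`, one for each `t > 0`; no limit of difference quotients is left. -/
theorem isClosed_graph [CompleteSpace X] (hA : IsInfinitesimalGenerator A S)
    (hS : IsC0Semigroup S) : IsClosed (A.graph : Set (X × X)) := by
  have : (A.graph : Set (X × X)) = ⋂ t ∈ Ioi (0 : ℝ),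
      {p : X × X | S t p.1 - p.1 = ∫ s in (0 : ℝ)..t, S (max s 0) p.2} := by
    ext ⟨x, y⟩
    have hcongr : ∀ t, 0 < t →
        ∫ s in (0 : ℝ)..t, S (max s 0) y = ∫ s in (0 : ℝ)..t, S s y := by
      intro t ht
      refine intervalIntegral.integral_congr fun s hs => ?_
      rw [uIcc_of_le ht.le] at hs
      simp [max_eq_left hs.1]
    simp only [SetLike.mem_coe, mem_iInter, mem_ofPred_eq, mem_Ioi]
    constructor
    · intro h t ht
      rw [hcongr t ht]
      exact hA.sub_eq_integral hS ht.le h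
    · intro h
      exact hA.mem_graph_of_sub_eq_integral hS fun t ht => by rw [h t ht, hcongr t ht]
  rw [this]
  refine isClosed_biInter fun t _ => isClosed_eq (by fun_prop) ?_
  refine intervalIntegral.continuous_parametric_intervalIntegral_of_continuous' ?_ 0 t
  exact hS.continuous_max.comp (continuous_snd.prodMk (continuous_snd.comp continuous_fst))

/-- After a shift of the integration variable, `S r ∫₀ᵗ - ∫₀ᵗ = ∫ₜᵗ⁺ʳ - ∫₀ʳ`, which equals `∫₀ʳ S s
(S t x - x) ds`; divided by `r` it tends to `S t x - x`. -/
theorem integral_mem_graph [CompleteSpace X] (hA : IsInfinitesimalGenerator A S)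
    (hS : IsC0Semigroup S) {t : ℝ} (ht : 0 ≤ t) (x : X) :
    (∫ s in (0 : ℝ)..t, S s x, S t x - x) ∈ A.graph := by
  rw [hA]
  have h1 : Tendsto (fun r : ℝ => r⁻¹ • ∫ s in (0 : ℝ)..r, S s (S t x - x)) (𝓝[>] 0)
      (𝓝 (S t x - x)) := by
    refine (tendsto_average hS (continuous_const (y := S t x - x))).congr' ?_
    filter_upwards [self_mem_nhdsWithin] with r hr
    have hr : 0 < r := hr
    congr 1
    refine intervalIntegral.integral_congr fun s hs => ?_
    rw [uIcc_of_le hr.le] at hs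
    simp [max_eq_left hs.1]
  refine h1.congr' ?_
  filter_upwards [self_mem_nhdsWithin] with r hr
  have hr : 0 < r := hr
  congr 1
  have hi : ∀ a b : ℝ, 0 ≤ a → 0 ≤ b →
      IntervalIntegrable (fun s => S s x) MeasureTheory.volume a b :=
    fun a b ha hb => hS.intervalIntegrable_apply ha hb x
  have e1 : S r (∫ s in (0 : ℝ)..t, S s x) = ∫ s in r..(t + r), S s x := by
    rw [← ContinuousLinearMap.intervalIntegral_comp_comm _ (hi 0 t le_rfl ht)]
    have := intervalIntegral.integral_comp_add_right (a := 0) (b := t) (fun s => S s x) r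
    rw [zero_add] at this
    rw [← this]
    refine intervalIntegral.integral_congr fun s hs => ?_
    rw [uIcc_of_le ht] at hs
    rw [add_comm, hS.map_add_apply hr.le hs.1]
  have e2 : ∫ s in (0 : ℝ)..r, S s (S t x) = ∫ s in t..(t + r), S s x := by
    have := intervalIntegral.integral_comp_add_right (a := 0) (b := r) (fun s => S s x) t
    rw [zero_add, add_comm r t] at this
    rw [← this]
    refine intervalIntegral.integral_congr fun s hs => ?_
    rw [uIcc_of_le hr.le] at hs
    rw [hS.map_add_apply hs.1 ht]
  simp only [map_sub]
  rw [intervalIntegral.integral_sub (hS.intervalIntegrable_apply le_rfl hr.le _)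
    (hS.intervalIntegrable_apply le_rfl hr.le _), e1, e2,
    ← intervalIntegral.integral_interval_sub_interval_comm' (hi _ _ (by linarith) (by linarith))
      (hi _ _ le_rfl (by linarith)) (hi _ _ (by linarith) le_rfl)]

/-- The averages `t⁻¹ ∫₀ᵗ S s x ds` lie in the domain and tend to `x`. -/
theorem mem_closure_domain [CompleteSpace X] (hA : IsInfinitesimalGenerator A S)
    (hS : IsC0Semigroup S) (x : X) : x ∈ closure (A.domain : Set X) := by
  refine mem_closure_of_tendsto (tendsto_average hS (continuous_const (y := x))) ?_
  filter_upwards [self_mem_nhdsWithin] with t ht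
  have ht : 0 < t := ht
  refine A.domain.smul_mem _ ?_
  have := LinearPMap.mem_domain_of_mem_graph (hA.integral_mem_graph hS ht.le x)
  convert this using 1
  refine intervalIntegral.integral_congr fun s hs => ?_
  rw [uIcc_of_le ht.le] at hs
  simp [max_eq_left hs.1]

theorem hasDerivAt [CompleteSpace X] (hA : IsInfinitesimalGenerator A S)
    (hS : IsC0Semigroup S) {t : ℝ} (ht : 0 < t) {x y : X} (h : (x, y) ∈ A.graph) :
    HasDerivAt (fun r => S r x) (S t y) t := by
  have hc : Continuous fun s : ℝ => S (max s 0) y :=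
    hS.continuous_max.comp (continuous_id.prodMk continuous_const)
  have h1 := ((hc.integral_hasStrictDerivAt 0 t).hasDerivAt).const_add x
  rw [max_eq_left ht.le] at h1
  refine h1.congr_of_eventuallyEq ?_
  filter_upwards [lt_mem_nhds ht] with r hr
  rw [← sub_eq_iff_eq_add', hA.sub_eq_integral hS hr.le h]
  refine intervalIntegral.integral_congr fun s hs => ?_
  rw [uIcc_of_le hr.le] at hs
  simp [max_eq_left hs.1]

end IsInfinitesimalGenerator

end SemigroupBasics

/-! ### Bounded perturbations of generators -/

section Perturbation

open BoundedContinuousFunction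

variable {X : Type*} [NormedAddCommGroup X] [NormedSpace ℝ X]

/-- The operator `A + B` with domain `D(A)`, where `B` is bounded. -/
noncomputable def perturb (A : X →ₗ.[ℝ] X) (B : X →L[ℝ] X) : X →ₗ.[ℝ] X where
  domain := A.domain
  toFun := A.toFun + (B : X →ₗ[ℝ] X).domRestrict A.domain

theorem mem_graph_perturb {A : X →ₗ.[ℝ] X} {B : X →L[ℝ] X} {x y : X} :
    (x, y) ∈ (perturb A B).graph ↔ (x, y - B x) ∈ A.graph := by
  simp only [LinearPMap.mem_graph_iff]
  constructor
  · rintro ⟨z, hz, rfl⟩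
    refine ⟨z, hz, ?_⟩
    subst hz
    change A z = A z + B z - B z
    simp
  · rintro ⟨z, hz, h⟩
    refine ⟨z, hz, ?_⟩
    subst hz
    change A z + B z = y
    rw [h]; simp

theorem integral_exp_neg_mul_sub_le {a : ℝ} (ha : 0 < a) (t : ℝ) :
    ∫ s in (0 : ℝ)..t, Real.exp (-(a * (t - s))) ≤ a⁻¹ := by
  have h : ∀ s ∈ uIcc 0 t, HasDerivAt (fun s => a⁻¹ * Real.exp (-(a * (t - s))))
      (Real.exp (-(a * (t - s)))) s := by
    intro s _
    have h1 : HasDerivAt (fun s => -(a * (t - s))) a s := by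
      have h2 : HasDerivAt (fun s => a * s - a * t) a s := by
        simpa using ((hasDerivAt_id s).const_mul a).sub_const (a * t)
      exact h2.congr_of_eventuallyEq (Eventually.of_forall fun r => by ring)
    refine (h1.exp.const_mul a⁻¹).congr_deriv ?_
    field_simp
  rw [intervalIntegral.integral_eq_sub_of_hasDerivAt h (Continuous.intervalIntegrable
    (by fun_prop) _ _)]
  simp only [sub_self, mul_zero, neg_zero, Real.exp_zero, mul_one]
  have : 0 ≤ a⁻¹ * Real.exp (-(a * (t - 0))) := by positivity
  linarith

/-- Unique solvability of a linear Volterra equation with an exponentially decaying kernel in the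
space of bounded continuous functions. -/
theorem exists_volterra_solution [CompleteSpace X] {R : ℝ → X →L[ℝ] X}
    (hR : Continuous fun p : ℝ × X => R p.1 p.2) (hR0 : ∀ t, t ≤ 0 → ‖R t‖ ≤ 1) {M a : ℝ}
    (ha : 0 < a) (hRM : ∀ t, 0 ≤ t → ‖R t‖ ≤ M * Real.exp (-(a * t)))
    (B : X →L[ℝ] X) (hB : M * ‖B‖ ≤ a / 2) :
    ∃ W : X →L[ℝ] (ℝ →ᵇ X), ∀ (x : X) (w : ℝ →ᵇ X), w = W x ↔
      ∀ t, w t = R t x + ∫ s in (0 : ℝ)..max t 0, R (max t 0 - s) (B (w s)) := by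
  have hM : 0 ≤ M := by
    have := (norm_nonneg _).trans (hRM 0 le_rfl)
    simpa using this
  have hcont : ∀ w : ℝ →ᵇ X, Continuous fun p : ℝ × ℝ => R (max p.1 0 - p.2) (B (w p.2)) := by
    intro w
    have : Continuous fun p : ℝ × ℝ => (max p.1 0 - p.2, B (w p.2)) := by fun_prop
    exact hR.comp this
  have hintegrable : ∀ (w : ℝ →ᵇ X) (t b : ℝ),
      IntervalIntegrable (fun s => R (max t 0 - s) (B (w s))) MeasureTheory.volume 0 b :=
    fun w t b => ((hcont w).comp (Continuous.prodMk_right t)).intervalIntegrable _ _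
  -- The Volterra operator has norm at most `M ‖B‖ a⁻¹ ≤ 1/2` on the whole half-line, thanks to the
  -- decay of the kernel.
  have hKbound : ∀ (w : ℝ →ᵇ X) (t : ℝ),
      ‖∫ s in (0 : ℝ)..max t 0, R (max t 0 - s) (B (w s))‖ ≤ 1 / 2 * ‖w‖ := by
    intro w t
    have h0 : 0 ≤ max t 0 := le_max_right _ _
    calc ‖∫ s in (0 : ℝ)..max t 0, R (max t 0 - s) (B (w s))‖
        ≤ ∫ s in (0 : ℝ)..max t 0, M * ‖B‖ * ‖w‖ * Real.exp (-(a * (max t 0 - s))) := by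
          refine intervalIntegral.norm_integral_le_of_norm_le h0 ?_
            (Continuous.intervalIntegrable (by fun_prop) _ _)
          refine Eventually.of_forall fun s hs => ?_
          have h1 := hRM (max t 0 - s) (by linarith [hs.2])
          calc ‖R (max t 0 - s) (B (w s))‖
              ≤ M * Real.exp (-(a * (max t 0 - s))) * (‖B‖ * ‖w‖) :=
                (R _).le_of_opNorm_le_of_le h1 (B.le_of_opNorm_le_of_le le_rfl (w.norm_coe_le_norm s))
            _ = _ := by ring
      _ = M * ‖B‖ * ‖w‖ * ∫ s in (0 : ℝ)..max t 0, Real.exp (-(a * (max t 0 - s))) := by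
          rw [intervalIntegral.integral_const_mul]
      _ ≤ (a / 2) * ‖w‖ * a⁻¹ := by
          have := integral_exp_neg_mul_sub_le ha (max t 0)
          have h1 : 0 ≤ ∫ s in (0 : ℝ)..max t 0, Real.exp (-(a * (max t 0 - s))) :=
            intervalIntegral.integral_nonneg h0 fun s _ => (Real.exp_pos _).le
          gcongr
      _ = 1 / 2 * ‖w‖ := by field_simp
  let Kfun : (ℝ →ᵇ X) → (ℝ →ᵇ X) := fun w =>
    BoundedContinuousFunction.ofNormedAddCommGroup
      (fun t => ∫ s in (0 : ℝ)..max t 0, R (max t 0 - s) (B (w s)))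
      (intervalIntegral.continuous_parametric_intervalIntegral_of_continuous (hcont w)
        (by fun_prop)) (1 / 2 * ‖w‖) (hKbound w)
  let K : (ℝ →ᵇ X) →L[ℝ] (ℝ →ᵇ X) := LinearMap.mkContinuous
    { toFun := Kfun
      map_add' := fun w z => by
        ext t
        simp only [Kfun, coe_ofNormedAddCommGroup, coe_add, Pi.add_apply, map_add]
        exact intervalIntegral.integral_add (hintegrable w t _) (hintegrable z t _)
      map_smul' := fun c w => by
        ext t
        simp only [Kfun, coe_ofNormedAddCommGroup, coe_smul, map_smul, RingHom.id_apply]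
        exact intervalIntegral.integral_smul _ _ } (1 / 2)
    (fun w => (norm_le (by positivity)).2 fun t => hKbound w t)
  have hKnorm : ‖K‖ < 1 :=
    lt_of_le_of_lt (LinearMap.mkContinuous_norm_le _ (by norm_num) _) (by norm_num)
  have hIb : ∀ x t, ‖R t x‖ ≤ max M 1 * ‖x‖ := by
    intro x t
    refine (R t).le_of_opNorm_le ?_ x
    rcases le_total t 0 with h | h
    · exact (hR0 t h).trans (le_max_right _ _)
    · refine (hRM t h).trans (le_trans ?_ (le_max_left _ _))
      have : Real.exp (-(a * t)) ≤ 1 := by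
        rw [Real.exp_le_one_iff]; have := mul_nonneg ha.le h; linarith
      nlinarith
  let I : X →L[ℝ] (ℝ →ᵇ X) := LinearMap.mkContinuous
    { toFun := fun x => BoundedContinuousFunction.ofNormedAddCommGroup (fun t => R t x)
        (hR.comp (Continuous.prodMk_left x)) (max M 1 * ‖x‖) (hIb x)
      map_add' := fun x y => by ext t; simp
      map_smul' := fun c x => by ext t; simp } (max M 1)
    (fun x => (norm_le (by positivity)).2 fun t => hIb x t)
  -- The equation reads `(1 - K) w = I x`, and `1 - K` is invertible by the Neumann series. Solving
  -- it by an operator gives linear and continuous dependence on `x` at once.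
  obtain ⟨V, hV⟩ := isUnit_one_sub_of_norm_lt_one hKnorm
  refine ⟨(V⁻¹ : Units ((ℝ →ᵇ X) →L[ℝ] (ℝ →ᵇ X))).val.comp I, fun x w => ?_⟩
  have h1 : w = ((V⁻¹ : Units ((ℝ →ᵇ X) →L[ℝ] (ℝ →ᵇ X))).val.comp I) x ↔ w - K w = I x := by
    have hV' : ∀ z, (V : (ℝ →ᵇ X) →L[ℝ] (ℝ →ᵇ X)) z = z - K z := fun z => by rw [hV]; rfl
    constructor
    · intro h
      rw [← hV', h, ContinuousLinearMap.comp_apply, ← mul_apply_eq_comp, V.mul_inv]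
      rfl
    · intro h
      rw [ContinuousLinearMap.comp_apply, ← h, ← hV', ← mul_apply_eq_comp, V.inv_mul]
      rfl
  rw [h1, sub_eq_iff_eq_add, BoundedContinuousFunction.ext_iff]
  rfl

/-- Here the integrand may also depend on the upper limit, as it does in a Duhamel integral. -/
theorem tendsto_average_of_continuous [CompleteSpace X] {F : ℝ → ℝ → X} (hF : Continuous F.uncurry) :
    Tendsto (fun t : ℝ => t⁻¹ • ∫ s in (0 : ℝ)..t, F t s) (𝓝[>] 0) (𝓝 (F 0 0)) := by
  rw [Metric.tendsto_nhdsWithin_nhds]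
  intro ε hε
  obtain ⟨δ, hδ, h⟩ := Metric.tendsto_nhds_nhds.1 (hF.tendsto (0, 0)) (ε / 2) (by positivity)
  refine ⟨δ, hδ, fun {t} ht htδ => ?_⟩
  have ht : 0 < t := ht
  rw [Real.dist_eq, sub_zero, abs_of_pos ht] at htδ
  have h1 : ‖∫ s in (0 : ℝ)..t, (F t s - F 0 0)‖ ≤ ε / 2 * |t - 0| := by
    refine intervalIntegral.norm_integral_le_of_norm_le_const fun s hs => ?_
    rw [uIoc_of_le ht.le] at hs
    rw [← dist_eq_norm]
    refine (@h (t, s) ?_).le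
    rw [Prod.dist_eq, Real.dist_eq, Real.dist_eq, sub_zero, sub_zero, abs_of_pos ht,
      abs_of_pos hs.1]
    exact max_lt htδ (hs.2.trans_lt htδ)
  have hi : IntervalIntegrable (fun s => F t s) MeasureTheory.volume 0 t :=
    (hF.comp (Continuous.prodMk_right t)).intervalIntegrable _ _
  rw [intervalIntegral.integral_sub hi (by simp), intervalIntegral.integral_const, sub_zero,
    abs_of_pos ht] at h1
  rw [dist_eq_norm]
  have h2 : t⁻¹ • (∫ s in (0 : ℝ)..t, F t s) - F 0 0
      = t⁻¹ • ((∫ s in (0 : ℝ)..t, F t s) - t • F 0 0) := by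
    rw [smul_sub, smul_smul, inv_mul_cancel₀ ht.ne', one_smul]
  rw [h2, norm_smul, norm_inv, Real.norm_eq_abs, abs_of_pos ht]
  calc t⁻¹ * ‖(∫ s in (0 : ℝ)..t, F t s) - t • F 0 0‖ ≤ t⁻¹ * (ε / 2 * t) := by gcongr
    _ = ε / 2 := by field_simp
    _ < ε := by linarith

/-- The bounded perturbation theorem. -/
theorem generatesC0Semigroup_perturb [CompleteSpace X] {A : X →ₗ.[ℝ] X}
    (hA : GeneratesC0Semigroup A) (B : X →L[ℝ] X) : GeneratesC0Semigroup (perturb A B) := by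
  obtain ⟨S, hS, hAS⟩ := hA
  obtain ⟨M, hM1, ω, hω, hMω⟩ := hS.exists_exp_bound
  -- This `a` meets the smallness condition `M ‖B‖ ≤ a / 2` and is positive. The factor `exp (-lam
  -- t)` with `lam = ω + a` turns growth at rate `ω` into decay at rate `a`.
  set a : ℝ := 2 * (M * ‖B‖) + 1 with ha_def
  have ha : 0 < a := by positivity
  set lam : ℝ := ω + a with hlam
  let R : ℝ → X →L[ℝ] X := fun t => Real.exp (-(lam * max t 0)) • S (max t 0)
  have hR : Continuous fun p : ℝ × X => R p.1 p.2 := by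
    have h1 : Continuous fun p : ℝ × X => Real.exp (-(lam * max p.1 0)) := by fun_prop
    exact h1.smul hS.continuous_max
  have hRneg : ∀ t, t ≤ 0 → R t = ContinuousLinearMap.id ℝ X := by
    intro t ht
    simp [R, max_eq_right ht, hS.map_zero]
  have hRM : ∀ t, 0 ≤ t → ‖R t‖ ≤ M * Real.exp (-(a * t)) := by
    intro t ht
    simp only [R, max_eq_left ht, norm_smul, Real.norm_eq_abs, Real.abs_exp]
    calc Real.exp (-(lam * t)) * ‖S t‖ ≤ Real.exp (-(lam * t)) * (M * Real.exp (ω * t)) := by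
          gcongr; exact hMω t ht
      _ = M * (Real.exp (-(lam * t)) * Real.exp (ω * t)) := by ring
      _ = M * Real.exp (-(a * t)) := by rw [← Real.exp_add]; congr 2; rw [hlam]; ring
  have hRadd : ∀ s t : ℝ, 0 ≤ s → 0 ≤ t → ∀ x, R (s + t) x = R s (R t x) := by
    intro s t hs ht x
    simp only [R, max_eq_left hs, max_eq_left ht, max_eq_left (add_nonneg hs ht),
      _root_.smul_apply, map_smul, smul_smul, hS.map_add_apply hs ht, ← Real.exp_add]
    congr 2; ring
  obtain ⟨W, hW⟩ := exists_volterra_solution hR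
    (fun t ht => by rw [hRneg t ht]; exact ContinuousLinearMap.norm_id_le) ha hRM B
    (by rw [ha_def]; linarith)
  have hWeq : ∀ x t, W x t = R t x + ∫ s in (0 : ℝ)..max t 0, R (max t 0 - s) (B (W x s)) :=
    fun x => (hW x (W x)).1 rfl
  have hWeq' : ∀ x t, 0 ≤ t → W x t = R t x + ∫ s in (0 : ℝ)..t, R (t - s) (B (W x s)) := by
    intro x t ht
    have := hWeq x t
    rwa [max_eq_left ht] at this
  have hintegrable : ∀ (w : ℝ →ᵇ X) (t b c : ℝ),
      IntervalIntegrable (fun s => R (t - s) (B (w s))) MeasureTheory.volume b c := by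
    intro w t b c
    have : Continuous fun s : ℝ => (t - s, B (w s)) := by fun_prop
    exact (hR.comp this).intervalIntegrable _ _
  have hWadd : ∀ x s t, 0 ≤ s → 0 ≤ t → W x (t + s) = W (W x s) t := by
    intro x s t hs ht
    -- The time shift of `W x` by `s` solves the Volterra equation with initial value `W x s`;
    -- uniqueness of the solution is the semigroup law.
    let z : ℝ →ᵇ X := (W x).compContinuous ⟨fun r => max r 0 + s, by fun_prop⟩
    have hz : z = W (W x s) := by
      rw [hW]
      intro r
      set q := max r 0 with hq
      have hq0 : 0 ≤ q := le_max_right _ _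
      have hRr : R r = R q := by simp [R, hq]
      have e1 : ∫ σ in (0 : ℝ)..q, R (q - σ) (B (z σ))
          = ∫ σ in s..(q + s), R (q + s - σ) (B (W x σ)) := by
        have := intervalIntegral.integral_comp_add_right (a := 0) (b := q)
          (fun σ => R (q + s - σ) (B (W x σ))) s
        rw [zero_add] at this
        rw [← this]
        refine intervalIntegral.integral_congr fun σ hσ => ?_
        rw [uIcc_of_le hq0] at hσ
        simp only [z, compContinuous_apply, ContinuousMap.coe_mk, max_eq_left hσ.1,
          add_sub_add_right_eq_sub]
      have e2 : R q (∫ σ in (0 : ℝ)..s, R (s - σ) (B (W x σ)))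
          = ∫ σ in (0 : ℝ)..s, R (q + s - σ) (B (W x σ)) := by
        rw [← ContinuousLinearMap.intervalIntegral_comp_comm _ (hintegrable _ _ _ _)]
        refine intervalIntegral.integral_congr fun σ hσ => ?_
        rw [uIcc_of_le hs] at hσ
        rw [← hRadd q (s - σ) hq0 (sub_nonneg.2 hσ.2), add_sub_assoc]
      have e3 : z r = W x (q + s) := rfl
      rw [e3, hRr, e1, hWeq' x (q + s) (by positivity), hWeq' x s hs, map_add, e2,
        ← hRadd q s hq0 hs, add_assoc,
        intervalIntegral.integral_add_adjacent_intervals (hintegrable _ _ _ _) (hintegrable _ _ _ _)]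
    have h2 : z t = W x (t + s) := by
      simp [z, max_eq_left ht]
    rw [← h2, hz]
  have hW0 : ∀ x, W x 0 = x := by
    intro x
    have := hWeq' x 0 le_rfl
    simpa [hRneg 0 le_rfl] using this
  let T : ℝ → X →L[ℝ] X := fun t => Real.exp (lam * t) • (evalCLM ℝ t).comp W
  have hT : ∀ t x, T t x = Real.exp (lam * t) • W x t := fun t x => rfl
  have hTcont : ∀ x, Continuous fun t => T t x := by
    intro x
    simp only [hT]
    fun_prop
  have hT0 : ∀ x, T 0 x = x := by intro x; simp [hT, hW0]
  have hTeq : ∀ x t, 0 ≤ t → T t x = S t x + ∫ s in (0 : ℝ)..t, S (max (t - s) 0) (B (T s x)) := by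
    intro x t ht
    rw [hT, hWeq' x t ht, smul_add, ← intervalIntegral.integral_smul]
    congr 1
    · simp only [R, max_eq_left ht, _root_.smul_apply, smul_smul, ← Real.exp_add]
      simp
    · refine intervalIntegral.integral_congr fun s hs => ?_
      rw [uIcc_of_le ht] at hs
      have : max (t - s) 0 = t - s := max_eq_left (by linarith [hs.2])
      simp only [R, this, hT, _root_.smul_apply, smul_smul, map_smul, ← Real.exp_add]
      congr 2; ring
  refine ⟨T, ⟨by ext x; exact hT0 x, ?_, ?_⟩, ?_⟩
  · intro s t hs ht
    ext x
    simp only [ContinuousLinearMap.comp_apply, hT, map_smul, hWadd x t s ht hs,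
      BoundedContinuousFunction.coe_smul, smul_smul, ← Real.exp_add]
    congr 2; ring
  · intro x
    have := (hTcont x).tendsto 0
    rw [hT0] at this
    exact this.mono_left nhdsWithin_le_nhds
  · intro x y
    rw [mem_graph_perturb, hAS]
    have hF : Continuous (Function.uncurry fun t s : ℝ => S (max (t - s) 0) (B (T s x))) := by
      have h1 : Continuous fun p : ℝ × ℝ => (p.1 - p.2, B (T p.2 x)) := by
        have := hTcont x
        fun_prop
      exact hS.continuous_max.comp h1
    have hlim := tendsto_average_of_continuous hF
    simp only [sub_self, max_self, hS.map_zero_apply, hT0] at hlim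
    -- The two difference quotients differ by an average that tends to `B x` for every `x`. So one
    -- converges exactly when the other does, and the domains coincide.
    have key : ∀ t : ℝ, 0 < t → t⁻¹ • (T t x - x) = t⁻¹ • (S t x - x)
        + t⁻¹ • ∫ s in (0 : ℝ)..t, S (max (t - s) 0) (B (T s x)) := by
      intro t ht
      rw [hTeq x t ht.le, ← smul_add]
      congr 1; abel
    constructor
    · intro h
      have := h.add hlim
      rw [sub_add_cancel] at this
      refine this.congr' ?_
      filter_upwards [self_mem_nhdsWithin] with t ht
      exact (key t ht).symm
    · intro h
      refine (h.sub hlim).congr' ?_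
      filter_upwards [self_mem_nhdsWithin] with t ht
      rw [key t ht]; abel

theorem opExp_isC0Semigroup {A : X →ₗ.[ℝ] X} (hA : GeneratesC0Semigroup A) :
    IsC0Semigroup (opExp A) := by
  rw [opExp, dif_pos hA]; exact hA.choose_spec.1

theorem opExp_isInfinitesimalGenerator {A : X →ₗ.[ℝ] X} (hA : GeneratesC0Semigroup A) :
    IsInfinitesimalGenerator A (opExp A) := by
  rw [opExp, dif_pos hA]; exact hA.choose_spec.2

end Perturbation

/-! ### Variation of constants and uniform estimates for perturbed semigroups -/

section Duhamel

variable {X : Type*} [NormedAddCommGroup X] [NormedSpace ℝ X]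

theorem perturb_perturb (A : X →ₗ.[ℝ] X) (B D : X →L[ℝ] X) :
    perturb (perturb A B) D = perturb A (B + D) := by
  refine LinearPMap.eq_of_eq_graph ?_
  ext ⟨x, y⟩
  rw [mem_graph_perturb, mem_graph_perturb, mem_graph_perturb]
  simp [sub_sub, add_comm]

variable [CompleteSpace X]

/-- The variation-of-constants formula for `w' = A w + F`. -/
theorem variation_of_constants {S : ℝ → X →L[ℝ] X} {A : X →ₗ.[ℝ] X} (hS : IsC0Semigroup S)
    (hA : IsInfinitesimalGenerator A S) {h : ℝ} (hh : 0 ≤ h) {w z F : ℝ → X}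
    (hwc : ContinuousOn w (Icc 0 h)) (hFc : ContinuousOn F (Icc 0 h))
    (hg : ∀ s ∈ Ioo 0 h, (w s, z s) ∈ A.graph)
    (hw : ∀ s ∈ Ioo 0 h, HasDerivAt w (z s + F s) s) :
    w h = S h (w 0) + ∫ s in (0 : ℝ)..h, S (h - s) (F s) := by
  have hsub : ContinuousOn (fun s : ℝ => h - s) (Icc 0 h) := by fun_prop
  have hsub0 : ∀ s ∈ Icc 0 h, 0 ≤ h - s := fun s hs => sub_nonneg.2 hs.2
  -- A product rule by hand, as `S` is only strongly continuous: `w r` is split into the fixed `w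
  -- s`, which lies in `D(A)`, and `w r - w s`, whose quotients converge and enter through joint
  -- continuity. The terms with `z s` cancel.
  have hderiv : ∀ s ∈ Ioo 0 h, HasDerivAt (fun s => S (h - s) (w s)) (S (h - s) (F s)) s := by
    intro s hs
    have h1 : HasDerivAt (fun r => S (h - r) (w s)) (-S (h - s) (z s)) s := by
      have h2 := hA.hasDerivAt hS (sub_pos.2 hs.2) (hg s hs)
      have h3 : HasDerivAt (fun r : ℝ => h - r) (-1) s := by
        simpa using (hasDerivAt_id s).const_sub h
      simpa [Function.comp_def] using h2.scomp s h3
    have h4 : HasDerivAt (fun r => S (h - r) (w r - w s)) (S (h - s) (z s + F s)) s := by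
      rw [hasDerivAt_iff_tendsto_slope]
      have h5 := (hw s hs).tendsto_slope
      have h6 : Tendsto (fun r : ℝ => h - r) (𝓝[≠] s) (𝓝 (h - s)) := by
        have : Continuous fun r : ℝ => h - r := by fun_prop
        exact (this.tendsto s).mono_left nhdsWithin_le_nhds
      have h7 := (hS.continuous_max.tendsto (h - s, z s + F s)).comp (h6.prodMk_nhds h5)
      simp only [max_eq_left (sub_nonneg.2 hs.2.le)] at h7
      refine h7.congr' ?_
      filter_upwards [mem_nhdsWithin_of_mem_nhds (gt_mem_nhds hs.2)] with r hr
      simp [slope, max_eq_left (sub_nonneg.2 (le_of_lt hr))]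
    have h8 := h1.add h4
    rw [map_add, neg_add_cancel_left] at h8
    refine h8.congr_of_eventuallyEq (Eventually.of_forall fun r => ?_)
    simp
  have hcont : ContinuousOn (fun s => S (h - s) (w s)) (Icc 0 h) :=
    hS.continuousOn_apply hsub hsub0 hwc
  have hFi : IntervalIntegrable (fun s => S (h - s) (F s)) MeasureTheory.volume 0 h := by
    refine ContinuousOn.intervalIntegrable ?_
    rw [uIcc_of_le hh]
    exact hS.continuousOn_apply hsub hsub0 hFc
  rw [intervalIntegral.integral_eq_sub_of_hasDerivAt_of_le hh hcont hderiv hFi]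
  simp [hS.map_zero_apply]

/-- For `v ∈ D(A)` the difference is the Duhamel integral of `e^{(t-s)A} D e^{s(A+D)} v`. Both sides
of the estimate are continuous in `v` and `D(A)` is dense. -/
theorem norm_opExp_perturb_sub_le {A : X →ₗ.[ℝ] X} (hA : GeneratesC0Semigroup A) (D : X →L[ℝ] X)
    {t M₁ M₂ : ℝ} (ht : 0 ≤ t) (h₁ : ∀ s ∈ Icc 0 t, ‖opExp A s‖ ≤ M₁)
    (h₂ : ∀ s ∈ Icc 0 t, ‖opExp (perturb A D) s‖ ≤ M₂) :
    ‖opExp (perturb A D) t - opExp A t‖ ≤ M₁ * M₂ * t * ‖D‖ := by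
  have hM₁ : 0 ≤ M₁ := (norm_nonneg _).trans (h₁ 0 ⟨le_rfl, ht⟩)
  have hM₂ : 0 ≤ M₂ := (norm_nonneg _).trans (h₂ 0 ⟨le_rfl, ht⟩)
  have hB := generatesC0Semigroup_perturb hA D
  set T := opExp (perturb A D) with hT
  have hTS : IsC0Semigroup T := opExp_isC0Semigroup hB
  have hTG : IsInfinitesimalGenerator (perturb A D) T := opExp_isInfinitesimalGenerator hB
  refine ContinuousLinearMap.opNorm_le_bound _ (by positivity) fun v => ?_
  have hclosed : IsClosed {v : X | ‖(T t - opExp A t) v‖ ≤ M₁ * M₂ * t * ‖D‖ * ‖v‖} :=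
    isClosed_le (by fun_prop) (by fun_prop)
  have hsub : (A.domain : Set X) ⊆ {v : X | ‖(T t - opExp A t) v‖ ≤ M₁ * M₂ * t * ‖D‖ * ‖v‖} := by
    intro v hv
    have hv' : (v, perturb A D ⟨v, hv⟩) ∈ (perturb A D).graph :=
      LinearPMap.mem_graph (perturb A D) ⟨v, hv⟩
    set y := perturb A D ⟨v, hv⟩
    have hcT : ContinuousOn (fun s => T s v) (Icc 0 t) :=
      hTS.continuousOn_apply continuousOn_id (fun s hs => hs.1) continuousOn_const
    have hvc := variation_of_constants (opExp_isC0Semigroup hA) (opExp_isInfinitesimalGenerator hA)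
      ht (w := fun s => T s v) (z := fun s => T s y - D (T s v)) (F := fun s => D (T s v)) hcT
      (D.continuous.comp_continuousOn hcT)
      (fun s hs => mem_graph_perturb.1 (hTG.semigroup_mem_graph hTS hs.1.le hv'))
      (fun s hs => by simpa using hTG.hasDerivAt hTS hs.1 hv')
    simp only [hTS.map_zero_apply] at hvc
    change ‖T t v - opExp A t v‖ ≤ _
    rw [hvc, add_sub_cancel_left]
    calc ‖∫ s in (0 : ℝ)..t, opExp A (t - s) (D (T s v))‖
        ≤ M₁ * (‖D‖ * (M₂ * ‖v‖)) * |t - 0| := by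
          refine intervalIntegral.norm_integral_le_of_norm_le_const fun s hs => ?_
          rw [uIoc_of_le ht] at hs
          refine ContinuousLinearMap.le_of_opNorm_le_of_le _
            (h₁ (t - s) ⟨sub_nonneg.2 hs.2, by linarith [hs.1]⟩) ?_
          exact D.le_of_opNorm_le_of_le le_rfl
            (ContinuousLinearMap.le_of_opNorm_le _ (h₂ s ⟨hs.1.le, hs.2⟩) v)
      _ = M₁ * M₂ * t * ‖D‖ * ‖v‖ := by rw [sub_zero, abs_of_nonneg ht]; ring
  exact closure_minimal hsub hclosed
    ((opExp_isInfinitesimalGenerator hA).mem_closure_domain (opExp_isC0Semigroup hA) v)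

/-- On a short time interval, the semigroups generated by `L + B` with `‖B‖ ≤ β` are uniformly
bounded and depend Lipschitz continuously on `B`. -/
theorem exists_uniform_opExp_bound {L : X →ₗ.[ℝ] X} (hL : GeneratesC0Semigroup L) (β : ℝ) :
    ∃ τ₀ > 0, ∃ M : ℝ, 0 ≤ M ∧ ∀ B : X →L[ℝ] X, ‖B‖ ≤ β → ∀ t ∈ Icc 0 τ₀,
      ‖opExp (perturb L B) t‖ ≤ M ∧ ∀ B' : X →L[ℝ] X, ‖B'‖ ≤ β →
        ‖opExp (perturb L B) t - opExp (perturb L B') t‖ ≤ M * t * ‖B - B'‖ := by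
  obtain ⟨M, hM0, hM⟩ := (opExp_isC0Semigroup hL).exists_bound 1
  have hβ : 0 ≤ |β| := abs_nonneg β
  -- Chosen so that `M |β| τ₀ ≤ 1/2`, which lets the Duhamel term be absorbed.
  set τ₀ : ℝ := min 1 (1 / (2 * (M * |β| + 1))) with hτ₀
  have hτ₀pos : 0 < τ₀ := by positivity
  have hτ1 : τ₀ ≤ 1 := min_le_left _ _
  have hsmall : M * |β| * τ₀ ≤ 1 / 2 := by
    have h1 : τ₀ ≤ 1 / (2 * (M * |β| + 1)) := min_le_right _ _
    rw [le_div_iff₀ (by positivity)] at h1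
    nlinarith
  have hbound : ∀ B : X →L[ℝ] X, ‖B‖ ≤ β → ∀ t ∈ Icc 0 τ₀, ‖opExp (perturb L B) t‖ ≤ 2 * M := by
    intro B hB
    have hBβ : ‖B‖ ≤ |β| := hB.trans (le_abs_self β)
    obtain ⟨K₀, _, hK₀⟩ := (opExp_isC0Semigroup
      (generatesC0Semigroup_perturb hL B)).exists_bound τ₀
    set s : Set ℝ := (fun t => ‖opExp (perturb L B) t‖) '' Icc 0 τ₀ with hs
    have hne : s.Nonempty := ⟨_, 0, ⟨le_rfl, hτ₀pos.le⟩, rfl⟩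
    have hbdd : BddAbove s := ⟨K₀, by rintro _ ⟨t, ht, rfl⟩; exact hK₀ t ht⟩
    have hK : ∀ t ∈ Icc 0 τ₀, ‖opExp (perturb L B) t‖ ≤ sSup s :=
      fun t ht => le_csSup hbdd ⟨t, ht, rfl⟩
    have hKnn : 0 ≤ sSup s := (norm_nonneg _).trans (hK 0 ⟨le_rfl, hτ₀pos.le⟩)
    -- The supremum is already known to be finite for each individual `B`, so `K ≤ M + K / 2` can be
    -- solved for `K`. The result `2 M` does not depend on `B`.
    have hKle : sSup s ≤ M + 1 / 2 * sSup s := by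
      refine csSup_le hne ?_
      rintro _ ⟨t, ht, rfl⟩
      have h1 := norm_opExp_perturb_sub_le hL B ht.1
        (fun r hr => hM r ⟨hr.1, by linarith [hr.2, ht.2]⟩)
        (fun r hr => hK r ⟨hr.1, hr.2.trans ht.2⟩)
      have h2 : M * sSup s * t * ‖B‖ ≤ 1 / 2 * sSup s := by
        calc M * sSup s * t * ‖B‖ ≤ M * sSup s * τ₀ * |β| := by
              have h0 := ht.1; have h3 := ht.2
              gcongr
          _ = (M * |β| * τ₀) * sSup s := by ring
          _ ≤ 1 / 2 * sSup s := by gcongr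
      have h3 := hM t ⟨ht.1, ht.2.trans hτ1⟩
      calc ‖opExp (perturb L B) t‖
          ≤ ‖opExp L t‖ + ‖opExp (perturb L B) t - opExp L t‖ := by
            have := norm_add_le (opExp L t) (opExp (perturb L B) t - opExp L t)
            rwa [add_sub_cancel] at this
        _ ≤ M + 1 / 2 * sSup s := add_le_add h3 (h1.trans h2)
    intro t ht
    exact (hK t ht).trans (by linarith)
  refine ⟨τ₀, hτ₀pos, 2 * M + 4 * M ^ 2, by positivity, fun B hB t ht => ⟨?_, fun B' hB' => ?_⟩⟩
  · exact (hbound B hB t ht).trans (by nlinarith)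
  -- `L + B` is regarded as the perturbation of `L + B'` by `B - B'`.
  · have h1 := norm_opExp_perturb_sub_le (generatesC0Semigroup_perturb hL B') (B - B') ht.1
      (M₁ := 2 * M) (M₂ := 2 * M) (fun r hr => hbound B' hB' r ⟨hr.1, hr.2.trans ht.2⟩)
      (fun r hr => by
        rw [perturb_perturb, add_sub_cancel]
        exact hbound B hB r ⟨hr.1, hr.2.trans ht.2⟩)
    rw [perturb_perturb, add_sub_cancel] at h1
    refine h1.trans ?_
    have h0 := ht.1
    have : 2 * M * (2 * M) ≤ 2 * M + 4 * M ^ 2 := by nlinarith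
    gcongr

end Duhamel

/-! ### The operators `φ_k(τ A)` -/

section PhiOperators

variable {X : Type*} [NormedAddCommGroup X] [NormedSpace ℝ X]

open Classical in
/-- `φ_k(τ A)` as a bounded operator, with `φ_0(τ A) = e^{τ A}`. -/
noncomputable def phiL (A : X →ₗ.[ℝ] X) (τ : ℝ) : ℕ → X →L[ℝ] X
  | 0 => opExp A τ
  | k + 1 => if h : ∃ Φ : X →L[ℝ] X, ∀ v, Φ v = phiOp k.succPNat A τ v then h.choose else 0

theorem phiOp_succPNat (k : ℕ) (A : X →ₗ.[ℝ] X) (τ : ℝ) (v : X) :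
    phiOp k.succPNat A τ v = ∫ θ in (0 : ℝ)..1, (θ ^ k / (k ! : ℝ)) • opExp A (τ * (1 - θ)) v := by
  simp [phiOp]

theorem phi_weight_le_one (k : ℕ) {θ : ℝ} (h0 : 0 ≤ θ) (h1 : θ ≤ 1) :
    θ ^ k / (k ! : ℝ) ≤ 1 := by
  rw [div_le_one (by positivity)]
  have h2 : θ ^ k ≤ 1 := pow_le_one₀ h0 h1
  have h3 : (1 : ℝ) ≤ (k ! : ℝ) := by exact_mod_cast Nat.factorial_pos k
  linarith

theorem norm_phiOp_le (A : X →ₗ.[ℝ] X) {τ M : ℝ} (hτ : 0 ≤ τ)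
    (hM : ∀ t ∈ Icc 0 τ, ‖opExp A t‖ ≤ M) (k : ℕ) (v : X) :
    ‖phiOp k.succPNat A τ v‖ ≤ M * ‖v‖ := by
  rw [phiOp_succPNat]
  have hM0 : 0 ≤ M := (norm_nonneg _).trans (hM 0 ⟨le_rfl, hτ⟩)
  have : ‖∫ θ in (0 : ℝ)..1, (θ ^ k / (k ! : ℝ)) • opExp A (τ * (1 - θ)) v‖
      ≤ M * ‖v‖ * |1 - 0| := by
    refine intervalIntegral.norm_integral_le_of_norm_le_const fun θ hθ => ?_
    rw [uIoc_of_le zero_le_one] at hθ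
    rw [norm_smul, Real.norm_eq_abs, abs_of_nonneg (by have := hθ.1; positivity)]
    have h1 := phi_weight_le_one k hθ.1.le hθ.2
    have h2 := (opExp A (τ * (1 - θ))).le_of_opNorm_le
      (hM _ ⟨mul_nonneg hτ (by linarith [hθ.2]), by nlinarith [hθ.1]⟩) v
    calc _ ≤ 1 * (M * ‖v‖) := by gcongr
      _ = M * ‖v‖ := one_mul _
  simpa using this

variable [CompleteSpace X] {A : X →ₗ.[ℝ] X}

theorem continuousOn_phi_integrand (hA : GeneratesC0Semigroup A) {τ : ℝ} (hτ : 0 ≤ τ) (k : ℕ)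
    (v : X) :
    ContinuousOn (fun θ : ℝ => (θ ^ k / (k ! : ℝ)) • opExp A (τ * (1 - θ)) v) (Icc 0 1) := by
  refine ContinuousOn.smul (by fun_prop) ((opExp_isC0Semigroup hA).continuousOn_apply
    (by fun_prop) (fun θ hθ => mul_nonneg hτ (by linarith [hθ.2])) continuousOn_const)

theorem intervalIntegrable_phi_integrand (hA : GeneratesC0Semigroup A) {τ : ℝ} (hτ : 0 ≤ τ)
    (k : ℕ) (v : X) :
    IntervalIntegrable (fun θ : ℝ => (θ ^ k / (k ! : ℝ)) • opExp A (τ * (1 - θ)) v)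
      MeasureTheory.volume 0 1 := by
  refine ContinuousOn.intervalIntegrable ?_
  rw [uIcc_of_le zero_le_one]
  exact continuousOn_phi_integrand hA hτ k v

theorem phiL_succ_apply (hA : GeneratesC0Semigroup A) {τ : ℝ} (hτ : 0 ≤ τ) (k : ℕ) (v : X) :
    phiL A τ (k + 1) v = phiOp k.succPNat A τ v := by
  have h : ∃ Φ : X →L[ℝ] X, ∀ v, Φ v = phiOp k.succPNat A τ v := by
    obtain ⟨M, _, hM⟩ := (opExp_isC0Semigroup hA).exists_bound τ
    refine ⟨LinearMap.mkContinuous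
      { toFun := phiOp k.succPNat A τ
        map_add' := fun v w => ?_
        map_smul' := fun c v => ?_ } M (norm_phiOp_le A hτ hM k), fun v => rfl⟩
    · simp only [phiOp_succPNat, map_add, smul_add]
      exact intervalIntegral.integral_add (intervalIntegrable_phi_integrand hA hτ k v)
        (intervalIntegrable_phi_integrand hA hτ k w)
    · simp only [phiOp_succPNat, map_smul, RingHom.id_apply]
      rw [← intervalIntegral.integral_smul]
      simp only [smul_comm c]
  rw [phiL, dif_pos h]
  exact h.choose_spec v

theorem phiL_succ_eq_integral (hA : GeneratesC0Semigroup A) {τ : ℝ} (hτ : 0 ≤ τ) (k : ℕ) (v : X) :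
    phiL A τ (k + 1) v = ∫ θ in (0 : ℝ)..1, (θ ^ k / (k ! : ℝ)) • opExp A (τ * (1 - θ)) v := by
  rw [phiL_succ_apply hA hτ, phiOp_succPNat]

theorem phiOp_eq_phiL (hA : GeneratesC0Semigroup A) {τ : ℝ} (hτ : 0 ≤ τ) (k : ℕ+) (v : X) :
    phiOp k A τ v = phiL A τ k v := by
  obtain ⟨j, rfl⟩ : ∃ j : ℕ, k = j.succPNat := ⟨k.natPred, (PNat.succPNat_natPred k).symm⟩
  rw [Nat.succPNat_coe, Nat.succ_eq_add_one, phiL_succ_apply hA hτ]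

theorem norm_phiL_le (hA : GeneratesC0Semigroup A) {τ M : ℝ} (hτ : 0 ≤ τ)
    (hM : ∀ t ∈ Icc 0 τ, ‖opExp A t‖ ≤ M) (k : ℕ) : ‖phiL A τ k‖ ≤ M := by
  cases k with
  | zero => exact hM τ ⟨hτ, le_rfl⟩
  | succ k =>
    refine ContinuousLinearMap.opNorm_le_bound _ ((norm_nonneg _).trans (hM 0 ⟨le_rfl, hτ⟩))
      fun v => ?_
    rw [phiL_succ_apply hA hτ]
    exact norm_phiOp_le A hτ hM k v

theorem norm_phiL_sub_le {A' : X →ₗ.[ℝ] X} (hA : GeneratesC0Semigroup A)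
    (hA' : GeneratesC0Semigroup A') {τ M : ℝ} (hτ : 0 ≤ τ)
    (hM : ∀ t ∈ Icc 0 τ, ‖opExp A t - opExp A' t‖ ≤ M) (k : ℕ) :
    ‖phiL A τ k - phiL A' τ k‖ ≤ M := by
  cases k with
  | zero => exact hM τ ⟨hτ, le_rfl⟩
  | succ k =>
    have hM0 : 0 ≤ M := (norm_nonneg _).trans (hM 0 ⟨le_rfl, hτ⟩)
    refine ContinuousLinearMap.opNorm_le_bound _ hM0 fun v => ?_
    rw [sub_apply, phiL_succ_eq_integral hA hτ, phiL_succ_eq_integral hA' hτ,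
      ← intervalIntegral.integral_sub (intervalIntegrable_phi_integrand hA hτ k v)
        (intervalIntegrable_phi_integrand hA' hτ k v)]
    have : ‖∫ θ in (0 : ℝ)..1, ((θ ^ k / (k ! : ℝ)) • opExp A (τ * (1 - θ)) v
        - (θ ^ k / (k ! : ℝ)) • opExp A' (τ * (1 - θ)) v)‖ ≤ M * ‖v‖ * |1 - 0| := by
      refine intervalIntegral.norm_integral_le_of_norm_le_const fun θ hθ => ?_
      rw [uIoc_of_le zero_le_one] at hθ
      rw [← smul_sub, norm_smul, Real.norm_eq_abs, abs_of_nonneg (by have := hθ.1; positivity)]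
      have h1 := phi_weight_le_one k hθ.1.le hθ.2
      have h2 := (opExp A (τ * (1 - θ)) - opExp A' (τ * (1 - θ))).le_of_opNorm_le
        (hM _ ⟨mul_nonneg hτ (by linarith [hθ.2]), by nlinarith [hθ.1]⟩) v
      rw [sub_apply] at h2
      calc _ ≤ 1 * (M * ‖v‖) := by gcongr
        _ = M * ‖v‖ := one_mul _
    simpa using this

theorem phiL_comm_opExp (hA : GeneratesC0Semigroup A) {τ t : ℝ} (hτ : 0 ≤ τ) (ht : 0 ≤ t) (k : ℕ)
    (v : X) : phiL A τ k (opExp A t v) = opExp A t (phiL A τ k v) := by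
  have hS := opExp_isC0Semigroup hA
  cases k with
  | zero => exact hS.comm_apply hτ ht v
  | succ k =>
    rw [phiL_succ_eq_integral hA hτ, phiL_succ_eq_integral hA hτ,
      ← ContinuousLinearMap.intervalIntegral_comp_comm _
        (intervalIntegrable_phi_integrand hA hτ k v)]
    refine intervalIntegral.integral_congr fun θ hθ => ?_
    rw [uIcc_of_le zero_le_one] at hθ
    simp only [map_smul]
    rw [hS.comm_apply (mul_nonneg hτ (by linarith [hθ.2])) ht]

theorem phiL_mem_graph (hA : GeneratesC0Semigroup A) {τ : ℝ} (hτ : 0 ≤ τ) (k : ℕ) {x y : X}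
    (h : (x, y) ∈ A.graph) : (phiL A τ k x, phiL A τ k y) ∈ A.graph :=
  (opExp_isInfinitesimalGenerator hA).map_mem_graph
    (fun _ ht x => phiL_comm_opExp hA hτ ht k x) h

theorem integral_phi_weight (k : ℕ) :
    ∫ θ in (0 : ℝ)..1, θ ^ k / (k ! : ℝ) = (((k + 1) ! : ℕ) : ℝ)⁻¹ := by
  rw [intervalIntegral.integral_div, integral_pow, Nat.factorial_succ]
  push_cast
  field_simp
  simp

theorem phiL_zero (hA : GeneratesC0Semigroup A) (k : ℕ) (v : X) :
    phiL A 0 k v = ((k ! : ℝ)⁻¹) • v := by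
  have hS := opExp_isC0Semigroup hA
  cases k with
  | zero => simp [phiL, hS.map_zero]
  | succ k =>
    rw [phiL_succ_eq_integral hA le_rfl]
    simp only [zero_mul, hS.map_zero_apply]
    rw [intervalIntegral.integral_smul_const, integral_phi_weight]

/-- `φ_k(τ A) = 1 / k! + τ A φ_{k+1}(τ A)` on `D(A)`. -/
theorem phiL_eq_add_of_mem_graph (hA : GeneratesC0Semigroup A) {τ : ℝ} (hτ : 0 ≤ τ) (k : ℕ)
    {x y : X} (h : (x, y) ∈ A.graph) :
    phiL A τ k x = ((k ! : ℝ)⁻¹) • x + τ • phiL A τ (k + 1) y := by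
  have hS := opExp_isC0Semigroup hA
  rcases hτ.eq_or_lt with rfl | hτ'
  · simp [phiL_zero hA]
  have hd : ∀ θ ∈ Ioo (0 : ℝ) 1, HasDerivAt (fun θ => opExp A (τ * (1 - θ)) x)
      (-(τ • opExp A (τ * (1 - θ)) y)) θ := by
    intro θ hθ
    have h2 := (opExp_isInfinitesimalGenerator hA).hasDerivAt hS
      (mul_pos hτ' (sub_pos.2 hθ.2)) h
    have h3 : HasDerivAt (fun r : ℝ => τ * (1 - r)) (-τ) θ := by
      simpa using ((hasDerivAt_id θ).const_sub 1).const_mul τ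
    simpa [Function.comp_def] using h2.scomp θ h3
  have hcx : ContinuousOn (fun θ : ℝ => opExp A (τ * (1 - θ)) x) (Icc 0 1) :=
    hS.continuousOn_apply (by fun_prop) (fun θ hθ => mul_nonneg hτ (by linarith [hθ.2]))
      continuousOn_const
  have hi := intervalIntegrable_phi_integrand hA hτ
  have hiτ : ∀ k v, IntervalIntegrable (fun θ : ℝ => τ • (θ ^ k / (k ! : ℝ)) •
      opExp A (τ * (1 - θ)) v) MeasureTheory.volume 0 1 := fun k v => (hi k v).smul τ
  cases k with
  | zero =>
    have hi0 : IntervalIntegrable (fun θ : ℝ => -(τ • opExp A (τ * (1 - θ)) y))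
        MeasureTheory.volume 0 1 := by
      have := (hiτ 0 y).neg
      simp only [pow_zero, Nat.factorial_zero, Nat.cast_one, div_one, one_smul] at this
      exact this
    have := intervalIntegral.integral_eq_sub_of_hasDerivAt_of_le zero_le_one hcx hd hi0
    rw [phiL_succ_eq_integral hA hτ, ← intervalIntegral.integral_smul]
    simp only [sub_self, mul_zero, hS.map_zero_apply, sub_zero, mul_one] at this
    simp only [pow_zero, Nat.factorial_zero, Nat.cast_one, inv_one, one_smul, div_one]
    rw [intervalIntegral.integral_neg] at this
    simp only [phiL]
    rw [← sub_eq_iff_eq_add', ← neg_inj, neg_sub, ← this]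
  | succ k =>
    -- Integration by parts: the derivative of `θ^{k+1}/(k+1)! • e^{τ(1-θ)A} x` contains the
    -- integrands of `φ_{k+1}` and `φ_{k+2}`, and the boundary value at `1` is `x / (k+1)!`.
    have hd' : ∀ θ ∈ Ioo (0 : ℝ) 1,
        HasDerivAt (fun θ => (θ ^ (k + 1) / ((k + 1)! : ℝ)) • opExp A (τ * (1 - θ)) x)
        ((θ ^ k / (k ! : ℝ)) • opExp A (τ * (1 - θ)) x
          - τ • (θ ^ (k + 1) / ((k + 1)! : ℝ)) • opExp A (τ * (1 - θ)) y) θ := by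
      intro θ hθ
      have h1 : HasDerivAt (fun θ : ℝ => θ ^ (k + 1) / ((k + 1)! : ℝ)) (θ ^ k / (k ! : ℝ)) θ := by
        refine ((hasDerivAt_pow (k + 1) θ).div_const _).congr_deriv ?_
        rw [Nat.factorial_succ]
        push_cast
        field_simp
      refine (h1.smul (hd θ hθ)).congr_deriv ?_
      rw [smul_neg, smul_comm τ]
      abel
    have := intervalIntegral.integral_eq_sub_of_hasDerivAt_of_le zero_le_one
      (continuousOn_phi_integrand hA hτ (k + 1) x) hd'
      ((hi k x).sub (hiτ (k + 1) y))
    rw [phiL_succ_eq_integral hA hτ, phiL_succ_eq_integral hA hτ, ← intervalIntegral.integral_smul,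
      ← sub_eq_iff_eq_add, ← intervalIntegral.integral_sub (hi k x) (hiτ (k + 1) y)]
    refine this.trans ?_
    simp [hS.map_zero_apply]

/-- For `τ > 0`, `φ_{k+1}(τ A)` maps into `D(A)`, and `τ A φ_{k+1}(τ A) = φ_k(τ A) - 1 / k!`. -/
theorem phiL_succ_mem_graph (hA : GeneratesC0Semigroup A) {τ : ℝ} (hτ : 0 < τ) (k : ℕ) (v : X) :
    (phiL A τ (k + 1) v, τ⁻¹ • (phiL A τ k v - ((k ! : ℝ)⁻¹) • v)) ∈ A.graph := by
  -- Both components are bounded operators applied to `v`, so closedness of the graph carries the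
  -- relation from the dense domain to all of `X`.
  have hclosed : IsClosed {v : X |
      (phiL A τ (k + 1) v, τ⁻¹ • (phiL A τ k v - ((k ! : ℝ)⁻¹) • v)) ∈ (A.graph : Set (X × X))} :=
    ((opExp_isInfinitesimalGenerator hA).isClosed_graph (opExp_isC0Semigroup hA)).preimage
      (by fun_prop)
  refine closure_minimal (s := (A.domain : Set X)) ?_ hclosed
    ((opExp_isInfinitesimalGenerator hA).mem_closure_domain (opExp_isC0Semigroup hA) v)
  intro x hx
  have hg : (x, A ⟨x, hx⟩) ∈ A.graph := LinearPMap.mem_graph A ⟨x, hx⟩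
  have h1 := phiL_mem_graph hA hτ.le (k + 1) hg
  have h2 : τ⁻¹ • (phiL A τ k x - ((k ! : ℝ)⁻¹) • x) = phiL A τ (k + 1) (A ⟨x, hx⟩) := by
    rw [phiL_eq_add_of_mem_graph hA hτ.le k hg, add_sub_cancel_left, smul_smul,
      inv_mul_cancel₀ hτ.ne', one_smul]
  change (phiL A τ (k + 1) x, τ⁻¹ • (phiL A τ k x - ((k ! : ℝ)⁻¹) • x)) ∈ A.graph
  rwa [h2]

/-- `∫₀ʰ e^{(h-s)A} s^k / k! v ds = h^{k+1} φ_{k+1}(h A) v`. -/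
theorem integral_opExp_pow (hA : GeneratesC0Semigroup A) {h : ℝ} (hh : 0 ≤ h) (k : ℕ) (v : X) :
    ∫ s in (0 : ℝ)..h, opExp A (h - s) ((s ^ k / (k ! : ℝ)) • v)
      = h ^ (k + 1) • phiL A h (k + 1) v := by
  rw [phiL_succ_eq_integral hA hh]
  have := intervalIntegral.smul_integral_comp_mul_left (a := 0) (b := 1)
    (fun s => opExp A (h - s) ((s ^ k / (k ! : ℝ)) • v)) h
  rw [mul_zero, mul_one] at this
  rw [← this, pow_succ', mul_smul, ← intervalIntegral.integral_smul (h ^ k)]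
  congr 1
  refine intervalIntegral.integral_congr fun θ _ => ?_
  simp only [map_smul, smul_smul]
  congr 2
  · ring_nf
  · ring_nf

end PhiOperators

/-! ### Linear combinations of `φ`-functions at operators -/

section PhiCombinations

theorem hasSum_phi (k : ℕ) (z : ℝ) :
    HasSum (fun n : ℕ => (((n + k)! : ℝ)⁻¹) • z ^ n) (phi k z) := by
  refine Summable.hasSum ?_
  refine Summable.of_norm_bounded (Real.summable_pow_div_factorial |z|) fun n => ?_
  rw [norm_smul, norm_pow, Real.norm_eq_abs, Real.norm_eq_abs, abs_of_pos (by positivity),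
    div_eq_inv_mul]
  have : (n ! : ℝ) ≤ ((n + k)! : ℝ) := by
    exact_mod_cast Nat.factorial_le (Nat.le_add_right n k)
  gcongr

theorem phi_zero_eq (k : ℕ) : phi k (0 : ℝ) = ((k ! : ℝ)⁻¹) := by
  have h1 := hasSum_phi k 0
  have h2 : HasSum (fun n : ℕ => (((n + k)! : ℝ)⁻¹) • (0 : ℝ) ^ n) ((k ! : ℝ)⁻¹) := by
    convert hasSum_single (f := fun n : ℕ => (((n + k)! : ℝ)⁻¹) • (0 : ℝ) ^ n) 0 ?_ using 1
    · simp
    · intro n hn; simp [hn]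
  exact h1.unique h2

theorem phi_algebraMap {d : ℕ} (k : ℕ) (z : ℝ) :
    phi k (algebraMap ℝ (Matrix (Fin d) (Fin d) ℝ) z)
      = algebraMap ℝ (Matrix (Fin d) (Fin d) ℝ) (phi k z) := by
  have h := (hasSum_phi k z).map (algebraMap ℝ (Matrix (Fin d) (Fin d) ℝ))
    (continuous_algebraMap _ _)
  refine HasSum.tsum_eq ?_
  have e : (fun n : ℕ => (((n + k)! : ℝ)⁻¹) • (algebraMap ℝ (Matrix (Fin d) (Fin d) ℝ) z) ^ n)
      = algebraMap ℝ (Matrix (Fin d) (Fin d) ℝ) ∘ fun n : ℕ => (((n + k)! : ℝ)⁻¹) • z ^ n := by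
    funext n
    simp [Algebra.smul_def]
  rwa [e]

namespace PhiComb

theorem eval_eq_linearCombination {R : Type*} [Ring R] [Algebra ℝ R] [TopologicalSpace R]
    (c : PhiComb) (z : R) : c.eval z = Finsupp.linearCombination ℝ
      (fun kg : ℕ+ × ℝ≥0 => phi (kg.1 : ℕ) ((kg.2 : ℝ) • z)) c := rfl

theorem eval_algebraMap {d : ℕ} (c : PhiComb) (z : ℝ) :
    c.eval (algebraMap ℝ (Matrix (Fin d) (Fin d) ℝ) z)
      = algebraMap ℝ (Matrix (Fin d) (Fin d) ℝ) (c.eval z) := by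
  simp only [eval, Finsupp.sum, map_sum]
  refine Finset.sum_congr rfl fun kg _ => ?_
  rw [show ((kg.2 : ℝ) • algebraMap ℝ (Matrix (Fin d) (Fin d) ℝ) z)
    = algebraMap ℝ (Matrix (Fin d) (Fin d) ℝ) ((kg.2 : ℝ) • z) by simp [Algebra.smul_def],
    phi_algebraMap]
  simp [Algebra.smul_def]

theorem eval_zero_eq (c : PhiComb) :
    c.eval (0 : ℝ) = c.sum fun kg w => w * (((kg.1 : ℕ)! : ℝ)⁻¹) := by
  simp [eval, phi_zero_eq]

theorem hasSum_eval (c : PhiComb) (z : ℝ) :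
    HasSum (fun n : ℕ => z ^ n • ∑ kg ∈ c.support,
      c kg * ((kg.2 : ℝ) ^ n * (((n + (kg.1 : ℕ))! : ℝ)⁻¹))) (c.eval z) := by
  have h : HasSum (fun n : ℕ => ∑ kg ∈ c.support,
      c kg • ((((n + (kg.1 : ℕ))! : ℝ)⁻¹) • ((kg.2 : ℝ) • z) ^ n)) (c.eval z) :=
    hasSum_sum fun kg _ => (hasSum_phi (kg.1 : ℕ) ((kg.2 : ℝ) • z)).const_smul (c kg)
  convert h using 2 with n
  rw [Finset.smul_sum]
  refine Finset.sum_congr rfl fun kg _ => ?_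
  simp only [smul_eq_mul, mul_pow]
  ring

/-- These sums are the Taylor coefficients of `c(z)` at `0`, so uniqueness of power series applies.
Up to the factor `n!` they are also the values of the functional in `functional_eq_zero` on
monomials. -/
theorem moments_eq_zero {c : PhiComb} (hc : ∀ z : ℝ, c.eval z = 0) (n : ℕ) :
    ∑ kg ∈ c.support, c kg * ((kg.2 : ℝ) ^ n * (((n + (kg.1 : ℕ))! : ℝ)⁻¹)) = 0 := by
  set a : ℕ → ℝ := fun n =>
    ∑ kg ∈ c.support, c kg * ((kg.2 : ℝ) ^ n * (((n + (kg.1 : ℕ))! : ℝ)⁻¹))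
  have h : HasFPowerSeriesAt (0 : ℝ → ℝ) (FormalMultilinearSeries.ofScalars ℝ a) 0 := by
    rw [hasFPowerSeriesAt_iff]
    refine Eventually.of_forall fun z => ?_
    have := hasSum_eval c z
    rw [hc z] at this
    simpa [FormalMultilinearSeries.coeff_ofScalars] using this
  have h2 := h.eq_zero
  have h3 : (FormalMultilinearSeries.ofScalars ℝ a).coeff n = 0 := by rw [h2]; rfl
  rwa [FormalMultilinearSeries.coeff_ofScalars] at h3

end PhiComb

/-- A Beta integral. Integration by parts lowers `n` and raises `j`, hence the induction with `j`
free. -/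
theorem integral_pow_mul_one_sub_pow (j n : ℕ) :
    ∫ θ in (0 : ℝ)..1, θ ^ j / (j ! : ℝ) * (1 - θ) ^ n = n ! * (((n + (j + 1))! : ℝ)⁻¹) := by
  induction n generalizing j with
  | zero => simpa using integral_phi_weight j
  | succ n ih =>
    have hd : ∀ θ ∈ uIcc (0 : ℝ) 1, HasDerivAt
        (fun θ : ℝ => θ ^ (j + 1) / ((j + 1)! : ℝ) * (1 - θ) ^ (n + 1))
        (θ ^ j / (j ! : ℝ) * (1 - θ) ^ (n + 1)
          - (n + 1) * (θ ^ (j + 1) / ((j + 1)! : ℝ) * (1 - θ) ^ n)) θ := by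
      intro θ _
      have h1 : HasDerivAt (fun θ : ℝ => θ ^ (j + 1) / ((j + 1)! : ℝ)) (θ ^ j / (j ! : ℝ)) θ := by
        refine ((hasDerivAt_pow (j + 1) θ).div_const _).congr_deriv ?_
        rw [Nat.factorial_succ]
        push_cast
        field_simp
      have h2 : HasDerivAt (fun θ : ℝ => (1 - θ) ^ (n + 1)) (-((n + 1) * (1 - θ) ^ n)) θ := by
        have := ((hasDerivAt_id θ).const_sub 1).pow (n + 1)
        refine this.congr_deriv ?_
        simp
      refine (h1.mul h2).congr_deriv ?_
      ring
    have h3 := intervalIntegral.integral_eq_sub_of_hasDerivAt hd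
      (Continuous.intervalIntegrable (by fun_prop) _ _)
    rw [intervalIntegral.integral_sub (Continuous.intervalIntegrable (by fun_prop) _ _)
      (Continuous.intervalIntegrable (by fun_prop) _ _), intervalIntegral.integral_const_mul,
      ih (j + 1)] at h3
    simp only [sub_self, ne_eq, Nat.add_eq_zero_iff, one_ne_zero, and_false, not_false_eq_true,
      zero_pow, mul_zero, zero_div, zero_mul] at h3
    rw [sub_eq_zero.1 h3, Nat.factorial_succ n, show n + 1 + (j + 1) = n + (j + 1 + 1) by ring]
    push_cast
    ring

namespace PhiComb

/-- The functional `F ↦ ∑ w ∫₀¹ θ^{k-1} / (k-1)! F(g (1 - θ)) dθ` attached to `∑ w φ_k(g z)`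
vanishes on continuous functions if `∑ w φ_k(g z)` vanishes. -/
theorem functional_eq_zero {c : PhiComb} (hc : ∀ z : ℝ, c.eval z = 0) {G : ℝ}
    (hG : ∀ kg ∈ c.support, (kg.2 : ℝ) ≤ G) {F : ℝ → ℝ} (hF : ContinuousOn F (Icc 0 G)) :
    ∑ kg ∈ c.support, c kg * ∫ θ in (0 : ℝ)..1,
      θ ^ kg.1.natPred / (kg.1.natPred ! : ℝ) * F (kg.2 * (1 - θ)) = 0 := by
  have hmem : ∀ kg ∈ c.support, ∀ θ ∈ Icc (0 : ℝ) 1, (kg.2 : ℝ) * (1 - θ) ∈ Icc 0 G := by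
    intro kg hkg θ hθ
    have h0 : (0 : ℝ) ≤ kg.2 := kg.2.2
    have h1 := hG kg hkg
    exact ⟨mul_nonneg h0 (by linarith [hθ.2]), by nlinarith [hθ.1]⟩
  have hintegrable : ∀ kg ∈ c.support, ∀ f : ℝ → ℝ, ContinuousOn f (Icc 0 G) →
      IntervalIntegrable (fun θ : ℝ => θ ^ kg.1.natPred / (kg.1.natPred ! : ℝ)
        * f (kg.2 * (1 - θ))) MeasureTheory.volume 0 1 := by
    intro kg hkg f hf
    refine ContinuousOn.intervalIntegrable ?_
    rw [uIcc_of_le zero_le_one]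
    refine ContinuousOn.mul (by fun_prop) (hf.comp (by fun_prop) (hmem kg hkg))
  have hpoly : ∀ p : Polynomial ℝ, ∑ kg ∈ c.support, c kg * ∫ θ in (0 : ℝ)..1,
      θ ^ kg.1.natPred / (kg.1.natPred ! : ℝ) * p.eval ((kg.2 : ℝ) * (1 - θ)) = 0 := by
    intro p
    induction p using Polynomial.induction_on' with
    | add p q hp hq =>
      refine Eq.trans ?_ ((congrArg₂ (· + ·) hp hq).trans (add_zero 0))
      rw [← Finset.sum_add_distrib]
      refine Finset.sum_congr rfl fun kg hkg => ?_
      rw [← mul_add, ← intervalIntegral.integral_add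
        (hintegrable kg hkg (fun x => p.eval x) p.continuous.continuousOn)
        (hintegrable kg hkg (fun x => q.eval x) q.continuous.continuousOn)]
      simp only [Polynomial.eval_add, mul_add]
    | monomial n a =>
      have h1 : ∀ kg ∈ c.support, c kg * ∫ θ in (0 : ℝ)..1,
          θ ^ kg.1.natPred / (kg.1.natPred ! : ℝ)
            * (Polynomial.monomial n a).eval ((kg.2 : ℝ) * (1 - θ))
          = a * n ! * (c kg * ((kg.2 : ℝ) ^ n * (((n + (kg.1 : ℕ))! : ℝ)⁻¹))) := by
        intro kg _
        have h2 : ∀ θ : ℝ, θ ^ kg.1.natPred / (kg.1.natPred ! : ℝ)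
            * (Polynomial.monomial n a).eval ((kg.2 : ℝ) * (1 - θ))
            = (a * (kg.2 : ℝ) ^ n) * (θ ^ kg.1.natPred / (kg.1.natPred ! : ℝ) * (1 - θ) ^ n) := by
          intro θ
          rw [Polynomial.eval_monomial, mul_pow]
          ring
        simp only [h2]
        rw [intervalIntegral.integral_const_mul, integral_pow_mul_one_sub_pow, PNat.natPred_add_one]
        ring
      rw [Finset.sum_congr rfl h1, ← Finset.mul_sum, moments_eq_zero hc, mul_zero]
  set Q : ℝ := ∑ kg ∈ c.support, |c kg| with hQ
  have hQ0 : 0 ≤ Q := Finset.sum_nonneg fun _ _ => abs_nonneg _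
  have hbound : ∀ ε > 0, |∑ kg ∈ c.support, c kg * ∫ θ in (0 : ℝ)..1,
      θ ^ kg.1.natPred / (kg.1.natPred ! : ℝ) * F (kg.2 * (1 - θ))| ≤ Q * ε := by
    intro ε hε
    -- Weierstrass approximation on `[0, G]`, which contains all arguments `g (1 - θ)`. The
    -- functional is bounded by the total weight `Q`, since the kernels are at most `1`.
    obtain ⟨p, hp⟩ := exists_polynomial_near_of_continuousOn 0 G F hF ε hε
    have e : ∑ kg ∈ c.support, c kg * ∫ θ in (0 : ℝ)..1,
        θ ^ kg.1.natPred / (kg.1.natPred ! : ℝ) * F (kg.2 * (1 - θ))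
        = ∑ kg ∈ c.support, c kg * (∫ θ in (0 : ℝ)..1,
            θ ^ kg.1.natPred / (kg.1.natPred ! : ℝ) * F (kg.2 * (1 - θ)))
          - ∑ kg ∈ c.support, c kg * ∫ θ in (0 : ℝ)..1,
            θ ^ kg.1.natPred / (kg.1.natPred ! : ℝ) * p.eval ((kg.2 : ℝ) * (1 - θ)) := by
      rw [hpoly p, sub_zero]
    rw [e, ← Finset.sum_sub_distrib, hQ, Finset.sum_mul]
    refine (Finset.abs_sum_le_sum_abs _ _).trans (Finset.sum_le_sum fun kg hkg => ?_)
    rw [← mul_sub, abs_mul, ← intervalIntegral.integral_sub (hintegrable kg hkg F hF)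
      (hintegrable kg hkg (fun x => p.eval x) p.continuous.continuousOn)]
    refine mul_le_mul_of_nonneg_left ?_ (abs_nonneg _)
    have := intervalIntegral.norm_integral_le_of_norm_le_const (a := 0) (b := 1) (C := ε)
      (f := fun θ : ℝ => θ ^ kg.1.natPred / (kg.1.natPred ! : ℝ) * F (kg.2 * (1 - θ))
        - θ ^ kg.1.natPred / (kg.1.natPred ! : ℝ) * p.eval ((kg.2 : ℝ) * (1 - θ))) ?_
    · simpa using this
    · intro θ hθ
      rw [uIoc_of_le zero_le_one] at hθ
      rw [← mul_sub, norm_mul, Real.norm_eq_abs, Real.norm_eq_abs,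
        abs_of_nonneg (by have := hθ.1; positivity), abs_sub_comm]
      have h1 := phi_weight_le_one kg.1.natPred hθ.1.le hθ.2
      have h2 := (hp _ (hmem kg hkg θ ⟨hθ.1.le, hθ.2⟩)).le
      calc _ ≤ 1 * ε := by gcongr
        _ = ε := one_mul ε
  rw [← abs_nonpos_iff]
  refine le_of_forall_pos_le_add fun ε hε => ?_
  refine (hbound (ε / (Q + 1)) (by positivity)).trans ?_
  rw [zero_add, mul_div_assoc', div_le_iff₀ (by positivity)]
  nlinarith

variable {X : Type*} [NormedAddCommGroup X] [NormedSpace ℝ X]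

/-- `c(τ A)` as a bounded operator. -/
noncomputable def opL (A : X →ₗ.[ℝ] X) (τ : ℝ) : PhiComb →ₗ[ℝ] X →L[ℝ] X :=
  Finsupp.linearCombination ℝ fun kg : ℕ+ × ℝ≥0 => phiL A ((kg.2 : ℝ) * τ) (kg.1 : ℕ)

theorem opL_single (A : X →ₗ.[ℝ] X) (τ : ℝ) (kg : ℕ+ × ℝ≥0) (w : ℝ) :
    opL A τ (Finsupp.single kg w) = w • phiL A ((kg.2 : ℝ) * τ) (kg.1 : ℕ) := by
  simp [opL]

theorem opL_apply (A : X →ₗ.[ℝ] X) (τ : ℝ) (c : PhiComb) (v : X) :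
    opL A τ c v = ∑ kg ∈ c.support, c kg • phiL A ((kg.2 : ℝ) * τ) (kg.1 : ℕ) v := by
  simp [opL, Finsupp.linearCombination_apply, Finsupp.sum]

variable [CompleteSpace X] {A : X →ₗ.[ℝ] X}

theorem op_eq_opL (hA : GeneratesC0Semigroup A) {τ : ℝ} (hτ : 0 ≤ τ) (c : PhiComb) (v : X) :
    c.op A τ v = opL A τ c v := by
  rw [opL_apply, op, Finsupp.sum]
  exact Finset.sum_congr rfl fun kg _ => by rw [phiOp_eq_phiL hA (by positivity)]

/-- There is no power series in an unbounded `A`. Testing with a functional `f` turns `c(τ A) v`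
into the functional of `functional_eq_zero` at the continuous function `σ ↦ f (e^{τ σ A} v)`. -/
theorem opL_eq_zero (hA : GeneratesC0Semigroup A) {τ : ℝ} (hτ : 0 ≤ τ) {c : PhiComb}
    (hc : ∀ z : ℝ, c.eval z = 0) : opL A τ c = 0 := by
  ext v
  refine SeparatingDual.eq_zero_of_forall_dual_eq_zero (R := ℝ) fun f => ?_
  obtain ⟨G, hG⟩ : ∃ G : ℝ, ∀ kg ∈ c.support, (kg.2 : ℝ) ≤ G := by
    obtain ⟨G, hG⟩ := (c.support.image fun kg => (kg.2 : ℝ)).bddAbove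
    exact ⟨G, fun kg hkg => hG (Finset.mem_coe.2 (Finset.mem_image_of_mem _ hkg))⟩
  have hF : ContinuousOn (fun σ : ℝ => f (opExp A (τ * σ) v)) (Icc 0 G) :=
    f.continuous.comp_continuousOn ((opExp_isC0Semigroup hA).continuousOn_apply (by fun_prop)
      (fun σ hσ => mul_nonneg hτ hσ.1) continuousOn_const)
  rw [← functional_eq_zero hc hG hF, opL_apply, map_sum]
  refine Finset.sum_congr rfl fun kg _ => ?_
  have hτ' : 0 ≤ (kg.2 : ℝ) * τ := by positivity
  rw [map_smul, smul_eq_mul]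
  congr 1
  conv_lhs => rw [← PNat.natPred_add_one kg.1]
  rw [phiL_succ_eq_integral hA hτ', ← ContinuousLinearMap.intervalIntegral_comp_comm _
    (intervalIntegrable_phi_integrand hA hτ' _ v)]
  refine intervalIntegral.integral_congr fun θ _ => ?_
  simp only [map_smul, smul_eq_mul]
  congr 4
  ring

/-- A matrix of size one is a real number, so the order conditions in dimension one already
determine the operator identities. -/
theorem opL_eq_of_eval_eq (hA : GeneratesC0Semigroup A) {τ : ℝ} (hτ : 0 ≤ τ) {c c' : PhiComb}
    (hc : ∀ Z : Matrix (Fin 1) (Fin 1) ℝ, c.eval Z = c'.eval Z) : opL A τ c = opL A τ c' := by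
  rw [← sub_eq_zero, ← map_sub]
  refine opL_eq_zero hA hτ fun z => ?_
  have h1 := hc (algebraMap ℝ _ z)
  rw [eval_algebraMap, eval_algebraMap] at h1
  have h2 := (algebraMap ℝ (Matrix (Fin 1) (Fin 1) ℝ)).injective h1
  rw [eval_eq_linearCombination, map_sub, ← eval_eq_linearCombination,
    ← eval_eq_linearCombination, h2, sub_self]

/-- The combination `c₁` in `c(z) = c(0) + z c₁(z)`. -/
noncomputable def shift (c : PhiComb) : PhiComb :=
  c.sum fun kg w => Finsupp.single (kg.1 + 1, kg.2) (w * kg.2)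

theorem opL_eq_add_of_mem_graph (hA : GeneratesC0Semigroup A) {τ : ℝ} (hτ : 0 ≤ τ) (c : PhiComb)
    {x y : X} (h : (x, y) ∈ A.graph) :
    opL A τ c x = c.eval (0 : ℝ) • x + τ • opL A τ c.shift y := by
  rw [eval_zero_eq, shift, Finsupp.sum, Finsupp.sum, map_sum, opL_apply, Finset.sum_smul,
    _root_.sum_apply, Finset.smul_sum, ← Finset.sum_add_distrib]
  refine Finset.sum_congr rfl fun kg _ => ?_
  rw [phiL_eq_add_of_mem_graph hA (by positivity) _ h, opL_single, PNat.add_coe, PNat.one_coe,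
    smul_add, smul_smul, _root_.smul_apply, smul_smul, smul_smul]
  congr 2
  ring

end PhiComb

end PhiCombinations

/-! ### Taylor expansions -/

section Taylor

set_option maxSynthPendingDepth 8

/-- Induction by the mean value inequality, with a constant that is not sharpened by `1 / n!`.
Derivatives within the interval are enough, so that it applies up to the endpoints of `[t₀, T]`. -/
theorem norm_sub_taylor_le {E : Type*} [NormedAddCommGroup E] [NormedSpace ℝ E] {a C : ℝ} (n : ℕ)
    (f : ℕ → ℝ → E)
    (hd : ∀ k < n, ∀ θ ∈ Icc 0 a, HasDerivWithinAt (f k) (f (k + 1) θ) (Icc 0 a) θ)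
    (hC : ∀ θ ∈ Icc 0 a, ‖f n θ‖ ≤ C) :
    ∀ θ ∈ Icc 0 a, ‖f 0 θ - ∑ k ∈ Finset.range n, (θ ^ k / (k ! : ℝ)) • f k 0‖ ≤ C * θ ^ n := by
  induction n generalizing f with
  | zero => intro θ hθ; simpa using hC θ hθ
  | succ n ih =>
    intro θ hθ
    have h1 := ih (fun k => f (k + 1)) (fun k hk => hd (k + 1) (by omega)) hC
    have hC0 : 0 ≤ C := (norm_nonneg _).trans (hC θ hθ)
    have hder : ∀ r ∈ Icc 0 θ, HasDerivWithinAt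
        (fun r => f 0 r - ∑ k ∈ Finset.range (n + 1), (r ^ k / (k ! : ℝ)) • f k 0)
        (f 1 r - ∑ k ∈ Finset.range n, (r ^ k / (k ! : ℝ)) • f (k + 1) 0) (Icc 0 θ) r := by
      intro r hr
      have hr' : r ∈ Icc 0 a := ⟨hr.1, hr.2.trans hθ.2⟩
      refine HasDerivWithinAt.sub
        ((hd 0 (Nat.succ_pos n) r hr').mono (Icc_subset_Icc_right hθ.2)) ?_
      simp only [Finset.sum_range_succ']
      have h2 : HasDerivWithinAt (fun r : ℝ => ∑ k ∈ Finset.range n,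
          (r ^ (k + 1) / ((k + 1)! : ℝ)) • f (k + 1) 0)
          (∑ k ∈ Finset.range n, (r ^ k / (k ! : ℝ)) • f (k + 1) 0) (Icc 0 θ) r := by
        refine HasDerivWithinAt.fun_sum fun k _ => ?_
        have h3 : HasDerivAt (fun r : ℝ => r ^ (k + 1) / ((k + 1)! : ℝ)) (r ^ k / (k ! : ℝ)) r := by
          refine ((hasDerivAt_pow (k + 1) r).div_const _).congr_deriv ?_
          rw [Nat.factorial_succ]
          push_cast
          field_simp
        exact (h3.smul_const _).hasDerivWithinAt
      simpa using h2.add_const (f 0 0)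
    have h4 := (convex_Icc (0 : ℝ) θ).norm_image_sub_le_of_norm_hasDerivWithin_le
      (C := C * θ ^ n) hder (fun r hr => (h1 r ⟨hr.1, hr.2.trans hθ.2⟩).trans
        (by have := hr.1; have := hr.2; gcongr)) (left_mem_Icc.2 hθ.1) (right_mem_Icc.2 hθ.1)
    rw [sub_zero, Real.norm_eq_abs, abs_of_nonneg hθ.1, mul_assoc, ← pow_succ] at h4
    have h5 : f 0 0 - ∑ k ∈ Finset.range (n + 1), ((0 : ℝ) ^ k / (k ! : ℝ)) • f k 0 = 0 := by
      simp [Finset.sum_range_succ']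
    rwa [h5, sub_zero] at h4

/-- Bounded neighbourhoods of a compact set need not be relatively compact in infinite dimensions.
The uniform radius comes from the compactness of `K` and the open set where `G < C + 1`. -/
theorem exists_ball_bound_of_continuousOn {X : Type*} [SeminormedAddCommGroup X] {K U : Set X}
    (hK : IsCompact K) (hU : IsOpen U)
    (hKU : K ⊆ U) {G : X → ℝ} (hG : ContinuousOn G U) :
    ∃ ρ > 0, ∃ C : ℝ, ∀ x ∈ K, ∀ y ∈ Metric.ball x ρ, y ∈ U ∧ G y ≤ C := by
  obtain ⟨C, hC⟩ := hK.bddAbove_image (hG.mono hKU)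
  have hopen : IsOpen (U ∩ G ⁻¹' Iio (C + 1)) := hG.isOpen_inter_preimage hU isOpen_Iio
  obtain ⟨ρ, hρ, hsub⟩ := hK.exists_thickening_subset_open hopen
    fun x hx => ⟨hKU hx, lt_of_le_of_lt (hC ⟨x, hx, rfl⟩) (lt_add_one C)⟩
  refine ⟨ρ, hρ, C + 1, fun x hx y hy => ?_⟩
  have := hsub (Metric.mem_thickening_iff.2 ⟨x, hx, hy⟩)
  exact ⟨this.1, le_of_lt this.2⟩

variable {X : Type*} [NormedAddCommGroup X] [NormedSpace ℝ X]

/-- The second derivative in curried form. -/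
noncomputable abbrev fderiv2 (N : X → X) : X → X →L[ℝ] X →L[ℝ] X := fderiv ℝ (fderiv ℝ N)

/-- The third derivative in curried form. -/
noncomputable abbrev fderiv3 (N : X → X) : X → X →L[ℝ] X →L[ℝ] X →L[ℝ] X :=
  fderiv ℝ (fderiv2 N)

/-- The fourth derivative in curried form. -/
noncomputable abbrev fderiv4 (N : X → X) : X → X →L[ℝ] X →L[ℝ] X →L[ℝ] X →L[ℝ] X :=
  fderiv ℝ (fderiv3 N)

/-- The fifth derivative in curried form. -/
noncomputable abbrev fderiv5 (N : X → X) : X → X →L[ℝ] X →L[ℝ] X →L[ℝ] X →L[ℝ] X →L[ℝ] X :=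
  fderiv ℝ (fderiv4 N)

/-! ### Smoothness and symmetry of the iterated derivatives. -/

section ContDiffAt

variable {N : X → X} {x : X}

theorem contDiffAt_fderiv (h : ContDiffAt ℝ 5 N x) : ContDiffAt ℝ 4 (fderiv ℝ N) x :=
  h.fderiv_right (by norm_num)

theorem contDiffAt_fderiv2 (h : ContDiffAt ℝ 5 N x) : ContDiffAt ℝ 3 (fderiv2 N) x :=
  (contDiffAt_fderiv h).fderiv_right (by norm_num)

theorem contDiffAt_fderiv3 (h : ContDiffAt ℝ 5 N x) : ContDiffAt ℝ 2 (fderiv3 N) x :=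
  (contDiffAt_fderiv2 h).fderiv_right (by norm_num)

theorem contDiffAt_fderiv4 (h : ContDiffAt ℝ 5 N x) : ContDiffAt ℝ 1 (fderiv4 N) x :=
  (contDiffAt_fderiv3 h).fderiv_right (by norm_num)

theorem contDiffAt_fderiv5 (h : ContDiffAt ℝ 5 N x) : ContDiffAt ℝ 0 (fderiv5 N) x :=
  (contDiffAt_fderiv4 h).fderiv_right (by norm_num)

theorem fderiv2_symm (h : ContDiffAt ℝ 5 N x) (a b : X) : fderiv2 N x a b = fderiv2 N x b a :=
  h.isSymmSndFDerivAt (by simp; norm_num) a b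

theorem fderiv3_symm_left (h : ContDiffAt ℝ 5 N x) (a b c : X) :
    fderiv3 N x a b c = fderiv3 N x b a c := by
  have := (contDiffAt_fderiv h).isSymmSndFDerivAt (by simp; norm_num) a b
  exact congrArg (fun f : X →L[ℝ] X => f c) this

/-- The symmetry of the second derivative holds near `x` and can be differentiated. -/
theorem fderiv3_symm_right (h : ContDiffAt ℝ 5 N x) (a b c : X) :
    fderiv3 N x a b c = fderiv3 N x a c b := by
  have hd : HasFDerivAt (fderiv2 N) (fderiv3 N x) x :=
    ((contDiffAt_fderiv2 h).differentiableAt (by norm_num)).hasFDerivAt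
  have h1 := (hd.clm_apply (hasFDerivAt_const b x)).clm_apply (hasFDerivAt_const c x)
  have h2 := (hd.clm_apply (hasFDerivAt_const c x)).clm_apply (hasFDerivAt_const b x)
  have h3 : (fun y => fderiv2 N y b c) =ᶠ[𝓝 x] fun y => fderiv2 N y c b := by
    filter_upwards [h.eventually (by simp)] with y hy
    exact fderiv2_symm hy b c
  have h4 := (h2.congr_of_eventuallyEq h3).unique h1
  simpa using (congrArg (fun f : X →L[ℝ] X => f a) h4).symm

theorem fderiv_nonlin (h : ContDiffAt ℝ 5 N x) (x₀ : X) :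
    fderiv ℝ (nonlin N x₀) x = fderiv ℝ N x - fderiv ℝ N x₀ := by
  have hd : HasFDerivAt N (fderiv ℝ N x) x := (h.differentiableAt (by norm_num)).hasFDerivAt
  exact (hd.sub (fderiv ℝ N x₀).hasFDerivAt).fderiv

/-- `nonlin N x₀` differs from `N` by a linear map. This is why the additional regularity, stated
for `Ñ`, concerns the derivatives of `N` itself. -/
theorem fderiv2_nonlin (h : ContDiffAt ℝ 5 N x) (x₀ : X) :
    fderiv2 (nonlin N x₀) =ᶠ[𝓝 x] fderiv2 N := by
  have h1 : fderiv ℝ (nonlin N x₀) =ᶠ[𝓝 x] fun y => fderiv ℝ N y - fderiv ℝ N x₀ := by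
    filter_upwards [h.eventually (by simp)] with y hy
    exact fderiv_nonlin hy x₀
  refine h1.fderiv.trans (Eventually.of_forall fun y => ?_)
  exact fderiv_sub_const _

theorem iteratedFDeriv_two_nonlin (h : ContDiffAt ℝ 5 N x) (x₀ a b : X) :
    iteratedFDeriv ℝ 2 (nonlin N x₀) x ![a, b] = fderiv2 N x a b := by
  rw [iteratedFDeriv_two_apply]
  change fderiv2 (nonlin N x₀) x a b = _
  rw [(fderiv2_nonlin h x₀).eq_of_nhds]

theorem iteratedFDeriv_three_nonlin (h : ContDiffAt ℝ 5 N x) (x₀ a b c : X) :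
    iteratedFDeriv ℝ 3 (nonlin N x₀) x ![a, b, c] = fderiv3 N x a b c := by
  rw [iteratedFDeriv_succ_apply_right, iteratedFDeriv_two_apply]
  change fderiv ℝ (fderiv2 (nonlin N x₀)) x a b c = _
  rw [(fderiv2_nonlin h x₀).fderiv.eq_of_nhds]

theorem iteratedFDeriv_four_nonlin (h : ContDiffAt ℝ 5 N x) (x₀ a b c d : X) :
    iteratedFDeriv ℝ 4 (nonlin N x₀) x ![a, b, c, d] = fderiv4 N x a b c d := by
  rw [iteratedFDeriv_succ_apply_right, iteratedFDeriv_succ_apply_right, iteratedFDeriv_two_apply]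
  change fderiv ℝ (fderiv ℝ (fderiv2 (nonlin N x₀))) x a b c d = _
  rw [(fderiv2_nonlin h x₀).fderiv.fderiv.eq_of_nhds]

end ContDiffAt

/-- Taylor's formula for the remainder of the linearization. -/
theorem norm_remainder_sub_taylor_le {N : X → X} {x y : X} {C : ℝ}
    (hN : ∀ θ ∈ Icc (0 : ℝ) 1, ContDiffAt ℝ 5 N (x + θ • y))
    (hC : ∀ θ ∈ Icc (0 : ℝ) 1, ‖fderiv5 N (x + θ • y)‖ ≤ C) :
    ‖remainder N x (x + y) - (1 / 2 : ℝ) • fderiv2 N x y y - (1 / 6 : ℝ) • fderiv3 N x y y y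
      - (1 / 24 : ℝ) • fderiv4 N x y y y y‖ ≤ C * ‖y‖ ^ 5 := by
  let f : ℕ → ℝ → X := fun k θ => match k with
    | 0 => N (x + θ • y)
    | 1 => fderiv ℝ N (x + θ • y) y
    | 2 => fderiv2 N (x + θ • y) y y
    | 3 => fderiv3 N (x + θ • y) y y y
    | 4 => fderiv4 N (x + θ • y) y y y y
    | 5 => fderiv5 N (x + θ • y) y y y y y
    | _ => 0
  have hline : ∀ θ : ℝ, HasDerivAt (fun θ : ℝ => x + θ • y) y θ := by
    intro θ
    simpa using ((hasDerivAt_id θ).smul_const y).const_add x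
  have hd : ∀ k < 5, ∀ θ ∈ Icc (0 : ℝ) 1,
      HasDerivWithinAt (f k) (f (k + 1) θ) (Icc 0 1) θ := by
    intro k hk θ hθ
    have hc := hN θ hθ
    refine HasDerivAt.hasDerivWithinAt ?_
    have hy := hasDerivAt_const θ y
    interval_cases k
    · exact (hc.differentiableAt (by norm_num)).hasFDerivAt.comp_hasDerivAt θ (hline θ)
    · have h1 := ((contDiffAt_fderiv hc).differentiableAt
        (by norm_num)).hasFDerivAt.comp_hasDerivAt θ (hline θ)
      simpa [f] using h1.clm_apply hy
    · have h1 := ((contDiffAt_fderiv2 hc).differentiableAt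
        (by norm_num)).hasFDerivAt.comp_hasDerivAt θ (hline θ)
      simpa [f] using (h1.clm_apply hy).clm_apply hy
    · have h1 := ((contDiffAt_fderiv3 hc).differentiableAt
        (by norm_num)).hasFDerivAt.comp_hasDerivAt θ (hline θ)
      simpa [f] using ((h1.clm_apply hy).clm_apply hy).clm_apply hy
    · have h1 := ((contDiffAt_fderiv4 hc).differentiableAt
        (by norm_num)).hasFDerivAt.comp_hasDerivAt θ (hline θ)
      simpa [f] using (((h1.clm_apply hy).clm_apply hy).clm_apply hy).clm_apply hy
  have hb : ∀ θ ∈ Icc (0 : ℝ) 1, ‖f 5 θ‖ ≤ C * ‖y‖ ^ 5 := by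
    intro θ hθ
    have h1 := ContinuousLinearMap.le_of_opNorm_le _ (hC θ hθ) y
    have h2 := ContinuousLinearMap.le_of_opNorm_le _ h1 y
    have h3 := ContinuousLinearMap.le_of_opNorm_le _ h2 y
    have h4 := ContinuousLinearMap.le_of_opNorm_le _ h3 y
    have h5 := ContinuousLinearMap.le_of_opNorm_le _ h4 y
    calc ‖f 5 θ‖ ≤ C * ‖y‖ * ‖y‖ * ‖y‖ * ‖y‖ * ‖y‖ := h5
      _ = C * ‖y‖ ^ 5 := by ring
  have h := norm_sub_taylor_le 5 f hd hb 1 (right_mem_Icc.2 zero_le_one)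
  simp only [one_pow, mul_one] at h
  refine le_of_eq_of_le ?_ h
  congr 1
  simp only [Finset.sum_range_succ, Finset.sum_range_zero, f, zero_smul, add_zero, one_smul,
    remainder, Nat.factorial, add_sub_cancel_left]
  norm_num
  abel

/-- Bounds for `N` and its derivatives in the balls of radius `ρ` around the points of `K`. -/
structure TubeBound (N : X → X) (K : Set X) (ρ C : ℝ) : Prop where
  pos : 0 < ρ
  contDiffAt : ∀ x ∈ K, ∀ y ∈ Metric.ball x ρ, ContDiffAt ℝ 5 N y
  norm_le : ∀ x ∈ K, ∀ y ∈ Metric.ball x ρ, ‖N y‖ ≤ C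
  norm_fderiv_le : ∀ x ∈ K, ∀ y ∈ Metric.ball x ρ, ‖fderiv ℝ N y‖ ≤ C
  norm_fderiv2_le : ∀ x ∈ K, ∀ y ∈ Metric.ball x ρ, ‖fderiv2 N y‖ ≤ C
  norm_fderiv3_le : ∀ x ∈ K, ∀ y ∈ Metric.ball x ρ, ‖fderiv3 N y‖ ≤ C
  norm_fderiv4_le : ∀ x ∈ K, ∀ y ∈ Metric.ball x ρ, ‖fderiv4 N y‖ ≤ C
  norm_fderiv5_le : ∀ x ∈ K, ∀ y ∈ Metric.ball x ρ, ‖fderiv5 N y‖ ≤ C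

theorem exists_tubeBound {N : X → X} {K : Set X} (hK : IsCompact K) {δ : ℝ} (hδ : 0 < δ)
    (hN : ContDiffOn ℝ 5 N (Metric.thickening δ K)) : ∃ ρ C : ℝ, TubeBound N K ρ C := by
  have hU : IsOpen (Metric.thickening δ K) := Metric.isOpen_thickening
  have hAt : ∀ y ∈ Metric.thickening δ K, ContDiffAt ℝ 5 N y :=
    fun y hy => hN.contDiffAt (hU.mem_nhds hy)
  have hG : ContinuousOn (fun y => ‖N y‖ + ‖fderiv ℝ N y‖ + ‖fderiv2 N y‖ + ‖fderiv3 N y‖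
      + ‖fderiv4 N y‖ + ‖fderiv5 N y‖) (Metric.thickening δ K) := by
    intro y hy
    have h := hAt y hy
    exact (((((h.continuousAt.norm.add (contDiffAt_fderiv h).continuousAt.norm).add
      (contDiffAt_fderiv2 h).continuousAt.norm).add (contDiffAt_fderiv3 h).continuousAt.norm).add
      (contDiffAt_fderiv4 h).continuousAt.norm).add
      (contDiffAt_fderiv5 h).continuousAt.norm).continuousWithinAt
  obtain ⟨ρ, hρ, C, h⟩ := exists_ball_bound_of_continuousOn hK hU
    (Metric.self_subset_thickening hδ K) hG
  have hnn : ∀ y, 0 ≤ ‖N y‖ ∧ 0 ≤ ‖fderiv ℝ N y‖ ∧ 0 ≤ ‖fderiv2 N y‖ ∧ 0 ≤ ‖fderiv3 N y‖ ∧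
      0 ≤ ‖fderiv4 N y‖ ∧ 0 ≤ ‖fderiv5 N y‖ := fun y =>
    ⟨norm_nonneg _, norm_nonneg _, norm_nonneg _, norm_nonneg _, norm_nonneg _, norm_nonneg _⟩
  have key : ∀ x ∈ K, ∀ y ∈ Metric.ball x ρ, ‖N y‖ ≤ C ∧ ‖fderiv ℝ N y‖ ≤ C ∧ ‖fderiv2 N y‖ ≤ C ∧
      ‖fderiv3 N y‖ ≤ C ∧ ‖fderiv4 N y‖ ≤ C ∧ ‖fderiv5 N y‖ ≤ C := by
    intro x hx y hy
    have h1 := (h x hx y hy).2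
    obtain ⟨a1, a2, a3, a4, a5, a6⟩ := hnn y
    refine ⟨?_, ?_, ?_, ?_, ?_, ?_⟩ <;> linarith
  exact ⟨ρ, C, hρ, fun x hx y hy => hAt y (h x hx y hy).1, fun x hx y hy => (key x hx y hy).1,
    fun x hx y hy => (key x hx y hy).2.1, fun x hx y hy => (key x hx y hy).2.2.1,
    fun x hx y hy => (key x hx y hy).2.2.2.1, fun x hx y hy => (key x hx y hy).2.2.2.2.1,
    fun x hx y hy => (key x hx y hy).2.2.2.2.2⟩

namespace TubeBound

variable {N : X → X} {K : Set X} {ρ C : ℝ}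

theorem norm_sub_le (hT : TubeBound N K ρ C) {x y z : X} (hx : x ∈ K)
    (hy : y ∈ Metric.ball x ρ) (hz : z ∈ Metric.ball x ρ) : ‖N y - N z‖ ≤ C * ‖y - z‖ :=
  (convex_ball x ρ).norm_image_sub_le_of_norm_fderiv_le
    (fun w hw => (hT.contDiffAt x hx w hw).differentiableAt (by norm_num))
    (fun w hw => hT.norm_fderiv_le x hx w hw) hz hy

theorem norm_fderiv_sub_le (hT : TubeBound N K ρ C) {x y z : X} (hx : x ∈ K)
    (hy : y ∈ Metric.ball x ρ) (hz : z ∈ Metric.ball x ρ) :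
    ‖fderiv ℝ N y - fderiv ℝ N z‖ ≤ C * ‖y - z‖ :=
  (convex_ball x ρ).norm_image_sub_le_of_norm_fderiv_le
    (fun w hw => (contDiffAt_fderiv (hT.contDiffAt x hx w hw)).differentiableAt (by norm_num))
    (fun w hw => hT.norm_fderiv2_le x hx w hw) hz hy

theorem norm_remainder_sub_taylor_le (hT : TubeBound N K ρ C) {x y : X} (hx : x ∈ K)
    (hy : ‖y‖ < ρ) :
    ‖remainder N x (x + y) - (1 / 2 : ℝ) • fderiv2 N x y y - (1 / 6 : ℝ) • fderiv3 N x y y y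
      - (1 / 24 : ℝ) • fderiv4 N x y y y y‖ ≤ C * ‖y‖ ^ 5 := by
  have hmem : ∀ θ ∈ Icc (0 : ℝ) 1, x + θ • y ∈ Metric.ball x ρ := by
    intro θ hθ
    rw [mem_ball_iff_norm, add_sub_cancel_left, norm_smul, Real.norm_eq_abs, abs_of_nonneg hθ.1]
    refine lt_of_le_of_lt ?_ hy
    have := norm_nonneg y
    nlinarith [hθ.2]
  exact EPIRKConv.norm_remainder_sub_taylor_le (fun θ hθ => hT.contDiffAt x hx _ (hmem θ hθ))
    (fun θ hθ => hT.norm_fderiv5_le x hx _ (hmem θ hθ))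

end TubeBound

end Taylor

/-! ### Calculus with error terms `O(hⁿ)`, uniform in further parameters -/

section OrderCalculus

open Asymptotics

variable {ι : Type*} {l : Filter ι} {h : ι → ℝ} {E F : Type*} [NormedAddCommGroup E]
  [NormedAddCommGroup F]

/-- `f = O(hⁿ)` along the filter `l`. -/
def OPow (l : Filter ι) (h : ι → ℝ) (n : ℕ) (f : ι → E) : Prop :=
  f =O[l] fun p => h p ^ n

namespace OPow

variable {m n : ℕ} {f g : ι → E}

theorem add (hf : OPow l h n f) (hg : OPow l h n g) : OPow l h n fun p => f p + g p :=
  IsBigO.add hf hg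

theorem sub (hf : OPow l h n f) (hg : OPow l h n g) : OPow l h n fun p => f p - g p :=
  IsBigO.sub hf hg

theorem sum {σ : Type*} {s : Finset σ} {f : σ → ι → E} (hf : ∀ i ∈ s, OPow l h n (f i)) :
    OPow l h n fun p => ∑ i ∈ s, f i p :=
  IsBigO.fun_sum hf

theorem congr (hf : OPow l h n f) (hfg : ∀ p, f p = g p) : OPow l h n g :=
  (funext hfg : f = g) ▸ hf

theorem congr' (hf : OPow l h n f) (hfg : f =ᶠ[l] g) : OPow l h n g :=
  IsBigO.congr' hf hfg EventuallyEq.rfl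

theorem mono (hf : OPow l h n f) (hh : h =O[l] (1 : ι → ℝ)) (hmn : m ≤ n) : OPow l h m f := by
  refine IsBigO.trans hf ?_
  obtain ⟨d, rfl⟩ := Nat.exists_eq_add_of_le hmn
  have := (isBigO_refl (fun p => h p ^ m) l).mul (hh.pow d)
  simpa [pow_add] using this

theorem of_norm_le {C : ℝ} (hf : ∀ᶠ p in l, ‖f p‖ ≤ C) : OPow l h 0 f :=
  IsBigO.of_bound C (by filter_upwards [hf] with p hp; simpa using hp)

theorem exists_norm_le (hf : OPow l h 0 f) : ∃ C : ℝ, ∀ᶠ p in l, ‖f p‖ ≤ C := by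
  obtain ⟨C, hC⟩ := IsBigO.bound hf
  exact ⟨C, hC.mono fun p hp => by simpa using hp⟩

theorem tendsto_zero (hf : OPow l h (n + 1) f) (hh : Tendsto h l (𝓝 0)) : Tendsto f l (𝓝 0) := by
  refine IsBigO.trans_tendsto hf ?_
  simpa using hh.pow (n + 1)

variable [NormedSpace ℝ E] [NormedSpace ℝ F]

theorem const_smul (c : ℝ) (hf : OPow l h n f) : OPow l h n fun p => c • f p :=
  IsBigO.const_smul_left hf c

theorem pow_smul (k : ℕ) (hf : OPow l h n f) : OPow l h (k + n) fun p => h p ^ k • f p := by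
  have := (isBigO_refl (fun p => h p ^ k) l).smul hf
  simpa [OPow, pow_add] using this

theorem smul (hf : OPow l h n f) : OPow l h (n + 1) fun p => h p • f p := by
  have := hf.pow_smul 1
  simp only [pow_one] at this
  rwa [add_comm] at this

end OPow

theorem isBigO_one_of_tendsto_zero (hh : Tendsto h l (𝓝 0)) : h =O[l] (1 : ι → ℝ) :=
  hh.isBigO_one ℝ

variable [NormedSpace ℝ E] [NormedSpace ℝ F]

theorem isBigO_clm_apply {B : ι → E →L[ℝ] F} {v : ι → E} {f g : ι → ℝ} (hB : B =O[l] f)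
    (hv : v =O[l] g) : (fun p => B p (v p)) =O[l] fun p => f p * g p :=
  (IsBigO.of_bound 1 (Eventually.of_forall fun p => by
    simpa using (B p).le_opNorm (v p))).trans (hB.norm_left.mul hv.norm_left)

theorem OPow.apply {m n : ℕ} {f : ι → E} {B : ι → E →L[ℝ] F} (hB : OPow l h m B)
    (hf : OPow l h n f) : OPow l h (m + n) fun p => B p (f p) := by
  have := isBigO_clm_apply hB hf
  simpa [OPow, pow_add] using this

end OrderCalculus

/-! ### Expansion of the remainder of the linearization up to order four. -/

section RemainderExpansion

set_option maxSynthPendingDepth 8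

variable {X : Type*} [NormedAddCommGroup X] [NormedSpace ℝ X]
  {ι : Type*} {l : Filter ι} {h : ι → ℝ} {N : X → X} {K : Set X} {ρ C : ℝ}

/-- The coefficient of `h⁴` in the expansion of the remainder at `x + h y₁ + h² y₂ + h³ y₃`. -/
noncomputable def remainderFour (N : X → X) (x y₁ y₂ y₃ : X) : X :=
  fderiv2 N x y₁ y₃ + (1 / 2 : ℝ) • fderiv2 N x y₂ y₂ + (1 / 2 : ℝ) • fderiv3 N x y₁ y₁ y₂
    + (1 / 24 : ℝ) • fderiv4 N x y₁ y₁ y₁ y₁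

/-- Expansion of the remainder of the linearization at `x + y` if
`y = h y₁ + h² y₂ + h³ y₃ + O(h⁴)`. -/
theorem TubeBound.remainder_expansion (hT : TubeBound N K ρ C) (hh : Tendsto h l (𝓝 0))
    {x y y₁ y₂ y₃ : ι → X} (hx : ∀ᶠ p in l, x p ∈ K) (h₁ : OPow l h 0 y₁) (h₂ : OPow l h 0 y₂)
    (h₃ : OPow l h 0 y₃)
    (hy : OPow l h 4 fun p => y p - (h p • y₁ p + h p ^ 2 • y₂ p + h p ^ 3 • y₃ p)) :
    OPow l h 5 fun p => remainder N (x p) (x p + y p)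
      - (h p ^ 2 • (1 / 2 : ℝ) • fderiv2 N (x p) (y₁ p) (y₁ p)
        + h p ^ 3 • (fderiv2 N (x p) (y₁ p) (y₂ p)
          + (1 / 6 : ℝ) • fderiv3 N (x p) (y₁ p) (y₁ p) (y₁ p))
        + h p ^ 4 • remainderFour N (x p) (y₁ p) (y₂ p) (y₃ p)) := by
  have hO := isBigO_one_of_tendsto_zero hh
  -- The successive tails of `y`: `e = O(h⁴)`, `e₂ = O(h³)`, `e₁ = O(h²)`. Each derivative is
  -- expanded only as far as terms of order `h⁵` require.
  set e : ι → X := fun p => y p - (h p • y₁ p + h p ^ 2 • y₂ p + h p ^ 3 • y₃ p) with he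
  set e₂ : ι → X := fun p => h p ^ 3 • y₃ p + e p with he₂
  set e₁ : ι → X := fun p => h p ^ 2 • y₂ p + e₂ p with he₁
  have hye₁ : ∀ p, y p = h p • y₁ p + e₁ p := fun p => by simp only [he₁, he₂, he]; abel
  have oe₂ : OPow l h 3 e₂ := (h₃.pow_smul 3).add (hy.mono hO (by norm_num))
  have oe₁ : OPow l h 2 e₁ := (h₂.pow_smul 2).add (oe₂.mono hO (by norm_num))
  have oy : OPow l h 1 y := (h₁.smul.add (oe₁.mono hO (by norm_num))).congr fun p => (hye₁ p).symm
  have ohy₁ : OPow l h 1 fun p => h p • y₁ p := h₁.smul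
  have hself : ∀ z ∈ K, z ∈ Metric.ball z ρ := fun z _ => Metric.mem_ball_self hT.pos
  have oD2 : OPow l h 0 fun p => fderiv2 N (x p) :=
    OPow.of_norm_le (hx.mono fun p hp => hT.norm_fderiv2_le _ hp _ (hself _ hp))
  have oD3 : OPow l h 0 fun p => fderiv3 N (x p) :=
    OPow.of_norm_le (hx.mono fun p hp => hT.norm_fderiv3_le _ hp _ (hself _ hp))
  have oD4 : OPow l h 0 fun p => fderiv4 N (x p) :=
    OPow.of_norm_le (hx.mono fun p hp => hT.norm_fderiv4_le _ hp _ (hself _ hp))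
  have hsymm : ∀ᶠ p in l, ContDiffAt ℝ 5 N (x p) :=
    hx.mono fun p hp => hT.contDiffAt _ hp _ (hself _ hp)
  have t0 : OPow l h 5 fun p => remainder N (x p) (x p + y p)
      - (1 / 2 : ℝ) • fderiv2 N (x p) (y p) (y p)
      - (1 / 6 : ℝ) • fderiv3 N (x p) (y p) (y p) (y p)
      - (1 / 24 : ℝ) • fderiv4 N (x p) (y p) (y p) (y p) (y p) := by
    have hsmall : ∀ᶠ p in l, ‖y p‖ < ρ := by
      have := (oy.tendsto_zero (n := 0) hh).norm
      rw [norm_zero] at this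
      exact this.eventually (gt_mem_nhds hT.pos)
    have h5 : (fun p => ‖y p‖ ^ 5) =O[l] fun p => h p ^ 5 := by
      have h6 : (fun p => ‖y p‖) =O[l] fun p => h p ^ 1 := Asymptotics.IsBigO.norm_left oy
      simpa using h6.pow 5
    refine Asymptotics.IsBigO.trans (Asymptotics.IsBigO.of_bound C ?_) h5
    filter_upwards [hx, hsmall] with p hp hs
    simpa using hT.norm_remainder_sub_taylor_le hp hs
  have t2 : OPow l h 5 fun p => fderiv2 N (x p) (y p) (y p)
      - (h p ^ 2 • fderiv2 N (x p) (y₁ p) (y₁ p)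
        + h p ^ 3 • (2 : ℝ) • fderiv2 N (x p) (y₁ p) (y₂ p)
        + h p ^ 4 • ((2 : ℝ) • fderiv2 N (x p) (y₁ p) (y₃ p) + fderiv2 N (x p) (y₂ p) (y₂ p))) := by
    have a1 : OPow l h 5 fun p => fderiv2 N (x p) (e p) (y p) := (oD2.apply hy).apply oy
    have a2 : OPow l h 5 fun p => fderiv2 N (x p) (y p - e p) (e p) :=
      (oD2.apply (oy.sub (hy.mono hO (by norm_num)))).apply hy
    have a3 : OPow l h 5 fun p => h p ^ 5 • (fderiv2 N (x p) (y₂ p) (y₃ p)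
        + fderiv2 N (x p) (y₃ p) (y₂ p)) :=
      (((oD2.apply h₂).apply h₃).add ((oD2.apply h₃).apply h₂)).pow_smul 5
    have a4 : OPow l h 5 fun p => h p ^ 6 • fderiv2 N (x p) (y₃ p) (y₃ p) :=
      (((oD2.apply h₃).apply h₃).pow_smul 6).mono hO (by norm_num)
    refine (((a1.add a2).add a3).add a4).congr' ?_
    filter_upwards [hsymm] with p hp
    have s1 := fderiv2_symm hp (y₂ p) (y₁ p)
    have s2 := fderiv2_symm hp (y₃ p) (y₁ p)
    have hyp : y p = h p • y₁ p + h p ^ 2 • y₂ p + h p ^ 3 • y₃ p + e p := by simp [he]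
    rw [hyp]
    simp only [map_add, map_sub, map_smul, add_apply, sub_apply, smul_apply, s1, s2]
    module
  have t3 : OPow l h 5 fun p => fderiv3 N (x p) (y p) (y p) (y p)
      - (h p ^ 3 • fderiv3 N (x p) (y₁ p) (y₁ p) (y₁ p)
        + h p ^ 4 • (3 : ℝ) • fderiv3 N (x p) (y₁ p) (y₁ p) (y₂ p)) := by
    -- With `y = h y₁ + e₁`, the terms `b2`-`b4` contain `e₁` at least twice. Those with a single
    -- `e₁` agree by symmetry, and `b1` is what is left of them after the `h⁴` part is removed.
    have b1 : OPow l h 5 fun p => h p ^ 2 • (3 : ℝ) • fderiv3 N (x p) (y₁ p) (y₁ p) (e₂ p) :=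
      ((((oD3.apply h₁).apply h₁).apply oe₂).const_smul 3).pow_smul 2
    have b2 : OPow l h 5 fun p => fderiv3 N (x p) (h p • y₁ p) (e₁ p) (e₁ p) :=
      ((oD3.apply ohy₁).apply oe₁).apply oe₁
    have b3 : OPow l h 5 fun p => fderiv3 N (x p) (e₁ p) (h p • y₁ p) (e₁ p) :=
      ((oD3.apply oe₁).apply ohy₁).apply oe₁
    have b4 : OPow l h 5 fun p => fderiv3 N (x p) (e₁ p) (e₁ p) (y p) :=
      ((oD3.apply oe₁).apply oe₁).apply oy
    refine (((b1.add b2).add b3).add b4).congr' ?_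
    filter_upwards [hsymm] with p hp
    have s1 : ∀ v, fderiv3 N (x p) (y₁ p) v (y₁ p) = fderiv3 N (x p) (y₁ p) (y₁ p) v :=
      fun v => fderiv3_symm_right hp _ _ _
    have s2 : ∀ v, fderiv3 N (x p) v (y₁ p) (y₁ p) = fderiv3 N (x p) (y₁ p) (y₁ p) v :=
      fun v => (fderiv3_symm_left hp _ _ _).trans (s1 v)
    have s3 : e₁ p = h p ^ 2 • y₂ p + e₂ p := rfl
    have s4 : fderiv3 N (x p) (y₁ p) (y₁ p) (e₁ p) = h p ^ 2 • fderiv3 N (x p) (y₁ p) (y₁ p) (y₂ p)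
        + fderiv3 N (x p) (y₁ p) (y₁ p) (e₂ p) := by rw [s3, map_add, map_smul]
    rw [hye₁ p]
    simp only [map_add, map_smul, add_apply, smul_apply, s1, s2, s4]
    module
  have t4 : OPow l h 5 fun p => fderiv4 N (x p) (y p) (y p) (y p) (y p)
      - h p ^ 4 • fderiv4 N (x p) (y₁ p) (y₁ p) (y₁ p) (y₁ p) := by
    -- The arguments are replaced one after the other, so no symmetry of the fourth derivative is
    -- needed.
    have c1 : OPow l h 5 fun p => fderiv4 N (x p) (e₁ p) (y p) (y p) (y p) :=
      (((oD4.apply oe₁).apply oy).apply oy).apply oy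
    have c2 : OPow l h 5 fun p => fderiv4 N (x p) (h p • y₁ p) (e₁ p) (y p) (y p) :=
      (((oD4.apply ohy₁).apply oe₁).apply oy).apply oy
    have c3 : OPow l h 5 fun p => fderiv4 N (x p) (h p • y₁ p) (h p • y₁ p) (e₁ p) (y p) :=
      (((oD4.apply ohy₁).apply ohy₁).apply oe₁).apply oy
    have c4 : OPow l h 5 fun p => fderiv4 N (x p) (h p • y₁ p) (h p • y₁ p) (h p • y₁ p) (e₁ p) :=
      (((oD4.apply ohy₁).apply ohy₁).apply ohy₁).apply oe₁
    refine (((c1.add c2).add c3).add c4).congr fun p => ?_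
    rw [hye₁ p]
    simp only [map_add, map_smul, add_apply, smul_apply]
    module
  refine (((t0.add (t2.const_smul (1 / 2))).add (t3.const_smul (1 / 6))).add
    (t4.const_smul (1 / 24))).congr fun p => ?_
  simp only [remainderFour]
  module

end RemainderExpansion

/-! ### Uniform estimates for `φ`-functions of perturbed generators -/

section UniformPhi

open Asymptotics

variable {X : Type*} [NormedAddCommGroup X] [NormedSpace ℝ X]
  {ι : Type*} {l : Filter ι} {h : ι → ℝ}

/-- `w` takes values in the domain of the operators `J`, and `J w` is bounded. -/
def BddImage (l : Filter ι) (h : ι → ℝ) (J : ι → X →ₗ.[ℝ] X) (w : ι → X) : Prop :=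
  ∃ z : ι → X, OPow l h 0 z ∧ ∀ᶠ p in l, (w p, z p) ∈ (J p).graph

theorem BddImage.add {J : ι → X →ₗ.[ℝ] X} {v w : ι → X} (hv : BddImage l h J v)
    (hw : BddImage l h J w) : BddImage l h J fun p => v p + w p := by
  obtain ⟨y, hy, hvy⟩ := hv
  obtain ⟨z, hz, hwz⟩ := hw
  refine ⟨_, hy.add hz, ?_⟩
  filter_upwards [hvy, hwz] with p h1 h2
  exact (J p).graph.add_mem h1 h2

theorem BddImage.const_smul {J : ι → X →ₗ.[ℝ] X} {w : ι → X} (c : ℝ) (hw : BddImage l h J w) :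
    BddImage l h J fun p => c • w p := by
  obtain ⟨z, hz, hwz⟩ := hw
  refine ⟨_, hz.const_smul c, ?_⟩
  filter_upwards [hwz] with p h1
  exact (J p).graph.smul_mem c h1

theorem eventually_mul_mem_Icc (hh : Tendsto h l (𝓝 0)) (hpos : ∀ᶠ p in l, 0 < h p) (g : ℝ≥0)
    {τ₀ : ℝ} (hτ₀ : 0 < τ₀) : ∀ᶠ p in l, (g : ℝ) * h p ∈ Icc 0 τ₀ := by
  have h1 : Tendsto (fun p => (g : ℝ) * h p) l (𝓝 0) := by simpa using hh.const_mul (g : ℝ)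
  filter_upwards [h1.eventually (gt_mem_nhds hτ₀), hpos] with p hp hp'
  exact ⟨by positivity, hp.le⟩

variable [CompleteSpace X] {L : X →ₗ.[ℝ] X} {B B' : ι → X →L[ℝ] X}

theorem phiL_opow (hL : GeneratesC0Semigroup L) (hh : Tendsto h l (𝓝 0))
    (hpos : ∀ᶠ p in l, 0 < h p) (hB : OPow l h 0 B) (g : ℝ≥0) (k : ℕ) :
    OPow l h 0 fun p => phiL (perturb L (B p)) ((g : ℝ) * h p) k := by
  obtain ⟨β, hβ⟩ := hB.exists_norm_le
  obtain ⟨τ₀, hτ₀, M, _, hM⟩ := exists_uniform_opExp_bound hL β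
  refine OPow.of_norm_le (C := M) ?_
  filter_upwards [hβ, eventually_mul_mem_Icc hh hpos g hτ₀] with p hp hp'
  exact norm_phiL_le (generatesC0Semigroup_perturb hL _) hp'.1
    (fun t ht => (hM _ hp t ⟨ht.1, ht.2.trans hp'.2⟩).1) k

theorem opL_opow (hL : GeneratesC0Semigroup L) (hh : Tendsto h l (𝓝 0))
    (hpos : ∀ᶠ p in l, 0 < h p) (hB : OPow l h 0 B) (c : PhiComb) :
    OPow l h 0 fun p => PhiComb.opL (perturb L (B p)) (h p) c := by
  simp only [PhiComb.opL, Finsupp.linearCombination_apply, Finsupp.sum]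
  exact OPow.sum fun kg _ => (phiL_opow hL hh hpos hB kg.2 kg.1).const_smul _

/-- The factor `h` comes from Duhamel's formula: two perturbed semigroups differ by at most a
multiple of the elapsed time, which is at most `g h`. -/
theorem phiL_sub_isBigO (hL : GeneratesC0Semigroup L) (hh : Tendsto h l (𝓝 0))
    (hpos : ∀ᶠ p in l, 0 < h p) (hB : OPow l h 0 B) (hB' : OPow l h 0 B') (g : ℝ≥0) (k : ℕ) :
    (fun p => phiL (perturb L (B p)) ((g : ℝ) * h p) k - phiL (perturb L (B' p)) ((g : ℝ) * h p) k)
      =O[l] fun p => h p * ‖B p - B' p‖ := by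
  obtain ⟨β, hβ⟩ := hB.exists_norm_le
  obtain ⟨β', hβ'⟩ := hB'.exists_norm_le
  obtain ⟨τ₀, hτ₀, M, hM0, hM⟩ := exists_uniform_opExp_bound hL (max β β')
  refine IsBigO.of_bound (M * g) ?_
  filter_upwards [hβ, hβ', eventually_mul_mem_Icc hh hpos g hτ₀, hpos] with p hp hp' hgh hp0
  have hle := norm_phiL_sub_le (generatesC0Semigroup_perturb hL (B p))
    (generatesC0Semigroup_perturb hL (B' p)) hgh.1 (M := M * ((g : ℝ) * h p) * ‖B p - B' p‖)
    (fun t ht => ((hM _ (hp.trans (le_max_left _ _)) t ⟨ht.1, ht.2.trans hgh.2⟩).2 _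
      (hp'.trans (le_max_right _ _))).trans (by have := ht.2; gcongr)) k
  refine hle.trans (le_of_eq ?_)
  rw [norm_mul, norm_norm, Real.norm_eq_abs, abs_of_pos hp0]
  ring

theorem opL_sub_isBigO (hL : GeneratesC0Semigroup L) (hh : Tendsto h l (𝓝 0))
    (hpos : ∀ᶠ p in l, 0 < h p) (hB : OPow l h 0 B) (hB' : OPow l h 0 B') (c : PhiComb) :
    (fun p => PhiComb.opL (perturb L (B p)) (h p) c - PhiComb.opL (perturb L (B' p)) (h p) c)
      =O[l] fun p => h p * ‖B p - B' p‖ := by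
  simp only [PhiComb.opL, Finsupp.linearCombination_apply, Finsupp.sum, ← Finset.sum_sub_distrib,
    ← smul_sub]
  exact IsBigO.fun_sum fun kg _ =>
    (phiL_sub_isBigO hL hh hpos hB hB' kg.2 kg.1).const_smul_left (c kg)

/-- From `c(z) = c(0) + z c₁(z)`: if `J w` is bounded, then `h J c₁(h J) w = h c₁(h J) J w` is of
size `h`. This is what allows conditions at `z = 0` only in the highest order. -/
theorem BddImage.opL_sub_opow (hL : GeneratesC0Semigroup L) (hh : Tendsto h l (𝓝 0))
    (hpos : ∀ᶠ p in l, 0 < h p) (hB : OPow l h 0 B) {w : ι → X}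
    (hw : BddImage l h (fun p => perturb L (B p)) w) (c : PhiComb) :
    OPow l h 1 fun p => PhiComb.opL (perturb L (B p)) (h p) c (w p) - c.eval (0 : ℝ) • w p := by
  obtain ⟨z, hz, hwz⟩ := hw
  refine (((opL_opow hL hh hpos hB c.shift).apply hz).smul).congr' ?_
  filter_upwards [hwz, hpos] with p h1 h2
  rw [PhiComb.opL_eq_add_of_mem_graph (generatesC0Semigroup_perturb hL _) h2.le c h1,
    add_sub_cancel_left]

end UniformPhi

/-! ### The stages of the method -/

section Stages

variable {X : Type*} [NormedAddCommGroup X] [NormedSpace ℝ X]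

namespace Method

/-- The internal stages, where `J = J(x)` and `f = f(x)`. -/
noncomputable def stage (m : Method) (J : X →ₗ.[ℝ] X) (N : X → X) (h : ℝ) (x f : X) (i : ℕ) : X :=
  x + (m.α i * h) • PhiComb.opL J h (m.psi i) f
    + h • ∑ j ∈ (Finset.Ico 2 i).attach,
      PhiComb.opL J h (m.a i j) (remainder N x (stage m J N h x f j))
  termination_by i
  decreasing_by exact (Finset.mem_Ico.1 j.2).2

theorem stage_eq (m : Method) (J : X →ₗ.[ℝ] X) (N : X → X) (h : ℝ) (x f : X) (i : ℕ) :
    m.stage J N h x f i = x + (m.α i * h) • PhiComb.opL J h (m.psi i) f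
      + h • ∑ j ∈ Finset.Ico 2 i,
        PhiComb.opL J h (m.a i j) (remainder N x (m.stage J N h x f j)) := by
  rw [stage, Finset.sum_attach (Finset.Ico 2 i)
    (fun j => PhiComb.opL J h (m.a i j) (remainder N x (m.stage J N h x f j)))]

/-- The result of one step of the method. -/
noncomputable def step (m : Method) (J : X →ₗ.[ℝ] X) (N : X → X) (h : ℝ) (x f : X) : X :=
  x + h • phiL J h 1 f
    + h • ∑ i ∈ Finset.Icc 2 m.s, PhiComb.opL J h (m.b i) (remainder N x (m.stage J N h x f i))

/-- The scheme is explicit, so by strong induction any admissible stages agree with the recursively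
defined ones where they are used. -/
theorem isStep_iff [CompleteSpace X] (m : Method) {L : X →ₗ.[ℝ] X} (hL : GeneratesC0Semigroup L)
    (N : X → X) {h : ℝ} (hh : 0 ≤ h) (x : L.domain) (x' : X) :
    m.IsStep L N h x x' ↔ x' = m.step (jacobian L N x) N h x (rhs L N x) := by
  -- `jacobian L N x` unfolds to `perturb L (fderiv ℝ N x)`; results on bounded perturbations apply
  -- to it without rewriting, here and below.
  have hJ : GeneratesC0Semigroup (jacobian L N x) := generatesC0Semigroup_perturb hL _
  have hop : ∀ (c : PhiComb) (v : X), c.op (jacobian L N x) h v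
      = PhiComb.opL (jacobian L N x) h c v := fun c v => PhiComb.op_eq_opL hJ hh c v
  have hphi : ∀ v, phiOp 1 (jacobian L N x) h v = phiL (jacobian L N x) h 1 v :=
    fun v => phiOp_eq_phiL hJ hh 1 v
  constructor
  · rintro ⟨U, hU, rfl⟩
    have hUs : ∀ i ∈ Finset.Icc 2 m.s, U i = m.stage (jacobian L N x) N h x (rhs L N x) i := by
      intro i
      induction i using Nat.strong_induction_on with
      | _ i ih =>
        intro hi
        rw [hU i hi, stage_eq, hop]
        congr 2
        refine Finset.sum_congr rfl fun j hj => ?_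
        rw [Finset.mem_Ico] at hj
        rw [Finset.mem_Icc] at hi
        rw [hop, ih j hj.2 (Finset.mem_Icc.2 ⟨hj.1, by omega⟩)]
    rw [step, hphi]
    congr 2
    exact Finset.sum_congr rfl fun i hi => by rw [hop, hUs i hi]
  · rintro rfl
    refine ⟨m.stage (jacobian L N x) N h x (rhs L N x), fun i _ => ?_, ?_⟩
    · rw [stage_eq]
      simp only [hop]
    · simp only [hop, hphi]
      rfl

end Method

end Stages

/-! ### Expansion of the numerical solution -/

section NumericalExpansion

set_option maxSynthPendingDepth 8

variable {X : Type*} [NormedAddCommGroup X] [NormedSpace ℝ X]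

/-- Data `x, u', u'', u'''` along a family of points of the exact solution; `J x' = x''` and
`J x'' = x''' - N''(x)(x', x')`. -/
structure SolutionFamily {ι : Type*} (L : X →ₗ.[ℝ] X) (N : X → X) (K : Set X) (l : Filter ι)
    (h : ι → ℝ) (x d₁ d₂ d₃ : ι → X) : Prop where
  tendsto : Tendsto h l (𝓝 0)
  pos : ∀ᶠ p in l, 0 < h p
  mem : ∀ᶠ p in l, x p ∈ K
  bdd₁ : OPow l h 0 d₁
  bdd₂ : OPow l h 0 d₂
  bdd₃ : OPow l h 0 d₃
  graph₁ : ∀ᶠ p in l, (d₁ p, d₂ p) ∈ (jacobian L N (x p)).graph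
  graph₂ : ∀ᶠ p in l, (d₂ p, d₃ p - fderiv2 N (x p) (d₁ p) (d₁ p)) ∈ (jacobian L N (x p)).graph
  image₃ : BddImage l h (fun p => jacobian L N (x p)) d₃

variable {ι : Type*} {l : Filter ι} {h : ι → ℝ} {L : X →ₗ.[ℝ] X} {N : X → X}
  {K : Set X} {ρ C : ℝ} {x d₁ d₂ d₃ : ι → X}

theorem TubeBound.fderiv_opow (hT : TubeBound N K ρ C) (hx : ∀ᶠ p in l, x p ∈ K) :
    OPow l h 0 fun p => fderiv ℝ N (x p) :=
  OPow.of_norm_le (hx.mono fun _ hp =>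
    hT.norm_fderiv_le _ hp _ (Metric.mem_ball_self hT.pos))

theorem TubeBound.fderiv2_opow (hT : TubeBound N K ρ C) (hx : ∀ᶠ p in l, x p ∈ K) :
    OPow l h 0 fun p => fderiv2 N (x p) :=
  OPow.of_norm_le (hx.mono fun _ hp =>
    hT.norm_fderiv2_le _ hp _ (Metric.mem_ball_self hT.pos))

theorem TubeBound.fderiv3_opow (hT : TubeBound N K ρ C) (hx : ∀ᶠ p in l, x p ∈ K) :
    OPow l h 0 fun p => fderiv3 N (x p) :=
  OPow.of_norm_le (hx.mono fun _ hp =>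
    hT.norm_fderiv3_le _ hp _ (Metric.mem_ball_self hT.pos))

theorem TubeBound.fderiv4_opow (hT : TubeBound N K ρ C) (hx : ∀ᶠ p in l, x p ∈ K) :
    OPow l h 0 fun p => fderiv4 N (x p) :=
  OPow.of_norm_le (hx.mono fun _ hp =>
    hT.norm_fderiv4_le _ hp _ (Metric.mem_ball_self hT.pos))

theorem opL_psi_eq (m : Method) (J : X →ₗ.[ℝ] X) (τ : ℝ) (i : ℕ) (v : X) :
    PhiComb.opL J τ (m.psi i) v
      = ∑ k ∈ Finset.Icc 1 m.K, m.p i k • phiL J ((m.g i : ℝ) * τ) (k : ℕ) v := by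
  simp [Method.psi, map_sum, PhiComb.opL_single]

theorem opL_bigPsi_eq (m : Method) (J : X →ₗ.[ℝ] X) (τ : ℝ) (i : ℕ) (v : X) :
    PhiComb.opL J τ (m.bigPsi i) v
      = (1 / 2 : ℝ) • ∑ j ∈ Finset.Ico 2 i, (m.α j ^ 2 * m.P j 1 ^ 2) • PhiComb.opL J τ (m.a i j) v
        - (m.α i * (m.g i : ℝ) ^ 2) • ∑ k ∈ Finset.Icc 1 m.K,
          m.p i k • phiL J ((m.g i : ℝ) * τ) ((k : ℕ) + 2) v := by
  simp [Method.bigPsi, map_sum, PhiComb.opL_single]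

variable [CompleteSpace X]

theorem generatesC0Semigroup_jacobian (hL : GeneratesC0Semigroup L) (N : X → X) (x : X) :
    GeneratesC0Semigroup (jacobian L N x) :=
  generatesC0Semigroup_perturb hL _

/-- Expansion of the first term of an internal stage. -/
theorem opL_psi_expansion (m : Method) {J : X →ₗ.[ℝ] X} (hJ : GeneratesC0Semigroup J) {τ : ℝ}
    (hτ : 0 ≤ τ) (i : ℕ) {d₁ d₂ d₃ q z : X} (h₁ : (d₁, d₂) ∈ J.graph)
    (h₂ : (d₂, d₃ - q) ∈ J.graph) (h₃ : (d₃, z) ∈ J.graph) :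
    PhiComb.opL J τ (m.psi i) d₁ = m.P i 1 • d₁ + (τ * (m.g i * m.P i 2)) • d₂
      + (τ ^ 2 * (m.g i ^ 2 * m.P i 3)) • d₃
      - (τ ^ 2 * m.g i ^ 2) • ∑ k ∈ Finset.Icc 1 m.K,
          m.p i k • phiL J ((m.g i : ℝ) * τ) ((k : ℕ) + 2) q
      + (τ ^ 3 * m.g i ^ 3) • ∑ k ∈ Finset.Icc 1 m.K,
          m.p i k • phiL J ((m.g i : ℝ) * τ) ((k : ℕ) + 3) z := by
  have hgτ : 0 ≤ (m.g i : ℝ) * τ := by positivity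
  rw [opL_psi_eq]
  simp only [Method.P, Finset.mul_sum, Finset.sum_smul, Finset.smul_sum, ← Finset.sum_add_distrib,
    ← Finset.sum_sub_distrib]
  refine Finset.sum_congr rfl fun k _ => ?_
  -- The recurrence for the `φ_k` is used along `d₁ → d₂ → d₃ - q`, and then once more for `d₃`
  -- alone: `J q` need not exist, so the term `φ_{k+2} q` stays.
  rw [phiL_eq_add_of_mem_graph hJ hgτ _ h₁, phiL_eq_add_of_mem_graph hJ hgτ _ h₂, map_sub,
    phiL_eq_add_of_mem_graph hJ hgτ _ h₃]
  simp only [div_eq_mul_inv, Nat.sub_self, add_zero, Nat.reduceSub]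
  module

/-- Strong induction over the stages. By the expansion of earlier stages, each remainder is `h²/2
α_{j1}² ℙ_{j1}² N''(u', u') + O(h³)`. Weighted with `h a_{ij}(h J)` and joined with the term
`φ_{k+2} N''(u', u')` left over from `ψ_{i1}`, these contributions form exactly `Ψ_i(h J) N''(u',
u')`. -/
theorem SolutionFamily.stage_expansion (hF : SolutionFamily L N K l h x d₁ d₂ d₃)
    (hT : TubeBound N K ρ C) (hL : GeneratesC0Semigroup L) (m : Method) (i : ℕ) :
    OPow l h 4 fun p => (m.stage (jacobian L N (x p)) N (h p) (x p) (d₁ p) i - x p)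
      - (h p • (m.α i * m.P i 1) • d₁ p + h p ^ 2 • (m.α i * m.g i * m.P i 2) • d₂ p
        + h p ^ 3 • ((m.α i * m.g i ^ 2 * m.P i 3) • d₃ p
          + PhiComb.opL (jacobian L N (x p)) (h p) (m.bigPsi i)
              (fderiv2 N (x p) (d₁ p) (d₁ p)))) := by
  have hO := isBigO_one_of_tendsto_zero hF.tendsto
  have hB : OPow l h 0 fun p => fderiv ℝ N (x p) := hT.fderiv_opow hF.mem
  have hq : OPow l h 0 fun p => fderiv2 N (x p) (d₁ p) (d₁ p) :=
    ((hT.fderiv2_opow hF.mem).apply hF.bdd₁).apply hF.bdd₁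
  have hop : ∀ c : PhiComb, OPow l h 0 fun p => PhiComb.opL (jacobian L N (x p)) (h p) c :=
    fun c => opL_opow hL hF.tendsto hF.pos hB c
  induction i using Nat.strong_induction_on with
  | _ i ih =>
    obtain ⟨z, hz, hzg⟩ := hF.image₃
    have hrem : ∀ j ∈ Finset.Ico 2 i, OPow l h 3 fun p =>
        remainder N (x p) (m.stage (jacobian L N (x p)) N (h p) (x p) (d₁ p) j)
          - h p ^ 2 • (1 / 2 * (m.α j ^ 2 * m.P j 1 ^ 2)) • fderiv2 N (x p) (d₁ p) (d₁ p) := by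
      intro j hj
      have y1 := hF.bdd₁.const_smul (m.α j * m.P j 1)
      have y2 := hF.bdd₂.const_smul (m.α j * m.g j * m.P j 2)
      have y3 := (hF.bdd₃.const_smul (m.α j * m.g j ^ 2 * m.P j 3)).add
        ((hop (m.bigPsi j)).apply hq)
      have D2 := hT.fderiv2_opow (l := l) (h := h) hF.mem
      have D3 := hT.fderiv3_opow (l := l) (h := h) hF.mem
      have D4 := hT.fderiv4_opow (l := l) (h := h) hF.mem
      have h1 := hT.remainder_expansion hF.tendsto hF.mem y1 y2 y3 (ih j (Finset.mem_Ico.1 hj).2)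
      have h2 := ((((D2.apply y1).apply y2).add
        ((((D3.apply y1).apply y1).apply y1).const_smul (1 / 6))).pow_smul 3)
      have h3 := (((((D2.apply y1).apply y3).add (((D2.apply y2).apply y2).const_smul (1 / 2))).add
        ((((D3.apply y1).apply y1).apply y2).const_smul (1 / 2))).add
        (((((D4.apply y1).apply y1).apply y1).apply y1).const_smul (1 / 24))).pow_smul 4
      refine (((h1.mono hO (by norm_num)).add h2).add (h3.mono hO (by norm_num))).congr fun p => ?_
      simp only [remainderFour, add_sub_cancel, map_smul, smul_apply]
      module
    have hsum : OPow l h 4 fun p => h p • ∑ j ∈ Finset.Ico 2 i,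
        PhiComb.opL (jacobian L N (x p)) (h p) (m.a i j)
          (remainder N (x p) (m.stage (jacobian L N (x p)) N (h p) (x p) (d₁ p) j)
          - h p ^ 2 • (1 / 2 * (m.α j ^ 2 * m.P j 1 ^ 2)) • fderiv2 N (x p) (d₁ p) (d₁ p)) :=
      (OPow.sum fun j hj => (((hop (m.a i j)).apply (hrem j hj)).mono hO (by norm_num) :
        OPow l h 3 _)).smul
    have hlast : OPow l h 4 fun p => h p ^ 4 • (m.α i * m.g i ^ 3) • ∑ k ∈ Finset.Icc 1 m.K,
          m.p i k • phiL (jacobian L N (x p)) ((m.g i : ℝ) * h p) ((k : ℕ) + 3) (z p) :=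
      ((OPow.sum fun (k : ℕ+) _ => (((phiL_opow hL hF.tendsto hF.pos hB (m.g i) (k + 3)).apply
        hz).const_smul (m.p i k))).const_smul _).pow_smul 4
    refine (hsum.add hlast).congr' ?_
    filter_upwards [hF.graph₁, hF.graph₂, hzg, hF.pos] with p g1 g2 g3 hp
    rw [Method.stage_eq, opL_psi_expansion m (generatesC0Semigroup_jacobian hL N (x p)) hp.le i g1 g2 g3,
      opL_bigPsi_eq]
    simp only [map_sub, map_smul, Finset.sum_sub_distrib, Finset.smul_sum (r := (1 / 2 : ℝ))]
    have e1 : ∀ (f : ℕ → X), ∑ j ∈ Finset.Ico 2 i, h p ^ 2 • (1 / 2 * (m.α j ^ 2 * m.P j 1 ^ 2)) • f j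
        = h p ^ 2 • ∑ j ∈ Finset.Ico 2 i, (1 / 2 : ℝ) • (m.α j ^ 2 * m.P j 1 ^ 2) • f j := by
      intro f
      rw [Finset.smul_sum]
      exact Finset.sum_congr rfl fun j _ => by module
    rw [e1]
    module

/-- Transfers C1-C3 to the operators `b_i(h J)`. -/
theorem sum_smul_opL_eq (m : Method) {J : X →ₗ.[ℝ] X} (hJ : GeneratesC0Semigroup J) {τ : ℝ}
    (hτ : 0 ≤ τ) (w : ℕ → ℝ) (n : ℕ+) (r : ℝ)
    (H : ∀ Z : Matrix (Fin 1) (Fin 1) ℝ,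
      ∑ i ∈ Finset.Icc 2 m.s, w i • (m.b i).eval Z = r • phi n Z) (v : X) :
    ∑ i ∈ Finset.Icc 2 m.s, w i • PhiComb.opL J τ (m.b i) v = r • phiL J τ n v := by
  have h1 : PhiComb.opL J τ (∑ i ∈ Finset.Icc 2 m.s, w i • m.b i)
      = PhiComb.opL J τ (Finsupp.single (n, 1) r) := by
    refine PhiComb.opL_eq_of_eval_eq hJ hτ fun Z => ?_
    rw [PhiComb.eval_eq_linearCombination, map_sum, PhiComb.eval_eq_linearCombination,
      Finsupp.linearCombination_single]
    simp only [map_smul, ← PhiComb.eval_eq_linearCombination, H, NNReal.coe_one, one_smul]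
  have h2 := congrArg (fun T : X →L[ℝ] X => T v) h1
  simpa [map_sum, PhiComb.opL_single] using h2

theorem sum_smul_opL_bigPsi_eq_zero {m : Method} (hord : m.SimplifiedOrderConditions)
    {J : X →ₗ.[ℝ] X} (hJ : GeneratesC0Semigroup J) {τ : ℝ} (hτ : 0 ≤ τ) (v : X) :
    ∑ i ∈ Finset.Icc 2 m.s, ((m.b i).eval (0 : ℝ) * m.α i * m.P i 1)
      • PhiComb.opL J τ (m.bigPsi i) v = 0 := by
  have h1 : PhiComb.opL J τ (∑ i ∈ Finset.Icc 2 m.s,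
      ((m.b i).eval (0 : ℝ) * m.α i * m.P i 1) • m.bigPsi i) = PhiComb.opL J τ 0 := by
    refine PhiComb.opL_eq_of_eval_eq hJ hτ fun Z => ?_
    rw [PhiComb.eval_eq_linearCombination, map_sum, PhiComb.eval_eq_linearCombination, map_zero]
    -- Dimension one and `Q = 1` suffice: the map `N''(x)(u', ·)`, for which `Q` stands, is the same
    -- for all stages and is applied afterwards by linearity.
    have := hord.C8s 1 Z 1
    simpa only [map_smul, one_mul, ← PhiComb.eval_eq_linearCombination] using this
  have h2 := congrArg (fun T : X →L[ℝ] X => T v) h1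
  simpa [map_sum] using h2

/-- The coefficient of `h⁵` in the expansion of the exact solution is `φ₅(h J)` applied to this
vector. -/
noncomputable def elementaryFour (N : X → X) (x d₁ d₂ d₃ : X) : X :=
  (4 : ℝ) • fderiv2 N x d₁ d₃ + (3 : ℝ) • fderiv2 N x d₂ d₂ + (6 : ℝ) • fderiv3 N x d₁ d₁ d₂
    + fderiv4 N x d₁ d₁ d₁ d₁

/-- With the scalars `b_i(0)` in front, multilinearity separates the five elementary differentials.
C4*-C7* give four of them their exact weights, and C8* cancels the one with `Ψ_i`. -/
theorem sum_eval_smul_remainderFour {m : Method} (hord : m.SimplifiedOrderConditions)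
    {J : X →ₗ.[ℝ] X} (hJ : GeneratesC0Semigroup J) {τ : ℝ} (hτ : 0 ≤ τ) (x d₁ d₂ d₃ q : X) :
    ∑ i ∈ Finset.Icc 2 m.s, (m.b i).eval (0 : ℝ) • remainderFour N x ((m.α i * m.P i 1) • d₁)
      ((m.α i * m.g i * m.P i 2) • d₂)
      ((m.α i * m.g i ^ 2 * m.P i 3) • d₃ + PhiComb.opL J τ (m.bigPsi i) q)
      = phi 5 (0 : ℝ) • elementaryFour N x d₁ d₂ d₃ := by
  have h8 : ∑ i ∈ Finset.Icc 2 m.s, ((m.b i).eval (0 : ℝ) * m.α i * m.P i 1)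
      • fderiv2 N x d₁ (PhiComb.opL J τ (m.bigPsi i) q) = 0 := by
    have := congrArg (fderiv2 N x d₁) (sum_smul_opL_bigPsi_eq_zero hord hJ hτ q)
    simpa only [map_sum, map_smul, map_zero] using this
  have e : ∀ i ∈ Finset.Icc 2 m.s,
      (m.b i).eval (0 : ℝ) • remainderFour N x ((m.α i * m.P i 1) • d₁)
        ((m.α i * m.g i * m.P i 2) • d₂)
        ((m.α i * m.g i ^ 2 * m.P i 3) • d₃ + PhiComb.opL J τ (m.bigPsi i) q)
      = ((m.b i).eval (0 : ℝ) * (m.g i : ℝ) ^ 2 * m.α i ^ 2 * m.P i 1 * m.P i 3)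
          • fderiv2 N x d₁ d₃
        + ((m.b i).eval (0 : ℝ) * m.α i ^ 2 * (m.g i : ℝ) ^ 2 * m.P i 2 ^ 2)
          • (1 / 2 : ℝ) • fderiv2 N x d₂ d₂
        + ((m.b i).eval (0 : ℝ) * m.g i * m.α i ^ 3 * m.P i 1 ^ 2 * m.P i 2)
          • (1 / 2 : ℝ) • fderiv3 N x d₁ d₁ d₂
        + ((m.b i).eval (0 : ℝ) * m.α i ^ 4 * m.P i 1 ^ 4)
          • (1 / 24 : ℝ) • fderiv4 N x d₁ d₁ d₁ d₁
        + ((m.b i).eval (0 : ℝ) * m.α i * m.P i 1)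
          • fderiv2 N x d₁ (PhiComb.opL J τ (m.bigPsi i) q) := by
    intro i _
    simp only [remainderFour, map_add, map_smul, smul_apply]
    module
  rw [Finset.sum_congr rfl e]
  simp only [Finset.sum_add_distrib, ← Finset.sum_smul]
  rw [hord.C4s, hord.C5s, hord.C6s, hord.C7s, h8]
  simp only [elementaryFour, show (3 ! : ℝ) = 6 by norm_num [Nat.factorial],
    show (4 ! : ℝ) = 24 by norm_num [Nat.factorial]]
  module

/-- In the orders `h²` and `h³` the operators `b_i(h J)` are kept and C1-C3 are applied as operator
identities. In the order `h⁴` both `b_i(h J)` and `φ₅(h J)` are frozen at `0`, with errors `hBt` and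
`hCt` of order `h⁵`. The step multiplies this sum by one more `h`. -/
theorem SolutionFamily.sum_expansion (hF : SolutionFamily L N K l h x d₁ d₂ d₃)
    (hT : TubeBound N K ρ C) (hL : GeneratesC0Semigroup L) {m : Method}
    (hord : m.SimplifiedOrderConditions)
    (r₁₃ : BddImage l h (fun p => jacobian L N (x p)) fun p => fderiv2 N (x p) (d₁ p) (d₃ p))
    (r₂₂ : BddImage l h (fun p => jacobian L N (x p)) fun p => fderiv2 N (x p) (d₂ p) (d₂ p))
    (r₁₁₂ : BddImage l h (fun p => jacobian L N (x p))
      fun p => fderiv3 N (x p) (d₁ p) (d₁ p) (d₂ p))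
    (r₁₁₁₁ : BddImage l h (fun p => jacobian L N (x p))
      fun p => fderiv4 N (x p) (d₁ p) (d₁ p) (d₁ p) (d₁ p))
    (rΨ : ∀ i ∈ Finset.Icc 2 m.s, BddImage l h (fun p => jacobian L N (x p))
      fun p => fderiv2 N (x p) (d₁ p) (PhiComb.opL (jacobian L N (x p)) (h p) (m.bigPsi i)
        (fderiv2 N (x p) (d₁ p) (d₁ p)))) :
    OPow l h 5 fun p => ∑ i ∈ Finset.Icc 2 m.s,
        PhiComb.opL (jacobian L N (x p)) (h p) (m.b i)
          (remainder N (x p) (m.stage (jacobian L N (x p)) N (h p) (x p) (d₁ p) i))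
      - (h p ^ 2 • phiL (jacobian L N (x p)) (h p) 3 (fderiv2 N (x p) (d₁ p) (d₁ p))
        + h p ^ 3 • phiL (jacobian L N (x p)) (h p) 4 ((3 : ℝ) • fderiv2 N (x p) (d₁ p) (d₂ p)
          + fderiv3 N (x p) (d₁ p) (d₁ p) (d₁ p))
        + h p ^ 4 • phiL (jacobian L N (x p)) (h p) 5
          (elementaryFour N (x p) (d₁ p) (d₂ p) (d₃ p))) := by
  have hO := isBigO_one_of_tendsto_zero hF.tendsto
  have hB : OPow l h 0 fun p => fderiv ℝ N (x p) := hT.fderiv_opow hF.mem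
  have hq : OPow l h 0 fun p => fderiv2 N (x p) (d₁ p) (d₁ p) :=
    ((hT.fderiv2_opow hF.mem).apply hF.bdd₁).apply hF.bdd₁
  have hop : ∀ c : PhiComb, OPow l h 0 fun p => PhiComb.opL (jacobian L N (x p)) (h p) c :=
    fun c => opL_opow hL hF.tendsto hF.pos hB c
  set y₁ : ℕ → ι → X := fun i p => (m.α i * m.P i 1) • d₁ p with hy₁
  set y₂ : ℕ → ι → X := fun i p => (m.α i * m.g i * m.P i 2) • d₂ p with hy₂
  set y₃ : ℕ → ι → X := fun i p => (m.α i * m.g i ^ 2 * m.P i 3) • d₃ p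
    + PhiComb.opL (jacobian L N (x p)) (h p) (m.bigPsi i) (fderiv2 N (x p) (d₁ p) (d₁ p)) with hy₃
  set Y : ℕ → ι → X := fun i p => h p ^ 2 • (1 / 2 : ℝ) • fderiv2 N (x p) (y₁ i p) (y₁ i p)
        + h p ^ 3 • (fderiv2 N (x p) (y₁ i p) (y₂ i p)
          + (1 / 6 : ℝ) • fderiv3 N (x p) (y₁ i p) (y₁ i p) (y₁ i p))
        + h p ^ 4 • remainderFour N (x p) (y₁ i p) (y₂ i p) (y₃ i p) with hY
  have hrem : ∀ i, OPow l h 5 fun p =>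
      remainder N (x p) (m.stage (jacobian L N (x p)) N (h p) (x p) (d₁ p) i) - Y i p := by
    intro i
    refine (hT.remainder_expansion hF.tendsto hF.mem (hF.bdd₁.const_smul (m.α i * m.P i 1))
      (hF.bdd₂.const_smul (m.α i * m.g i * m.P i 2))
      ((hF.bdd₃.const_smul (m.α i * m.g i ^ 2 * m.P i 3)).add ((hop (m.bigPsi i)).apply hq))
      (hF.stage_expansion hT hL m i)).congr fun p => ?_
    simp only [add_sub_cancel, hY, hy₁, hy₂, hy₃]
  have hA : OPow l h 5 fun p => ∑ i ∈ Finset.Icc 2 m.s,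
      PhiComb.opL (jacobian L N (x p)) (h p) (m.b i)
        (remainder N (x p) (m.stage (jacobian L N (x p)) N (h p) (x p) (d₁ p) i) - Y i p) :=
    OPow.sum fun i _ => ((hop (m.b i)).apply (hrem i)).mono hO (by norm_num)
  have hR : ∀ i ∈ Finset.Icc 2 m.s, BddImage l h (fun p => jacobian L N (x p))
      fun p => remainderFour N (x p) (y₁ i p) (y₂ i p) (y₃ i p) := by
    intro i hi
    obtain ⟨z, hz, hzg⟩ := ((((r₁₃.const_smul (m.α i ^ 2 * m.g i ^ 2 * m.P i 1 * m.P i 3)).add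
      ((rΨ i hi).const_smul (m.α i * m.P i 1))).add
      (r₂₂.const_smul (1 / 2 * (m.α i * m.g i * m.P i 2) ^ 2))).add
      (r₁₁₂.const_smul (1 / 2 * (m.α i * m.P i 1) ^ 2 * (m.α i * m.g i * m.P i 2)))).add
      (r₁₁₁₁.const_smul (1 / 24 * (m.α i * m.P i 1) ^ 4))
    refine ⟨z, hz, hzg.mono fun p hp => ?_⟩
    convert hp using 2
    simp only [remainderFour, hy₁, hy₂, hy₃, map_add, map_smul, smul_apply]
    module
  have hBt : OPow l h 5 fun p => h p ^ 4 • ∑ i ∈ Finset.Icc 2 m.s,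
      (PhiComb.opL (jacobian L N (x p)) (h p) (m.b i)
        (remainderFour N (x p) (y₁ i p) (y₂ i p) (y₃ i p))
        - (m.b i).eval (0 : ℝ) • remainderFour N (x p) (y₁ i p) (y₂ i p) (y₃ i p)) :=
    (OPow.sum fun i hi => (hR i hi).opL_sub_opow hL hF.tendsto hF.pos hB (m.b i)).pow_smul 4
  have hW : BddImage l h (fun p => jacobian L N (x p))
      fun p => elementaryFour N (x p) (d₁ p) (d₂ p) (d₃ p) :=
    (((r₁₃.const_smul 4).add (r₂₂.const_smul 3)).add (r₁₁₂.const_smul 6)).add r₁₁₁₁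
  have hCt : OPow l h 5 fun p => h p ^ 4 •
      (PhiComb.opL (jacobian L N (x p)) (h p) (Finsupp.single (5, 1) 1)
        (elementaryFour N (x p) (d₁ p) (d₂ p) (d₃ p))
        - PhiComb.eval (Finsupp.single (5, 1) 1) (0 : ℝ)
          • elementaryFour N (x p) (d₁ p) (d₂ p) (d₃ p)) :=
    (hW.opL_sub_opow hL hF.tendsto hF.pos hB (Finsupp.single (5, 1) 1)).pow_smul 4
  have e5 : PhiComb.eval (Finsupp.single (5, 1) 1) (0 : ℝ) = phi 5 (0 : ℝ) := by
    simp [PhiComb.eval]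
  refine ((hA.add hBt).sub hCt).congr' ?_
  filter_upwards [hF.pos] with p hp
  have hJ : GeneratesC0Semigroup (jacobian L N (x p)) := generatesC0Semigroup_jacobian hL N (x p)
  have E1 := sum_smul_opL_eq m hJ hp.le _ 3 2 (hord.C1 1) (fderiv2 N (x p) (d₁ p) (d₁ p))
  have E2 := sum_smul_opL_eq m hJ hp.le _ 4 3 (hord.C2 1) (fderiv2 N (x p) (d₁ p) (d₂ p))
  have E3 := sum_smul_opL_eq m hJ hp.le _ 4 (3 ! : ℝ) (hord.C3 1)
    (fderiv3 N (x p) (d₁ p) (d₁ p) (d₁ p))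
  have E4 := sum_eval_smul_remainderFour (N := N) hord hJ hp.le (x p) (d₁ p) (d₂ p) (d₃ p)
    (fderiv2 N (x p) (d₁ p) (d₁ p))
  have EY : ∑ i ∈ Finset.Icc 2 m.s, PhiComb.opL (jacobian L N (x p)) (h p) (m.b i) (Y i p)
      = h p ^ 2 • phiL (jacobian L N (x p)) (h p) 3 (fderiv2 N (x p) (d₁ p) (d₁ p))
        + h p ^ 3 • phiL (jacobian L N (x p)) (h p) 4 ((3 : ℝ) • fderiv2 N (x p) (d₁ p) (d₂ p)
          + fderiv3 N (x p) (d₁ p) (d₁ p) (d₁ p))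
        + h p ^ 4 • ∑ i ∈ Finset.Icc 2 m.s, PhiComb.opL (jacobian L N (x p)) (h p) (m.b i)
          (remainderFour N (x p) (y₁ i p) (y₂ i p) (y₃ i p)) := by
    have e : ∀ i ∈ Finset.Icc 2 m.s, PhiComb.opL (jacobian L N (x p)) (h p) (m.b i) (Y i p)
        = (h p ^ 2 * (1 / 2)) • (m.α i ^ 2 * m.P i 1 ^ 2) •
            PhiComb.opL (jacobian L N (x p)) (h p) (m.b i) (fderiv2 N (x p) (d₁ p) (d₁ p))
          + h p ^ 3 • (m.α i ^ 2 * m.g i * m.P i 1 * m.P i 2) •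
            PhiComb.opL (jacobian L N (x p)) (h p) (m.b i) (fderiv2 N (x p) (d₁ p) (d₂ p))
          + (h p ^ 3 * (1 / 6)) • (m.α i ^ 3 * m.P i 1 ^ 3) •
            PhiComb.opL (jacobian L N (x p)) (h p) (m.b i) (fderiv3 N (x p) (d₁ p) (d₁ p) (d₁ p))
          + h p ^ 4 • PhiComb.opL (jacobian L N (x p)) (h p) (m.b i)
            (remainderFour N (x p) (y₁ i p) (y₂ i p) (y₃ i p)) := by
      intro i _
      simp only [hY, hy₁, hy₂, map_add, map_smul, smul_apply]
      module
    rw [Finset.sum_congr rfl e]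
    simp only [Finset.sum_add_distrib, ← Finset.smul_sum]
    rw [E1, E2, E3]
    simp only [PNat.val_ofNat, map_add, map_smul, show (3 ! : ℝ) = 6 by norm_num [Nat.factorial]]
    module
  simp only [map_sub, Finset.sum_sub_distrib]
  rw [EY, E4, e5, PhiComb.opL_single]
  simp only [PNat.val_ofNat, NNReal.coe_one, one_mul, one_smul]
  module

end NumericalExpansion

/-! ### The exact solution -/

section ExactSolution

set_option maxSynthPendingDepth 8

variable {X : Type*} [NormedAddCommGroup X] [NormedSpace ℝ X]

/-- Difference quotients of a curve in a closed subspace stay there. Applied to the graph of `L`,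
this lets equations `L w = z` be differentiated in time. -/
theorem mem_of_hasDerivWithinAt {V : Submodule ℝ X} (hV : IsClosed (V : Set X)) {I : Set ℝ}
    {w : ℝ → X} {w' : X} {t : ℝ} (hI : UniqueDiffWithinAt ℝ I t) (ht : t ∈ I)
    (hw : HasDerivWithinAt w w' I t) (hmem : ∀ s ∈ I, w s ∈ V) : w' ∈ V := by
  rw [hasDerivWithinAt_iff_tendsto_slope] at hw
  have : (𝓝[I \ {t}] t).NeBot := by
    rwa [uniqueDiffWithinAt_iff_accPt, accPt_principal_iff_nhdsWithin] at hI
  refine hV.mem_of_tendsto hw ?_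
  filter_upwards [self_mem_nhdsWithin] with s hs
  exact V.smul_mem _ (V.sub_mem (hmem s hs.1) (hmem t ht))

namespace SmoothSolution

variable {L : X →ₗ.[ℝ] X} {N : X → X} {t₀ T : ℝ} {u : ℝ → X}

theorem hasDerivWithinAt_iteratedDerivWithin (hu : SmoothSolution L N t₀ T u) (hT : t₀ < T)
    {k : ℕ} (hk : k < 5) {t : ℝ} (ht : t ∈ Icc t₀ T) :
    HasDerivWithinAt (iteratedDerivWithin k u (Icc t₀ T))
      (iteratedDerivWithin (k + 1) u (Icc t₀ T) t) (Icc t₀ T) t := by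
  have h1 := hu.smooth.differentiableOn_iteratedDerivWithin (m := k) (by exact_mod_cast hk)
    (uniqueDiffOn_Icc hT)
  rw [iteratedDerivWithin_succ]
  exact (h1 t ht).hasDerivWithinAt

theorem exists_norm_iteratedDerivWithin_le (hu : SmoothSolution L N t₀ T u) (hT : t₀ < T)
    {k : ℕ} (hk : k ≤ 5) :
    ∃ C : ℝ, ∀ t ∈ Icc t₀ T, ‖iteratedDerivWithin k u (Icc t₀ T) t‖ ≤ C :=
  isCompact_Icc.exists_bound_of_continuousOn
    (hu.smooth.continuousOn_iteratedDerivWithin (by exact_mod_cast hk) (uniqueDiffOn_Icc hT))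

theorem continuousOn (hu : SmoothSolution L N t₀ T u) : ContinuousOn u (Icc t₀ T) :=
  hu.smooth.continuousOn

theorem isCompact_image (hu : SmoothSolution L N t₀ T u) : IsCompact (u '' Icc t₀ T) :=
  isCompact_Icc.image_of_continuousOn hu.continuousOn

theorem mem_domain (hu : SmoothSolution L N t₀ T u) {t : ℝ} (ht : t ∈ Icc t₀ T) :
    u t ∈ L.domain :=
  (hu.solves t ht).choose

theorem rhs_eq (hu : SmoothSolution L N t₀ T u) (hT : t₀ < T) {t : ℝ} (ht : t ∈ Icc t₀ T) :
    rhs L N ⟨u t, hu.mem_domain ht⟩ = iteratedDerivWithin 1 u (Icc t₀ T) t := by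
  obtain ⟨h1, h2⟩ := hu.solves t ht
  rw [iteratedDerivWithin_one]
  exact (h2.derivWithin (uniqueDiffOn_Icc hT t ht)).symm

theorem mem_graph_zero (hu : SmoothSolution L N t₀ T u) (hT : t₀ < T) {t : ℝ}
    (ht : t ∈ Icc t₀ T) : (u t, iteratedDerivWithin 1 u (Icc t₀ T) t - N (u t)) ∈ L.graph := by
  rw [← hu.rhs_eq hT ht, rhs, add_sub_cancel_right]
  exact LinearPMap.mem_graph L ⟨u t, hu.mem_domain ht⟩

theorem contDiffAt (hu : SmoothSolution L N t₀ T u) {t : ℝ} (ht : t ∈ Icc t₀ T) :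
    ContDiffAt ℝ 5 N (u t) := by
  obtain ⟨δ, hδ, h⟩ := hu.strip
  exact h.contDiffAt (Metric.isOpen_thickening.mem_nhds
    (Metric.self_subset_thickening hδ _ ⟨t, ht, rfl⟩))

theorem hasDerivWithinAt (hu : SmoothSolution L N t₀ T u) (hT : t₀ < T) {t : ℝ}
    (ht : t ∈ Icc t₀ T) :
    HasDerivWithinAt u (iteratedDerivWithin 1 u (Icc t₀ T) t) (Icc t₀ T) t := by
  simpa using hu.hasDerivWithinAt_iteratedDerivWithin hT (k := 0) (by norm_num) ht

variable [CompleteSpace X]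

theorem mem_graph_succ (hL : GeneratesC0Semigroup L) (hT : t₀ < T) {w z w' z' : ℝ → X}
    (hw : ∀ t ∈ Icc t₀ T, HasDerivWithinAt w (w' t) (Icc t₀ T) t)
    (hz : ∀ t ∈ Icc t₀ T, HasDerivWithinAt z (z' t) (Icc t₀ T) t)
    (hg : ∀ t ∈ Icc t₀ T, (w t, z t) ∈ L.graph) :
    ∀ t ∈ Icc t₀ T, (w' t, z' t) ∈ L.graph := by
  obtain ⟨S, hS, hLS⟩ := hL
  intro t ht
  exact mem_of_hasDerivWithinAt (hLS.isClosed_graph hS) (uniqueDiffOn_Icc hT t ht) ht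
    ((hw t ht).prodMk (hz t ht)) hg

theorem mem_graph_one (hu : SmoothSolution L N t₀ T u) (hL : GeneratesC0Semigroup L) (hT : t₀ < T) :
    ∀ t ∈ Icc t₀ T, (iteratedDerivWithin 1 u (Icc t₀ T) t,
      iteratedDerivWithin 2 u (Icc t₀ T) t
        - fderiv ℝ N (u t) (iteratedDerivWithin 1 u (Icc t₀ T) t)) ∈ L.graph :=
  mem_graph_succ hL hT (fun _ ht => hu.hasDerivWithinAt hT ht)
    (fun t ht => (hu.hasDerivWithinAt_iteratedDerivWithin hT (by norm_num) ht).sub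
      (((hu.contDiffAt ht).differentiableAt (by norm_num)).hasFDerivAt.comp_hasDerivWithinAt t
        (hu.hasDerivWithinAt hT ht)))
    fun _ ht => hu.mem_graph_zero hT ht

theorem mem_graph_two (hu : SmoothSolution L N t₀ T u) (hL : GeneratesC0Semigroup L) (hT : t₀ < T) :
    ∀ t ∈ Icc t₀ T, (iteratedDerivWithin 2 u (Icc t₀ T) t,
      iteratedDerivWithin 3 u (Icc t₀ T) t
        - (fderiv2 N (u t) (iteratedDerivWithin 1 u (Icc t₀ T) t)
            (iteratedDerivWithin 1 u (Icc t₀ T) t)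
          + fderiv ℝ N (u t) (iteratedDerivWithin 2 u (Icc t₀ T) t))) ∈ L.graph :=
  mem_graph_succ hL hT (fun _ ht => hu.hasDerivWithinAt_iteratedDerivWithin hT (by norm_num) ht)
    (fun t ht => (hu.hasDerivWithinAt_iteratedDerivWithin hT (by norm_num) ht).sub
      ((((contDiffAt_fderiv (hu.contDiffAt ht)).differentiableAt
        (by norm_num)).hasFDerivAt.comp_hasDerivWithinAt t (hu.hasDerivWithinAt hT ht)).clm_apply
        (hu.hasDerivWithinAt_iteratedDerivWithin hT (by norm_num) ht)))
    (hu.mem_graph_one hL hT)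

/-- It serves to show that `J u'''` is bounded, which controls the last term of `opL_psi_expansion`.
-/
theorem mem_graph_three (hu : SmoothSolution L N t₀ T u) (hL : GeneratesC0Semigroup L)
    (hT : t₀ < T) :
    ∀ t ∈ Icc t₀ T, (iteratedDerivWithin 3 u (Icc t₀ T) t,
      iteratedDerivWithin 4 u (Icc t₀ T) t
        - ((fderiv3 N (u t) (iteratedDerivWithin 1 u (Icc t₀ T) t)
              (iteratedDerivWithin 1 u (Icc t₀ T) t)
            + fderiv2 N (u t) (iteratedDerivWithin 2 u (Icc t₀ T) t))
              (iteratedDerivWithin 1 u (Icc t₀ T) t)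
            + fderiv2 N (u t) (iteratedDerivWithin 1 u (Icc t₀ T) t)
              (iteratedDerivWithin 2 u (Icc t₀ T) t)
          + (fderiv2 N (u t) (iteratedDerivWithin 1 u (Icc t₀ T) t)
              (iteratedDerivWithin 2 u (Icc t₀ T) t)
            + fderiv ℝ N (u t) (iteratedDerivWithin 3 u (Icc t₀ T) t)))) ∈ L.graph := by
  refine mem_graph_succ hL hT
    (fun _ ht => hu.hasDerivWithinAt_iteratedDerivWithin hT (by norm_num) ht)
    (fun t ht => ?_) (hu.mem_graph_two hL hT)
  have hd := fun k (hk : k < 5) => hu.hasDerivWithinAt_iteratedDerivWithin hT hk ht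
  have h1 := ((contDiffAt_fderiv (hu.contDiffAt ht)).differentiableAt
    (by norm_num)).hasFDerivAt.comp_hasDerivWithinAt t (hu.hasDerivWithinAt hT ht)
  have h2 := ((contDiffAt_fderiv2 (hu.contDiffAt ht)).differentiableAt
    (by norm_num)).hasFDerivAt.comp_hasDerivWithinAt t (hu.hasDerivWithinAt hT ht)
  exact (hd 3 (by norm_num)).sub
    (((h2.clm_apply (hd 1 (by norm_num))).clm_apply (hd 1 (by norm_num))).add
      (h1.clm_apply (hd 2 (by norm_num))))

/-- The variation-of-constants formula for the exact solution, linearized at `u t`. -/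
theorem eq_add_integral (hu : SmoothSolution L N t₀ T u) (hL : GeneratesC0Semigroup L)
    (hT : t₀ < T) {t h : ℝ} (ht : t ∈ Icc t₀ T) (hh : 0 ≤ h) (hth : t + h ≤ T) :
    ContinuousOn (fun s => remainder N (u t) (u (t + s))) (Icc 0 h) ∧
    u (t + h) = u t + h • phiL (jacobian L N (u t)) h 1 (iteratedDerivWithin 1 u (Icc t₀ T) t)
      + ∫ s in (0 : ℝ)..h, opExp (jacobian L N (u t)) (h - s)
          (remainder N (u t) (u (t + s))) := by
  have hJ := generatesC0Semigroup_jacobian hL N (u t)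
  have hS := opExp_isC0Semigroup hJ
  have hmem : ∀ s ∈ Icc 0 h, t + s ∈ Icc t₀ T :=
    fun s hs => ⟨by linarith [ht.1, hs.1], by linarith [hs.2]⟩
  have hcu : ContinuousOn (fun s => u (t + s)) (Icc 0 h) :=
    hu.continuousOn.comp (by fun_prop) hmem
  have hcN : ContinuousOn (fun s => N (u (t + s))) (Icc 0 h) := by
    intro s hs
    exact ContinuousAt.comp_continuousWithinAt (g := N) (f := fun s => u (t + s))
      (hu.contDiffAt (hmem s hs)).continuousAt (hcu s hs)
  have hcR : ContinuousOn (fun s => remainder N (u t) (u (t + s))) (Icc 0 h) := by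
    unfold remainder
    exact (hcN.sub continuousOn_const).sub
      ((fderiv ℝ N (u t)).continuous.comp_continuousOn (hcu.sub continuousOn_const))
  refine ⟨hcR, ?_⟩
  set d := iteratedDerivWithin 1 u (Icc t₀ T) with hd
  -- The increment `u(t + s) - u(t)` starts at `0` and solves the linearized equation with
  -- inhomogeneity `f(u(t))` plus the remainder. The constant part integrates to `h φ₁(h J)
  -- f(u(t))`.
  have hvc := variation_of_constants hS (opExp_isInfinitesimalGenerator hJ) hh
    (w := fun s => u (t + s) - u t)
    (z := fun s => ((d (t + s) - N (u (t + s))) - (d t - N (u t)))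
      + fderiv ℝ N (u t) (u (t + s) - u t))
    (F := fun s => d t + remainder N (u t) (u (t + s)))
    (hcu.sub continuousOn_const) (continuousOn_const.add hcR) ?_ ?_
  · simp only [add_zero, sub_self, map_zero, zero_add, map_add] at hvc
    have hi1 : IntervalIntegrable (fun s => opExp (jacobian L N (u t)) (h - s) (d t))
        MeasureTheory.volume 0 h := by
      refine ContinuousOn.intervalIntegrable ?_
      rw [uIcc_of_le hh]
      exact hS.continuousOn_apply (by fun_prop) (fun s hs => sub_nonneg.2 hs.2) continuousOn_const
    have hi2 : IntervalIntegrable (fun s => opExp (jacobian L N (u t)) (h - s)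
        (remainder N (u t) (u (t + s)))) MeasureTheory.volume 0 h := by
      refine ContinuousOn.intervalIntegrable ?_
      rw [uIcc_of_le hh]
      exact hS.continuousOn_apply (by fun_prop) (fun s hs => sub_nonneg.2 hs.2) hcR
    rw [intervalIntegral.integral_add hi1 hi2, sub_eq_iff_eq_add'] at hvc
    have hphi := integral_opExp_pow hJ hh 0 (d t)
    simp only [pow_zero, Nat.factorial_zero, Nat.cast_one, div_one, one_smul, zero_add,
      pow_one] at hphi
    rw [hvc, hphi, add_assoc]
  · intro s hs
    have hs' := hmem s ⟨hs.1.le, hs.2.le⟩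
    refine mem_graph_perturb.2 ?_
    rw [add_sub_cancel_right]
    exact L.graph.sub_mem (hu.mem_graph_zero hT hs') (hu.mem_graph_zero hT ht)
  · intro s hs
    have hs' := hmem s ⟨hs.1.le, hs.2.le⟩
    have h1 : HasDerivAt u (d (t + s)) (t + s) :=
      (hu.hasDerivWithinAt hT hs').hasDerivAt
        (Icc_mem_nhds (by linarith [ht.1, hs.1]) (by linarith [hs.2]))
    have h2 : HasDerivAt (fun s => u (t + s) - u t) (d (t + s)) s :=
      (h1.comp_const_add t s).sub_const _
    refine h2.congr_deriv ?_
    simp only [remainder]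
    abel

end SmoothSolution

end ExactSolution

/-! ### The local error -/

section LocalError

set_option maxSynthPendingDepth 8

open Asymptotics

variable {X : Type*} [NormedAddCommGroup X] [NormedSpace ℝ X]

/-- The filter of pairs `(t, h)` with `t ∈ [t₀, T]`, `t + h ≤ T` and `h → 0+`. -/
def stepFilter (t₀ T : ℝ) : Filter (ℝ × ℝ) :=
  𝓟 {p | p.1 ∈ Icc t₀ T ∧ p.1 + p.2 ≤ T} ⊓ comap Prod.snd (𝓝[>] 0)

theorem eventually_stepFilter {t₀ T : ℝ} {P : ℝ × ℝ → Prop} :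
    (∀ᶠ p in stepFilter t₀ T, P p) ↔
      ∃ η > 0, ∀ t ∈ Icc t₀ T, ∀ h, 0 < h → h < η → t + h ≤ T → P (t, h) := by
  rw [stepFilter, inf_comm, eventually_inf_principal, eventually_comap]
  constructor
  · intro H
    rw [eventually_nhdsWithin_iff] at H
    obtain ⟨η, hη, H⟩ := Metric.eventually_nhds_iff.1 H
    refine ⟨η, hη, fun t ht h h0 hh hth => ?_⟩
    exact H (y := h) (by simpa [abs_of_pos h0] using hh) h0 (t, h) rfl ⟨ht, hth⟩
  · rintro ⟨η, hη, H⟩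
    filter_upwards [Ioo_mem_nhdsGT hη] with h hh
    rintro ⟨t, h'⟩ rfl ⟨ht, hth⟩
    exact H t ht h' hh.1 hh.2 hth

theorem eventually_mem_stepFilter (t₀ T : ℝ) :
    ∀ᶠ p in stepFilter t₀ T, p.1 ∈ Icc t₀ T ∧ 0 < p.2 ∧ p.1 + p.2 ≤ T :=
  eventually_stepFilter.2 ⟨1, one_pos, fun _ ht _ h0 _ hth => ⟨ht, h0, hth⟩⟩

theorem tendsto_snd_stepFilter (t₀ T : ℝ) : Tendsto Prod.snd (stepFilter t₀ T) (𝓝 0) :=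
  (tendsto_comap.mono_left inf_le_right).mono_right nhdsWithin_le_nhds

theorem bddImage_of_lBound {ι : Type*} {l : Filter ι} {h : ι → ℝ} {L : X →ₗ.[ℝ] X} {N : X → X}
    {x w : ι → X} {B : ℝ} (hN : OPow l h 0 fun p => fderiv ℝ N (x p)) (hw : OPow l h 0 w)
    (hB : ∀ᶠ p in l, LBound L B (w p)) : BddImage l h (fun p => jacobian L N (x p)) w := by
  classical
  let z : ι → X := fun p => if hp : w p ∈ L.domain then L ⟨w p, hp⟩ else 0
  have hz : OPow l h 0 z := by
    refine OPow.of_norm_le (C := B) ?_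
    filter_upwards [hB] with p hp
    obtain ⟨h1, h2⟩ := hp
    simpa [z, h1] using h2
  refine ⟨fun p => z p + fderiv ℝ N (x p) (w p), hz.add (hN.apply hw), ?_⟩
  filter_upwards [hB] with p hp
  obtain ⟨h1, h2⟩ := hp
  refine mem_graph_perturb.2 ?_
  simp [z, h1]

variable {L : X →ₗ.[ℝ] X} {N : X → X} {t₀ T : ℝ} {u : ℝ → X}

namespace SmoothSolution

theorem iteratedDerivWithin_opow (hu : SmoothSolution L N t₀ T u) (hT : t₀ < T) {ι : Type*}
    {l : Filter ι} {h τ : ι → ℝ} (hτ : ∀ᶠ p in l, τ p ∈ Icc t₀ T) {k : ℕ} (hk : k ≤ 5) :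
    OPow l h 0 fun p => iteratedDerivWithin k u (Icc t₀ T) (τ p) := by
  obtain ⟨C, hC⟩ := hu.exists_norm_iteratedDerivWithin_le hT hk
  exact OPow.of_norm_le (hτ.mono fun p hp => hC _ hp)

theorem taylor_opow (hu : SmoothSolution L N t₀ T u) (hT : t₀ < T) :
    OPow (stepFilter t₀ T) Prod.snd 4 fun p => (u (p.1 + p.2) - u p.1)
      - (p.2 • iteratedDerivWithin 1 u (Icc t₀ T) p.1
        + p.2 ^ 2 • (1 / 2 : ℝ) • iteratedDerivWithin 2 u (Icc t₀ T) p.1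
        + p.2 ^ 3 • (1 / 6 : ℝ) • iteratedDerivWithin 3 u (Icc t₀ T) p.1) := by
  obtain ⟨C, hC⟩ := hu.exists_norm_iteratedDerivWithin_le hT (k := 4) (by norm_num)
  refine IsBigO.of_bound C ?_
  filter_upwards [eventually_mem_stepFilter t₀ T] with p hp
  obtain ⟨ht, h0, hth⟩ := hp
  have hmem : MapsTo (fun θ => p.1 + θ) (Icc 0 p.2) (Icc t₀ T) :=
    fun s hs => ⟨by linarith [ht.1, hs.1], by linarith [hs.2]⟩
  have h1 := norm_sub_taylor_le (a := p.2) (C := C) 4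
    (fun k θ => iteratedDerivWithin k u (Icc t₀ T) (p.1 + θ)) (fun k hk θ hθ => by
      have h2 := hu.hasDerivWithinAt_iteratedDerivWithin hT (k := k) (by omega) (hmem hθ)
      have h3 : HasDerivWithinAt (fun θ => p.1 + θ) 1 (Icc 0 p.2) θ :=
        ((hasDerivAt_id θ).const_add p.1).hasDerivWithinAt
      simpa [Function.comp_def] using h2.scomp θ h3 hmem)
    (fun θ hθ => hC _ (hmem hθ)) p.2 ⟨h0.le, le_rfl⟩
  rw [norm_pow, Real.norm_eq_abs, abs_of_pos h0]
  refine le_of_eq_of_le ?_ h1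
  congr 1
  simp only [Finset.sum_range_succ, Finset.sum_range_zero, Nat.factorial, add_zero,
    iteratedDerivWithin_zero]
  norm_num
  module

variable [CompleteSpace X]

theorem solutionFamily (hu : SmoothSolution L N t₀ T u) (hL : GeneratesC0Semigroup L)
    (hT : t₀ < T) {ρ C : ℝ} (hB : TubeBound N (u '' Icc t₀ T) ρ C) {ι : Type*} {l : Filter ι}
    {h τ : ι → ℝ} (hh : Tendsto h l (𝓝 0)) (hpos : ∀ᶠ p in l, 0 < h p)
    (hτ : ∀ᶠ p in l, τ p ∈ Icc t₀ T) :
    SolutionFamily L N (u '' Icc t₀ T) l h (fun p => u (τ p))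
      (fun p => iteratedDerivWithin 1 u (Icc t₀ T) (τ p))
      (fun p => iteratedDerivWithin 2 u (Icc t₀ T) (τ p))
      (fun p => iteratedDerivWithin 3 u (Icc t₀ T) (τ p)) := by
  have hK : ∀ᶠ p in l, u (τ p) ∈ u '' Icc t₀ T := hτ.mono fun p hp => ⟨_, hp, rfl⟩
  have d1 := hu.iteratedDerivWithin_opow (h := h) hT hτ (k := 1) (by norm_num)
  have d2 := hu.iteratedDerivWithin_opow (h := h) hT hτ (k := 2) (by norm_num)
  have d3 := hu.iteratedDerivWithin_opow (h := h) hT hτ (k := 3) (by norm_num)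
  have d4 := hu.iteratedDerivWithin_opow (h := h) hT hτ (k := 4) (by norm_num)
  have D1 := hB.fderiv_opow (h := h) hK
  have D2 := hB.fderiv2_opow (h := h) hK
  have D3 := hB.fderiv3_opow (h := h) hK
  refine ⟨hh, hpos, hK, d1, d2, d3, ?_, ?_, ?_⟩
  · exact hτ.mono fun p hp => mem_graph_perturb.2 (hu.mem_graph_one hL hT _ hp)
  · refine hτ.mono fun p hp => mem_graph_perturb.2 ?_
    rw [sub_sub]
    exact hu.mem_graph_two hL hT _ hp
  · refine ⟨_, ((d4.sub (((((D3.apply d1).apply d1).add (D2.apply d2)).apply d1).add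
      ((D2.apply d1).apply d2) |>.add (((D2.apply d1).apply d2).add (D1.apply d3)))).add
      (D1.apply d3)), hτ.mono fun p hp => mem_graph_perturb.2 ?_⟩
    rw [add_sub_cancel_right]
    exact hu.mem_graph_three hL hT _ hp

theorem solutionFamily_stepFilter (hu : SmoothSolution L N t₀ T u) (hL : GeneratesC0Semigroup L)
    (hT : t₀ < T) {ρ C : ℝ} (hB : TubeBound N (u '' Icc t₀ T) ρ C) :
    SolutionFamily L N (u '' Icc t₀ T) (stepFilter t₀ T) Prod.snd (fun p => u p.1)
      (fun p => iteratedDerivWithin 1 u (Icc t₀ T) p.1)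
      (fun p => iteratedDerivWithin 2 u (Icc t₀ T) p.1)
      (fun p => iteratedDerivWithin 3 u (Icc t₀ T) p.1) :=
  hu.solutionFamily hL hT hB (tendsto_snd_stepFilter t₀ T)
    ((eventually_mem_stepFilter t₀ T).mono fun _ hp => hp.2.1)
    ((eventually_mem_stepFilter t₀ T).mono fun _ hp => hp.1)

/-- Expansion of the remainder of the linearization along the exact solution. -/
theorem remainder_opow (hu : SmoothSolution L N t₀ T u) (hL : GeneratesC0Semigroup L)
    (hT : t₀ < T) {ρ C : ℝ} (hB : TubeBound N (u '' Icc t₀ T) ρ C) :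
    OPow (stepFilter t₀ T) Prod.snd 5 fun p => remainder N (u p.1) (u (p.1 + p.2))
      - ((p.2 ^ 2 / (2 ! : ℝ)) • fderiv2 N (u p.1) (iteratedDerivWithin 1 u (Icc t₀ T) p.1)
          (iteratedDerivWithin 1 u (Icc t₀ T) p.1)
        + (p.2 ^ 3 / (3 ! : ℝ)) • ((3 : ℝ) • fderiv2 N (u p.1)
            (iteratedDerivWithin 1 u (Icc t₀ T) p.1) (iteratedDerivWithin 2 u (Icc t₀ T) p.1)
          + fderiv3 N (u p.1) (iteratedDerivWithin 1 u (Icc t₀ T) p.1)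
            (iteratedDerivWithin 1 u (Icc t₀ T) p.1) (iteratedDerivWithin 1 u (Icc t₀ T) p.1))
        + (p.2 ^ 4 / (4 ! : ℝ)) • elementaryFour N (u p.1)
            (iteratedDerivWithin 1 u (Icc t₀ T) p.1) (iteratedDerivWithin 2 u (Icc t₀ T) p.1)
            (iteratedDerivWithin 3 u (Icc t₀ T) p.1)) := by
  have hF := hu.solutionFamily_stepFilter hL hT hB
  refine (hB.remainder_expansion hF.tendsto hF.mem hF.bdd₁ (hF.bdd₂.const_smul (1 / 2))
    (hF.bdd₃.const_smul (1 / 6)) (hu.taylor_opow hT)).congr fun p => ?_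
  simp only [remainderFour, elementaryFour, add_sub_cancel, map_smul, smul_apply,
    show (2 ! : ℝ) = 2 by norm_num [Nat.factorial], show (3 ! : ℝ) = 6 by norm_num [Nat.factorial],
    show (4 ! : ℝ) = 24 by norm_num [Nat.factorial]]
  module

/-- The expansion of the remainder is integrated against the semigroup: each monomial in `s`
produces a `φ`-function by `integral_opExp_pow`, and the `O(s⁵)` error, which is uniform in `t`,
gains a power of `h`. -/
theorem integral_remainder_opow (hu : SmoothSolution L N t₀ T u) (hL : GeneratesC0Semigroup L)
    (hT : t₀ < T) {ρ C : ℝ} (hB : TubeBound N (u '' Icc t₀ T) ρ C) :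
    OPow (stepFilter t₀ T) Prod.snd 6 fun p =>
      (∫ s in (0 : ℝ)..p.2, opExp (jacobian L N (u p.1)) (p.2 - s)
          (remainder N (u p.1) (u (p.1 + s))))
      - (p.2 ^ 3 • phiL (jacobian L N (u p.1)) p.2 3 (fderiv2 N (u p.1)
            (iteratedDerivWithin 1 u (Icc t₀ T) p.1) (iteratedDerivWithin 1 u (Icc t₀ T) p.1))
        + p.2 ^ 4 • phiL (jacobian L N (u p.1)) p.2 4 ((3 : ℝ) • fderiv2 N (u p.1)
            (iteratedDerivWithin 1 u (Icc t₀ T) p.1) (iteratedDerivWithin 2 u (Icc t₀ T) p.1)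
          + fderiv3 N (u p.1) (iteratedDerivWithin 1 u (Icc t₀ T) p.1)
            (iteratedDerivWithin 1 u (Icc t₀ T) p.1) (iteratedDerivWithin 1 u (Icc t₀ T) p.1))
        + p.2 ^ 5 • phiL (jacobian L N (u p.1)) p.2 5 (elementaryFour N (u p.1)
            (iteratedDerivWithin 1 u (Icc t₀ T) p.1) (iteratedDerivWithin 2 u (Icc t₀ T) p.1)
            (iteratedDerivWithin 3 u (Icc t₀ T) p.1))) := by
  obtain ⟨C₅, hC₅pos, hC₅⟩ := IsBigO.exists_nonneg (hu.remainder_opow hL hT hB)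
  rw [isBigOWith_iff] at hC₅
  obtain ⟨η, hη, hR⟩ := eventually_stepFilter.1 hC₅
  obtain ⟨τ₀, hτ₀, M, hM0, hM⟩ := exists_uniform_opExp_bound hL C
  refine IsBigO.of_bound (M * C₅) ?_
  refine eventually_stepFilter.2 ⟨min η τ₀, lt_min hη hτ₀, fun t ht h h0 hh hth => ?_⟩
  have hJ := generatesC0Semigroup_jacobian hL N (u t)
  have hS := opExp_isC0Semigroup hJ
  obtain ⟨hcR, -⟩ := hu.eq_add_integral hL hT ht h0.le hth
  simp only
  set q₂ := fderiv2 N (u t) (iteratedDerivWithin 1 u (Icc t₀ T) t)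
    (iteratedDerivWithin 1 u (Icc t₀ T) t)
  set q₃ := (3 : ℝ) • fderiv2 N (u t)
            (iteratedDerivWithin 1 u (Icc t₀ T) t) (iteratedDerivWithin 2 u (Icc t₀ T) t)
          + fderiv3 N (u t) (iteratedDerivWithin 1 u (Icc t₀ T) t)
            (iteratedDerivWithin 1 u (Icc t₀ T) t) (iteratedDerivWithin 1 u (Icc t₀ T) t)
  set q₄ := elementaryFour N (u t)
            (iteratedDerivWithin 1 u (Icc t₀ T) t) (iteratedDerivWithin 2 u (Icc t₀ T) t)
            (iteratedDerivWithin 3 u (Icc t₀ T) t)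
  have hi : ∀ F : ℝ → X, ContinuousOn F (Icc 0 h) → IntervalIntegrable
      (fun s => opExp (jacobian L N (u t)) (h - s) (F s)) MeasureTheory.volume 0 h := by
    intro F hFc
    refine ContinuousOn.intervalIntegrable ?_
    rw [uIcc_of_le h0.le]
    exact hS.continuousOn_apply (by fun_prop) (fun s hs => sub_nonneg.2 hs.2) hFc
  have hmono : ∀ (k : ℕ) (v : X), ContinuousOn (fun s : ℝ => (s ^ k / (k ! : ℝ)) • v) (Icc 0 h) :=
    fun k v => by fun_prop
  rw [← integral_opExp_pow hJ h0.le 2, ← integral_opExp_pow hJ h0.le 3,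
    ← integral_opExp_pow hJ h0.le 4, ← intervalIntegral.integral_add (hi _ (hmono 2 q₂))
      (hi _ (hmono 3 q₃)), ← intervalIntegral.integral_add
      ((hi _ (hmono 2 q₂)).add (hi _ (hmono 3 q₃))) (hi _ (hmono 4 q₄)),
    ← intervalIntegral.integral_sub (hi _ hcR)
      (((hi _ (hmono 2 q₂)).add (hi _ (hmono 3 q₃))).add (hi _ (hmono 4 q₄)))]
  have hbound := intervalIntegral.norm_integral_le_of_norm_le_const (a := 0) (b := h)
    (C := M * (C₅ * h ^ 5)) (f := fun s =>
      opExp (jacobian L N (u t)) (h - s) (remainder N (u t) (u (t + s)))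
      - (opExp (jacobian L N (u t)) (h - s) ((s ^ 2 / (2 ! : ℝ)) • q₂)
        + opExp (jacobian L N (u t)) (h - s) ((s ^ 3 / (3 ! : ℝ)) • q₃)
        + opExp (jacobian L N (u t)) (h - s) ((s ^ 4 / (4 ! : ℝ)) • q₄))) ?_
  · refine hbound.trans (le_of_eq ?_)
    rw [sub_zero, abs_of_pos h0, norm_pow, Real.norm_eq_abs, abs_of_pos h0]
    ring
  · intro s hs
    rw [uIoc_of_le h0.le] at hs
    rw [← map_add, ← map_add, ← map_sub]
    have hfd : ‖fderiv ℝ N (u t)‖ ≤ C :=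
      hB.norm_fderiv_le _ ⟨t, ht, rfl⟩ _ (Metric.mem_ball_self hB.pos)
    refine ContinuousLinearMap.le_of_opNorm_le_of_le _ (hM _ hfd (h - s)
      ⟨sub_nonneg.2 hs.2, by linarith [hs.1, min_le_right η τ₀]⟩).1 ?_
    refine (hR t ht s hs.1 (by linarith [hs.2, min_le_left η τ₀]) (by linarith [hs.2])).trans ?_
    have := hs.1
    have := hs.2
    simp only [norm_pow, Real.norm_eq_abs, abs_of_pos hs.1]
    gcongr

/-- The local error of the method is of size `h⁶`. -/
theorem local_error (hu : SmoothSolution L N t₀ T u) (hL : GeneratesC0Semigroup L) (hT : t₀ < T)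
    {m : Method} (hreg : AdditionalRegularity m L N t₀ T u) (hord : m.SimplifiedOrderConditions) :
    ∃ η > 0, ∃ C : ℝ, 0 ≤ C ∧ ∀ t ∈ Icc t₀ T, ∀ h, 0 < h → h < η → t + h ≤ T →
      ‖m.step (jacobian L N (u t)) N h (u t) (iteratedDerivWithin 1 u (Icc t₀ T) t) - u (t + h)‖
        ≤ C * h ^ 6 := by
  obtain ⟨δ, hδ, hN⟩ := hu.strip
  obtain ⟨ρ, C, hB⟩ := exists_tubeBound hu.isCompact_image hδ hN
  obtain ⟨B, H, hH, hreg⟩ := hreg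
  have hF := hu.solutionFamily_stepFilter hL hT hB
  have hmem := eventually_mem_stepFilter t₀ T
  have d1 := hF.bdd₁
  have d2 := hF.bdd₂
  have d3 := hF.bdd₃
  have D1 := hB.fderiv_opow (l := stepFilter t₀ T) (h := Prod.snd) hF.mem
  have D2 := hB.fderiv2_opow (l := stepFilter t₀ T) (h := Prod.snd) hF.mem
  have D3 := hB.fderiv3_opow (l := stepFilter t₀ T) (h := Prod.snd) hF.mem
  have D4 := hB.fderiv4_opow (l := stepFilter t₀ T) (h := Prod.snd) hF.mem
  have hsmall : ∀ᶠ p in stepFilter t₀ T, p.2 ≤ H :=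
    ((tendsto_snd_stepFilter t₀ T).eventually (gt_mem_nhds hH)).mono fun p hp => le_of_lt hp
  have hsum := hF.sum_expansion hB hL hord
    (bddImage_of_lBound D1 ((D2.apply d1).apply d3) (B := B) <| hmem.mono fun p hp => by
      have h1 := (hreg p.1 hp.1).1
      rwa [iteratedFDeriv_two_nonlin (hu.contDiffAt hp.1)] at h1)
    (bddImage_of_lBound D1 ((D2.apply d2).apply d2) (B := B) <| hmem.mono fun p hp => by
      have h1 := (hreg p.1 hp.1).2.1
      rwa [iteratedFDeriv_two_nonlin (hu.contDiffAt hp.1)] at h1)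
    (bddImage_of_lBound D1 (((D3.apply d1).apply d1).apply d2) (B := B) <|
      hmem.mono fun p hp => by
        have h1 := (hreg p.1 hp.1).2.2.1
        rwa [iteratedFDeriv_three_nonlin (hu.contDiffAt hp.1)] at h1)
    (bddImage_of_lBound D1 ((((D4.apply d1).apply d1).apply d1).apply d1) (B := B) <|
      hmem.mono fun p hp => by
        have h1 := (hreg p.1 hp.1).2.2.2.1
        rwa [iteratedFDeriv_four_nonlin (hu.contDiffAt hp.1)] at h1)
    (fun i hi => bddImage_of_lBound D1 ((D2.apply d1).apply
      ((opL_opow hL hF.tendsto hF.pos D1 (m.bigPsi i)).apply ((D2.apply d1).apply d1)))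
      (B := B) <| by
        filter_upwards [hmem, hsmall] with p hp hpH
        have h1 := (hreg p.1 hp.1).2.2.2.2 i hi p.2 hp.2.1 hpH
        rwa [iteratedFDeriv_two_nonlin (hu.contDiffAt hp.1),
          iteratedFDeriv_two_nonlin (hu.contDiffAt hp.1),
          PhiComb.op_eq_opL (generatesC0Semigroup_jacobian hL N _) hp.2.1.le] at h1)
  have hintegrable := hu.integral_remainder_opow hL hT hB
  have hloc : OPow (stepFilter t₀ T) Prod.snd 6 fun p =>
      m.step (jacobian L N (u p.1)) N p.2 (u p.1) (iteratedDerivWithin 1 u (Icc t₀ T) p.1)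
        - u (p.1 + p.2) := by
    -- The terms `x + h φ₁(h J) f(x)` of both solutions cancel exactly, which leaves `h` times the
    -- sum over the stages minus the Duhamel integral.
    refine (hsum.smul.sub hintegrable).congr' ?_
    filter_upwards [hmem] with p hp
    rw [(hu.eq_add_integral hL hT hp.1 hp.2.1.le hp.2.2).2, Method.step]
    module
  obtain ⟨C', hC'pos, hC'⟩ := IsBigO.exists_nonneg hloc
  rw [isBigOWith_iff] at hC'
  obtain ⟨η, hη, h1⟩ := eventually_stepFilter.1 hC'
  refine ⟨η, hη, C', hC'pos, fun t ht h h0 hh hth => ?_⟩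
  simpa [abs_of_pos h0] using h1 t ht h h0 hh hth

end SmoothSolution

end LocalError

/-! ### Propagation of perturbations in one step -/

section Propagation

set_option maxSynthPendingDepth 8

open Asymptotics

theorem isBigO_clm_apply_sub {ι E F : Type*} [NormedAddCommGroup E] [NormedSpace ℝ E]
    [NormedAddCommGroup F] [NormedSpace ℝ F] {l : Filter ι} {A A' : ι → E →L[ℝ] F} {v v' : ι → E}
    {e : ι → ℝ} (hA : A =O[l] (1 : ι → ℝ)) (hAA' : (fun p => A p - A' p) =O[l] e)
    (hv' : v' =O[l] (1 : ι → ℝ)) (hvv' : (fun p => v p - v' p) =O[l] e) :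
    (fun p => A p (v p) - A' p (v' p)) =O[l] e := by
  have h1 := isBigO_clm_apply hA hvv'
  have h2 := isBigO_clm_apply hAA' hv'
  simp only [Pi.one_apply, one_mul, mul_one] at h1 h2
  refine (h1.add h2).congr_left fun p => ?_
  simp only [map_sub, sub_apply]
  abel

theorem OPow.isBigO_one {ι E : Type*} [NormedAddCommGroup E] {l : Filter ι} {h : ι → ℝ}
    {f : ι → E} (hf : OPow l h 0 f) : f =O[l] (1 : ι → ℝ) := by
  simpa [OPow, Pi.one_def] using hf

theorem opow_zero_of_isBigO_one {ι E : Type*} [NormedAddCommGroup E] {l : Filter ι} {h : ι → ℝ}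
    {f : ι → E} (hf : f =O[l] (1 : ι → ℝ)) : OPow l h 0 f := by
  simpa [OPow, Pi.one_def] using hf

variable {X : Type*} [NormedAddCommGroup X] [NormedSpace ℝ X]

/-- Points `y ∈ D(L)`, with `f = f(y)`, close to the points `x` of the exact solution. -/
structure NearbyFamily {ι : Type*} (L : X →ₗ.[ℝ] X) (N : X → X) (K : Set X) (l : Filter ι)
    (h : ι → ℝ) (x d₁ d₂ d₃ y f : ι → X) : Prop
    extends SolutionFamily L N K l h x d₁ d₂ d₃ where
  bdd₀ : OPow l h 0 x
  close : Tendsto (fun p => y p - x p) l (𝓝 0)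
  graph_x : ∀ᶠ p in l, (x p, d₁ p - N (x p)) ∈ L.graph
  graph_y : ∀ᶠ p in l, (y p, f p - N (y p)) ∈ L.graph

namespace NearbyFamily

variable {ι : Type*} {l : Filter ι} {h : ι → ℝ} {L : X →ₗ.[ℝ] X} {N : X → X}
  {K : Set X} {ρ C : ℝ} {x d₁ d₂ d₃ y f : ι → X}

theorem eventually_mem_ball (hF : NearbyFamily L N K l h x d₁ d₂ d₃ y f) (hρ : 0 < ρ) :
    ∀ᶠ p in l, y p ∈ Metric.ball (x p) ρ := by
  have := hF.close.norm
  rw [norm_zero] at this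
  filter_upwards [this.eventually (gt_mem_nhds hρ)] with p hp
  rwa [mem_ball_iff_norm]

theorem fderiv_sub (hF : NearbyFamily L N K l h x d₁ d₂ d₃ y f) (hT : TubeBound N K ρ C) :
    (fun p => fderiv ℝ N (y p) - fderiv ℝ N (x p)) =O[l] fun p => ‖y p - x p‖ := by
  refine IsBigO.of_bound C ?_
  filter_upwards [hF.mem, hF.eventually_mem_ball hT.pos] with p hp hy
  rw [norm_norm]
  exact hT.norm_fderiv_sub_le hp hy (Metric.mem_ball_self hT.pos)

theorem fderiv_opow (hF : NearbyFamily L N K l h x d₁ d₂ d₃ y f) (hT : TubeBound N K ρ C) :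
    OPow l h 0 fun p => fderiv ℝ N (y p) := by
  refine OPow.of_norm_le (C := C) ?_
  filter_upwards [hF.mem, hF.eventually_mem_ball hT.pos] with p hp hy
  exact hT.norm_fderiv_le _ hp _ hy

theorem nonlin_sub (hF : NearbyFamily L N K l h x d₁ d₂ d₃ y f) (hT : TubeBound N K ρ C) :
    (fun p => nonlin N (y p) (y p) - nonlin N (x p) (x p)) =O[l] fun p => ‖y p - x p‖ := by
  have h1 : (fun p => N (y p) - N (x p)) =O[l] fun p => ‖y p - x p‖ := by
    refine IsBigO.of_bound C ?_
    filter_upwards [hF.mem, hF.eventually_mem_ball hT.pos] with p hp hy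
    rw [norm_norm]
    exact hT.norm_sub_le hp hy (Metric.mem_ball_self hT.pos)
  have h2 := isBigO_clm_apply_sub (hF.fderiv_opow hT).isBigO_one (hF.fderiv_sub hT)
    hF.bdd₀.isBigO_one ((isBigO_refl (fun p => y p - x p) l).norm_right)
  refine (h1.sub h2).congr_left fun p => ?_
  simp only [nonlin]
  abel

theorem nonlin_opow (hF : NearbyFamily L N K l h x d₁ d₂ d₃ y f) (hT : TubeBound N K ρ C) :
    OPow l h 0 fun p => nonlin N (x p) (x p) := by
  have h1 : OPow l h 0 fun p => N (x p) :=
    OPow.of_norm_le (hF.mem.mono fun p hp => hT.norm_le _ hp _ (Metric.mem_ball_self hT.pos))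
  exact h1.sub ((hT.fderiv_opow hF.mem).apply hF.bdd₀)

theorem isBigO_of_isBigO_mul (hF : NearbyFamily L N K l h x d₁ d₂ d₃ y f) {E : Type*}
    [NormedAddCommGroup E] {v : ι → E} {e : ι → ℝ} (hv : v =O[l] fun p => h p * e p) :
    v =O[l] e := by
  refine hv.trans ?_
  simpa using (isBigO_one_of_tendsto_zero hF.tendsto).mul (isBigO_refl e l)

/-- This is `f(x) = J(x) x + nonlin N x x`: the unbounded part of `f` is carried by `J(x)`, and `x ↦
nonlin N x x` is Lipschitz near the solution. -/
theorem mem_graph_jacobian {x f : X} (hx : (x, f - N x) ∈ L.graph) :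
    (x, f - nonlin N x x) ∈ (jacobian L N x).graph := by
  refine mem_graph_perturb.2 ?_
  convert hx using 2
  simp only [nonlin]
  abel

theorem remainder_sub (hF : NearbyFamily L N K l h x d₁ d₂ d₃ y f) (hT : TubeBound N K ρ C)
    {U U' : ι → X} (hU' : Tendsto (fun p => U' p - x p) l (𝓝 0))
    (hUU' : (fun p => U p - U' p) =O[l] fun p => ‖y p - x p‖) :
    OPow l h 0 (fun p => remainder N (x p) (U' p)) ∧
    (fun p => remainder N (y p) (U p) - remainder N (x p) (U' p)) =O[l] fun p => ‖y p - x p‖ := by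
  have hball : ∀ {V : ι → X}, Tendsto (fun p => V p - x p) l (𝓝 0) →
      ∀ᶠ p in l, V p ∈ Metric.ball (x p) ρ := by
    intro V hV
    have := hV.norm
    rw [norm_zero] at this
    filter_upwards [this.eventually (gt_mem_nhds hT.pos)] with p hp
    rwa [mem_ball_iff_norm]
  have hclose : Tendsto (fun p => ‖y p - x p‖) l (𝓝 0) := by simpa using hF.close.norm
  have hU : Tendsto (fun p => U p - x p) l (𝓝 0) := by
    have h1 : Tendsto (fun p => U p - U' p) l (𝓝 0) := hUU'.trans_tendsto hclose
    simpa using h1.add hU'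
  have hU'1 : (fun p => U' p - x p) =O[l] (1 : ι → ℝ) := hU'.isBigO_one ℝ
  have hself : (fun p => y p - x p) =O[l] fun p => ‖y p - x p‖ :=
    (isBigO_refl (fun p => y p - x p) l).norm_right
  constructor
  · have h1 : OPow l h 0 fun p => N (U' p) := by
      refine OPow.of_norm_le (C := C) ?_
      filter_upwards [hF.mem, hball hU'] with p hp hp'
      exact hT.norm_le _ hp _ hp'
    have h2 : OPow l h 0 fun p => N (x p) :=
      OPow.of_norm_le (hF.mem.mono fun p hp => hT.norm_le _ hp _ (Metric.mem_ball_self hT.pos))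
    exact (h1.sub h2).sub ((hT.fderiv_opow hF.mem).apply (opow_zero_of_isBigO_one hU'1))
  · have h1 : (fun p => N (U p) - N (U' p)) =O[l] fun p => ‖y p - x p‖ := by
      refine IsBigO.trans (IsBigO.of_bound C ?_) hUU'
      filter_upwards [hF.mem, hball hU, hball hU'] with p hp hp1 hp2
      exact hT.norm_sub_le hp hp1 hp2
    have h2 : (fun p => N (y p) - N (x p)) =O[l] fun p => ‖y p - x p‖ := by
      refine IsBigO.of_bound C ?_
      filter_upwards [hF.mem, hF.eventually_mem_ball hT.pos] with p hp hy
      rw [norm_norm]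
      exact hT.norm_sub_le hp hy (Metric.mem_ball_self hT.pos)
    have h3 := isBigO_clm_apply_sub (v := fun p => U p - y p) (hF.fderiv_opow hT).isBigO_one
      (hF.fderiv_sub hT) hU'1 ((hUU'.sub hself).congr_left fun p => by abel)
    refine ((h1.sub h2).sub h3).congr_left fun p => ?_
    simp only [remainder]
    abel

variable [CompleteSpace X]

theorem phiL_sub (hF : NearbyFamily L N K l h x d₁ d₂ d₃ y f) (hT : TubeBound N K ρ C)
    (hL : GeneratesC0Semigroup L) (g : ℝ≥0) (k : ℕ) :
    (fun p => phiL (jacobian L N (y p)) ((g : ℝ) * h p) k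
      - phiL (jacobian L N (x p)) ((g : ℝ) * h p) k) =O[l] fun p => h p * ‖y p - x p‖ :=
  (phiL_sub_isBigO hL hF.tendsto hF.pos (hF.fderiv_opow hT) (hT.fderiv_opow hF.mem) g k).trans
    ((isBigO_refl h l).mul (hF.fderiv_sub hT).norm_left)

theorem opL_sub (hF : NearbyFamily L N K l h x d₁ d₂ d₃ y f) (hT : TubeBound N K ρ C)
    (hL : GeneratesC0Semigroup L) (c : PhiComb) :
    (fun p => PhiComb.opL (jacobian L N (y p)) (h p) c
      - PhiComb.opL (jacobian L N (x p)) (h p) c) =O[l] fun p => h p * ‖y p - x p‖ :=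
  (opL_sub_isBigO hL hF.tendsto hF.pos (hF.fderiv_opow hT) (hT.fderiv_opow hF.mem) c).trans
    ((isBigO_refl h l).mul (hF.fderiv_sub hT).norm_left)

/-- `φ_j(g h J(y)) v` depends Lipschitz continuously on `(y, v)`. -/
theorem phiL_apply_sub (hF : NearbyFamily L N K l h x d₁ d₂ d₃ y f) (hT : TubeBound N K ρ C)
    (hL : GeneratesC0Semigroup L) (g : ℝ≥0) (k : ℕ) {v v' : ι → X} (hv' : OPow l h 0 v')
    (hvv' : (fun p => v p - v' p) =O[l] fun p => ‖y p - x p‖) :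
    (fun p => phiL (jacobian L N (y p)) ((g : ℝ) * h p) k (v p)
      - phiL (jacobian L N (x p)) ((g : ℝ) * h p) k (v' p)) =O[l] fun p => ‖y p - x p‖ :=
  isBigO_clm_apply_sub (phiL_opow hL hF.tendsto hF.pos (hF.fderiv_opow hT) g k).isBigO_one
    (hF.isBigO_of_isBigO_mul (hF.phiL_sub hT hL g k)) hv'.isBigO_one hvv'

theorem opL_apply_sub (hF : NearbyFamily L N K l h x d₁ d₂ d₃ y f) (hT : TubeBound N K ρ C)
    (hL : GeneratesC0Semigroup L) (c : PhiComb) {v v' : ι → X} (hv' : OPow l h 0 v')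
    (hvv' : (fun p => v p - v' p) =O[l] fun p => ‖y p - x p‖) :
    (fun p => PhiComb.opL (jacobian L N (y p)) (h p) c (v p)
      - PhiComb.opL (jacobian L N (x p)) (h p) c (v' p)) =O[l] fun p => ‖y p - x p‖ :=
  isBigO_clm_apply_sub (opL_opow hL hF.tendsto hF.pos (hF.fderiv_opow hT) c).isBigO_one
    (hF.isBigO_of_isBigO_mul (hF.opL_sub hT hL c)) hv'.isBigO_one hvv'

/-- `h φ_{k+1}(g h J(x)) f(x)` in terms of bounded operators. -/
theorem smul_phiL_succ_eq (hL : GeneratesC0Semigroup L) {τ : ℝ} (hτ : 0 ≤ τ) {g : ℝ≥0}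
    (hg : 0 < g) (k : ℕ) {x f : X} (hx : (x, f - N x) ∈ L.graph) :
    τ • phiL (jacobian L N x) ((g : ℝ) * τ) (k + 1) f
      = (g : ℝ)⁻¹ • (phiL (jacobian L N x) ((g : ℝ) * τ) k x - ((k ! : ℝ)⁻¹) • x)
        + τ • phiL (jacobian L N x) ((g : ℝ) * τ) (k + 1) (nonlin N x x) := by
  have h1 := phiL_eq_add_of_mem_graph (generatesC0Semigroup_jacobian hL N x)
    (by positivity : 0 ≤ (g : ℝ) * τ) k (mem_graph_jacobian hx)
  have hg' : (g : ℝ) ≠ 0 := by positivity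
  rw [h1, add_sub_cancel_left, smul_smul, ← mul_assoc, inv_mul_cancel₀ hg', one_mul, map_sub,
    smul_sub, sub_add_cancel]

/-- `f p - d₁ p` is not controlled by `y p - x p`. If `g_{i1} > 0`, `smul_phiL_succ_eq` expresses `h
φ_k(g h J) f` by bounded operators. If `g_{i1} = 0`, each alternative of the restriction gives
`α_{i1} p_{i1k} = 0`, and the term is absent. -/
theorem psi_sub (hF : NearbyFamily L N K l h x d₁ d₂ d₃ y f) (hT : TubeBound N K ρ C)
    (hL : GeneratesC0Semigroup L) {m : Method} (hm : m.CoeffRestriction) {i : ℕ}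
    (hi : i ∈ Finset.Icc 2 m.s) :
    (fun p => (m.α i * h p) • PhiComb.opL (jacobian L N (y p)) (h p) (m.psi i) (f p)
      - (m.α i * h p) • PhiComb.opL (jacobian L N (x p)) (h p) (m.psi i) (d₁ p))
      =O[l] fun p => ‖y p - x p‖ := by
  simp only [opL_psi_eq, Finset.smul_sum, ← Finset.sum_sub_distrib]
  refine IsBigO.fun_sum fun k hk => ?_
  rcases eq_or_ne (m.g i) 0 with hg | hg
  · have h0 : m.α i * m.p i k = 0 := by
      rcases hm i hi k hk with h1 | h1 | h1 <;> simp [h1, hg]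
    refine (isBigO_zero _ l).congr_left fun p => ?_
    have e : ∀ v : X, (m.α i * h p) • m.p i k • v = (0 : X) := fun v => by
      rw [smul_smul, mul_right_comm, h0, zero_mul, zero_smul]
    rw [e, e, sub_self]
  · have hgpos : 0 < m.g i := pos_iff_ne_zero.2 hg
    have hself : (fun p => y p - x p) =O[l] fun p => ‖y p - x p‖ :=
      (isBigO_refl (fun p => y p - x p) l).norm_right
    have t1 := hF.phiL_apply_sub hT hL (m.g i) k.natPred hF.bdd₀ hself
    have t2 := hself.const_smul_left ((k.natPred ! : ℝ)⁻¹)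
    have t3 := hF.phiL_apply_sub hT hL (m.g i) (k.natPred + 1) (hF.nonlin_opow hT)
      (hF.nonlin_sub hT)
    have t4 := (isBigO_one_of_tendsto_zero hF.tendsto).smul t3
    simp only [Pi.one_apply, one_smul] at t4
    have t5 := (((t1.sub t2).const_smul_left ((m.g i : ℝ)⁻¹)).add t4).const_smul_left
      (m.α i * m.p i k)
    refine t5.congr' ?_ EventuallyEq.rfl
    filter_upwards [hF.graph_x, hF.graph_y, hF.pos] with p gx gy hp
    have ey := smul_phiL_succ_eq hL hp.le hgpos k.natPred gy
    have ex := smul_phiL_succ_eq hL hp.le hgpos k.natPred gx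
    rw [PNat.natPred_add_one] at ex ey
    have e : ∀ v : X, (m.α i * h p) • m.p i k • v = (m.α i * m.p i k) • h p • v := fun v => by
      module
    rw [e, e, ex, ey]
    simp only [Pi.smul_apply, PNat.natPred_add_one]
    module

theorem stage_tendsto (hF : NearbyFamily L N K l h x d₁ d₂ d₃ y f) (hT : TubeBound N K ρ C)
    (hL : GeneratesC0Semigroup L) (m : Method) (i : ℕ) :
    Tendsto (fun p => m.stage (jacobian L N (x p)) N (h p) (x p) (d₁ p) i - x p) l (𝓝 0) := by
  have hO := isBigO_one_of_tendsto_zero hF.tendsto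
  have hq : OPow l h 0 fun p => fderiv2 N (x p) (d₁ p) (d₁ p) :=
    ((hT.fderiv2_opow hF.mem).apply hF.bdd₁).apply hF.bdd₁
  have h1 := hF.stage_expansion hT hL m i
  have h2 := (hF.bdd₁.const_smul (m.α i * m.P i 1)).smul
  have h3 := (hF.bdd₂.const_smul (m.α i * m.g i * m.P i 2)).pow_smul 2
  have h4 := ((hF.bdd₃.const_smul (m.α i * m.g i ^ 2 * m.P i 3)).add
    ((opL_opow hL hF.tendsto hF.pos (hT.fderiv_opow hF.mem) (m.bigPsi i)).apply hq)).pow_smul 3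
  have h5 := (h1.mono hO (by norm_num : 1 ≤ 4)).add
    ((h2.add (h3.mono hO (by norm_num : 1 ≤ 2))).add (h4.mono hO (by norm_num : 1 ≤ 3)))
  refine (h5.tendsto_zero (n := 0) hF.tendsto).congr fun p => ?_
  exact sub_add_cancel _ _

theorem stage_sub (hF : NearbyFamily L N K l h x d₁ d₂ d₃ y f) (hT : TubeBound N K ρ C)
    (hL : GeneratesC0Semigroup L) {m : Method} (hm : m.CoeffRestriction) (i : ℕ)
    (hi : i ∈ Finset.Icc 2 m.s) :
    (fun p => m.stage (jacobian L N (y p)) N (h p) (y p) (f p) i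
      - m.stage (jacobian L N (x p)) N (h p) (x p) (d₁ p) i) =O[l] fun p => ‖y p - x p‖ := by
  induction i using Nat.strong_induction_on with
  | _ i ih =>
    have hself : (fun p => y p - x p) =O[l] fun p => ‖y p - x p‖ :=
      (isBigO_refl (fun p => y p - x p) l).norm_right
    have h1 : (fun p => ∑ j ∈ Finset.Ico 2 i,
        (PhiComb.opL (jacobian L N (y p)) (h p) (m.a i j)
          (remainder N (y p) (m.stage (jacobian L N (y p)) N (h p) (y p) (f p) j))
        - PhiComb.opL (jacobian L N (x p)) (h p) (m.a i j)
          (remainder N (x p) (m.stage (jacobian L N (x p)) N (h p) (x p) (d₁ p) j))))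
        =O[l] fun p => ‖y p - x p‖ := by
      refine IsBigO.fun_sum fun j hj => ?_
      rw [Finset.mem_Ico] at hj
      rw [Finset.mem_Icc] at hi
      obtain ⟨r1, r2⟩ := hF.remainder_sub hT (hF.stage_tendsto hT hL m j)
        (ih j hj.2 (Finset.mem_Icc.2 ⟨hj.1, by omega⟩))
      exact hF.opL_apply_sub hT hL (m.a i j) r1 r2
    have h2 := (isBigO_one_of_tendsto_zero hF.tendsto).smul h1
    simp only [Pi.one_apply, one_smul] at h2
    refine ((hself.add (hF.psi_sub hT hL hm hi)).add h2).congr_left fun p => ?_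
    rw [m.stage_eq (jacobian L N (y p)), m.stage_eq (jacobian L N (x p)), Finset.sum_sub_distrib]
    simp only [smul_sub]
    abel

/-- One step of the method, started at two nearby points. -/
theorem step_sub (hF : NearbyFamily L N K l h x d₁ d₂ d₃ y f) (hT : TubeBound N K ρ C)
    (hL : GeneratesC0Semigroup L) {m : Method} (hm : m.CoeffRestriction) :
    (fun p => m.step (jacobian L N (y p)) N (h p) (y p) (f p)
      - m.step (jacobian L N (x p)) N (h p) (x p) (d₁ p)
      - opExp (jacobian L N (x p)) (h p) (y p - x p)) =O[l] fun p => h p * ‖y p - x p‖ := by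
  have hy : y =O[l] (1 : ι → ℝ) := by
    have := (hF.close.isBigO_one ℝ).add hF.bdd₀.isBigO_one
    exact this.congr_left fun p => sub_add_cancel _ _
  -- Here `k = 0`, so this is `(e^{hJ(y)} - e^{hJ(x)}) y`. It arises since `y + h φ₁(h J(y)) f(y) =
  -- e^{hJ(y)} y + h φ₁(h J(y)) nonlin N y y`; all other differences carry an explicit factor `h`.
  have h1 := isBigO_clm_apply (hF.phiL_sub hT hL 1 0) hy
  simp only [Pi.one_apply, mul_one] at h1
  have h2 := hF.phiL_apply_sub hT hL 1 1 (hF.nonlin_opow hT) (hF.nonlin_sub hT)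
  have h3 : (fun p => ∑ i ∈ Finset.Icc 2 m.s,
      (PhiComb.opL (jacobian L N (y p)) (h p) (m.b i)
        (remainder N (y p) (m.stage (jacobian L N (y p)) N (h p) (y p) (f p) i))
      - PhiComb.opL (jacobian L N (x p)) (h p) (m.b i)
        (remainder N (x p) (m.stage (jacobian L N (x p)) N (h p) (x p) (d₁ p) i))))
      =O[l] fun p => ‖y p - x p‖ := by
    refine IsBigO.fun_sum fun i hi => ?_
    obtain ⟨r1, r2⟩ := hF.remainder_sub hT (hF.stage_tendsto hT hL m i)
      (hF.stage_sub hT hL hm i hi)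
    exact hF.opL_apply_sub hT hL (m.b i) r1 r2
  have h4 := (isBigO_refl h l).smul (h2.add h3)
  simp only [smul_eq_mul] at h4
  refine (h1.add h4).congr' ?_ EventuallyEq.rfl
  filter_upwards [hF.graph_x, hF.graph_y, hF.pos] with p gx gy hp
  have ey := smul_phiL_succ_eq hL hp.le one_pos 0 gy
  have ex := smul_phiL_succ_eq hL hp.le one_pos 0 gx
  simp only [NNReal.coe_one, one_mul, zero_add, inv_one, one_smul, Nat.factorial_zero,
    Nat.cast_one] at ex ey
  simp only [NNReal.coe_one, one_mul, Method.step]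
  rw [ex, ey, Finset.sum_sub_distrib]
  simp only [phiL, sub_apply, map_sub, smul_add, smul_sub]
  abel

end NearbyFamily

/-- The filter of triples `(t, h, y)` with `t ∈ [t₀, T]`, `h → 0+` and `y - u t → 0`. -/
def nearbyFilter (L : X →ₗ.[ℝ] X) (t₀ T : ℝ) (u : ℝ → X) : Filter (ℝ × ℝ × L.domain) :=
  𝓟 {p | p.1 ∈ Icc t₀ T} ⊓ (comap (fun p => p.2.1) (𝓝[>] 0)
    ⊓ comap (fun p => (p.2.2 : X) - u p.1) (𝓝 0))

theorem exists_of_eventually_nearbyFilter {L : X →ₗ.[ℝ] X} {t₀ T : ℝ} {u : ℝ → X}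
    {P : ℝ × ℝ × L.domain → Prop} (H : ∀ᶠ p in nearbyFilter L t₀ T u, P p) :
    ∃ η > 0, ∃ ε > 0, ∀ t ∈ Icc t₀ T, ∀ h, 0 < h → h < η → ∀ y : L.domain,
      ‖(y : X) - u t‖ < ε → P (t, h, y) := by
  have hb := ((hasBasis_principal {p : ℝ × ℝ × L.domain | p.1 ∈ Icc t₀ T}).inf
    (((nhdsGT_basis (0 : ℝ)).comap (fun p : ℝ × ℝ × L.domain => p.2.1)).inf
      ((Metric.nhds_basis_ball (x := (0 : X))).comap
        (fun p : ℝ × ℝ × L.domain => (p.2.2 : X) - u p.1))))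
  obtain ⟨⟨_, η, ε⟩, ⟨_, hη, hε⟩, hsub⟩ := hb.eventually_iff.1 H
  refine ⟨η, hη, ε, hε, fun t ht h h0 hh y hy => @hsub (t, h, y) ⟨ht, ⟨h0, hh⟩, ?_⟩⟩
  simpa using hy

theorem SmoothSolution.propagation [CompleteSpace X] {L : X →ₗ.[ℝ] X} {N : X → X} {t₀ T : ℝ}
    {u : ℝ → X} (hu : SmoothSolution L N t₀ T u) (hL : GeneratesC0Semigroup L) (hT : t₀ < T)
    {m : Method} (hm : m.CoeffRestriction) :
    ∃ η > 0, ∃ ε > 0, ∃ C : ℝ, 0 ≤ C ∧ ∀ t ∈ Icc t₀ T, ∀ h, 0 < h → h < η → ∀ y : L.domain,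
      ‖(y : X) - u t‖ < ε →
      ‖m.step (jacobian L N y) N h y (rhs L N y)
        - m.step (jacobian L N (u t)) N h (u t) (iteratedDerivWithin 1 u (Icc t₀ T) t)
        - opExp (jacobian L N (u t)) h ((y : X) - u t)‖ ≤ C * h * ‖(y : X) - u t‖ := by
  obtain ⟨δ, hδ, hN⟩ := hu.strip
  obtain ⟨ρ, C, hB⟩ := exists_tubeBound hu.isCompact_image hδ hN
  have hh : Tendsto (fun p : ℝ × ℝ × L.domain => p.2.1) (nearbyFilter L t₀ T u) (𝓝[>] 0) :=
    tendsto_comap.mono_left (inf_le_right.trans inf_le_left)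
  have hcl : Tendsto (fun p : ℝ × ℝ × L.domain => (p.2.2 : X) - u p.1) (nearbyFilter L t₀ T u)
      (𝓝 0) := tendsto_comap.mono_left (inf_le_right.trans inf_le_right)
  have hmem : ∀ᶠ p in nearbyFilter L t₀ T u, p.1 ∈ Icc t₀ T := by
    have : ∀ᶠ p in 𝓟 {p : ℝ × ℝ × L.domain | p.1 ∈ Icc t₀ T}, p.1 ∈ Icc t₀ T :=
      eventually_principal.2 fun p hp => hp
    exact this.filter_mono inf_le_left
  have hpos : ∀ᶠ p in nearbyFilter L t₀ T u, 0 < p.2.1 := hh.eventually self_mem_nhdsWithin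
  have hh0 := hh.mono_right nhdsWithin_le_nhds
  have hF : NearbyFamily L N (u '' Icc t₀ T) (nearbyFilter L t₀ T u) (fun p => p.2.1)
      (fun p => u p.1) (fun p => iteratedDerivWithin 1 u (Icc t₀ T) p.1)
      (fun p => iteratedDerivWithin 2 u (Icc t₀ T) p.1)
      (fun p => iteratedDerivWithin 3 u (Icc t₀ T) p.1) (fun p => (p.2.2 : X))
      (fun p => rhs L N p.2.2) :=
    { toSolutionFamily := hu.solutionFamily hL hT hB hh0 hpos hmem
      bdd₀ := by
        simpa using hu.iteratedDerivWithin_opow (h := fun p : ℝ × ℝ × L.domain => p.2.1) hT hmem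
          (k := 0) (by norm_num)
      close := hcl
      graph_x := hmem.mono fun p hp => hu.mem_graph_zero hT hp
      graph_y := Eventually.of_forall fun p => by
        simp only [rhs, add_sub_cancel_right]
        exact LinearPMap.mem_graph L p.2.2 }
  obtain ⟨C', hC'pos, hC'⟩ := (hF.step_sub hB hL hm).exists_nonneg
  rw [isBigOWith_iff] at hC'
  obtain ⟨η, hη, ε, hε, H⟩ := exists_of_eventually_nearbyFilter hC'
  refine ⟨η, hη, ε, hε, C', hC'pos, fun t ht h h0 hh y hy => ?_⟩
  have := H t ht h h0 hh y hy
  rwa [norm_mul, norm_norm, Real.norm_eq_abs, abs_of_pos h0, ← mul_assoc] at this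

end Propagation

/-! ### Convergence -/

section Convergence

variable {X : Type*} [NormedAddCommGroup X] [NormedSpace ℝ X]

theorem gridTime_succ (t₀ : ℝ) (h : ℕ → ℝ) (n : ℕ) :
    gridTime t₀ h (n + 1) = gridTime t₀ h n + h n := by
  simp [gridTime, Finset.sum_range_succ, add_assoc]

theorem gridTime_le_of_le {t₀ : ℝ} {h : ℕ → ℝ} {M n : ℕ} (hh : ∀ n < M, 0 < h n) (hn : n ≤ M) :
    gridTime t₀ h n ≤ gridTime t₀ h M := by
  rw [gridTime, gridTime]
  exact add_le_add_right (Finset.sum_le_sum_of_subset_of_nonneg (Finset.range_subset_range.2 hn)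
    fun i hi _ => (hh i (Finset.mem_range.1 hi)).le) t₀

theorem le_gridTime {t₀ : ℝ} {h : ℕ → ℝ} {M n : ℕ} (hh : ∀ n < M, 0 < h n) (hn : n ≤ M) :
    t₀ ≤ gridTime t₀ h n := by
  rw [gridTime]
  exact le_add_of_nonneg_right (Finset.sum_nonneg fun i hi =>
    (hh i ((Finset.mem_range.1 hi).trans_le hn)).le)

/-- The recursion in the definition splits off the latest factor; propagating errors forward needs
the earliest one. -/
theorem evolution_succ_right (L : X →ₗ.[ℝ] X) (N : X → X) (t₀ : ℝ) (u : ℝ → X) (h : ℕ → ℝ)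
    (k l : ℕ) : evolution L N t₀ u h k (l + 1) = (evolution L N t₀ u h (k + 1) l).comp
      (opExp (jacobian L N (u (gridTime t₀ h k))) (h k)) := by
  induction l with
  | zero => simp [evolution]
  | succ l ih =>
    rw [evolution, ih, evolution, ContinuousLinearMap.comp_assoc, add_right_comm k 1 l, add_assoc]

theorem Stable.norm_evolution_le {L : X →ₗ.[ℝ] X} {N : X → X} {t₀ : ℝ} {u : ℝ → X} {M : ℕ}
    {h : ℕ → ℝ} {Cs : ℝ} (hs : Stable L N t₀ u M h Cs) {k l : ℕ} (hkl : k + l ≤ M) :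
    ‖evolution L N t₀ u h k l‖ ≤ max Cs 1 := by
  rcases Nat.eq_zero_or_pos l with rfl | hl
  · exact ContinuousLinearMap.norm_id_le.trans (le_max_right _ _)
  · exact (hs k l hl hkl).trans (le_max_left _ _)

/-- Along a stable grid, errors are bounded by the sum of the local defects. -/
theorem Stable.norm_le_sum_defect {L : X →ₗ.[ℝ] X} {N : X → X} {t₀ : ℝ} {u : ℝ → X} {M : ℕ}
    {h : ℕ → ℝ} {Cs : ℝ} (hs : Stable L N t₀ u M h Cs) {e : ℕ → X} (he : e 0 = 0) {n : ℕ}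
    (hn : n ≤ M) :
    ‖e n‖ ≤ max Cs 1 * ∑ k ∈ Finset.range n,
      ‖e (k + 1) - opExp (jacobian L N (u (gridTime t₀ h k))) (h k) (e k)‖ := by
  -- The claim is strengthened to all later evolution operators applied to `e n`. The induction then
  -- absorbs each exponential into a longer product and never multiplies norms.
  suffices H : ∀ n l, n + l ≤ M → ‖evolution L N t₀ u h n l (e n)‖ ≤
      max Cs 1 * ∑ k ∈ Finset.range n,
        ‖e (k + 1) - opExp (jacobian L N (u (gridTime t₀ h k))) (h k) (e k)‖ by
    simpa [evolution] using H n 0 hn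
  intro n
  induction n with
  | zero => simp [he]
  | succ n ih =>
    intro l hl
    have h1 := ih (l + 1) (by omega)
    rw [evolution_succ_right, ContinuousLinearMap.comp_apply] at h1
    rw [Finset.sum_range_succ, mul_add]
    have h2 := (evolution L N t₀ u h (n + 1) l).le_of_opNorm_le (hs.norm_evolution_le hl)
      (e (n + 1) - opExp (jacobian L N (u (gridTime t₀ h n))) (h n) (e n))
    rw [map_sub] at h2
    calc _ ≤ _ := norm_le_norm_add_norm_sub' _
          (evolution L N t₀ u h (n + 1) l
            (opExp (jacobian L N (u (gridTime t₀ h n))) (h n) (e n)))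
      _ ≤ _ := add_le_add h1 h2

/-- A discrete Gronwall estimate in which the recursive bound is available only as long as the
errors `x n` are smaller than `ε`. -/
theorem sum_le_of_recursive_bound {x d h : ℕ → ℝ} {M : ℕ} {S C₁ C₂ ε ℓ : ℝ} {q : ℕ → ℝ}
    (hS : 0 ≤ S) (hC₁ : 0 ≤ C₁) (hC₂ : 0 ≤ C₂) (hh : ∀ n < M, 0 ≤ h n) (hq : ∀ n < M, 0 ≤ q n)
    (hℓ : ∑ k ∈ Finset.range M, h k ≤ ℓ)
    (hx : ∀ n ≤ M, x n ≤ S * ∑ k ∈ Finset.range n, d k)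
    (hd : ∀ n < M, x n < ε → d n ≤ C₁ * h n * x n + C₂ * q n)
    (hε : S * (C₂ * Real.exp (C₁ * S * ℓ)) * ∑ k ∈ Finset.range M, q k < ε) {n : ℕ} (hn : n ≤ M) :
    x n ≤ S * (C₂ * Real.exp (C₁ * S * ℓ)) * ∑ k ∈ Finset.range n, q k := by
  have hqn : ∀ {n}, n ≤ M → 0 ≤ ∑ k ∈ Finset.range n, q k := fun hn =>
    Finset.sum_nonneg fun k hk => hq k ((Finset.mem_range.1 hk).trans_le hn)
  have hmono : ∀ {f : ℕ → ℝ}, (∀ n < M, 0 ≤ f n) → ∀ {n}, n ≤ M →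
      ∑ k ∈ Finset.range n, f k ≤ ∑ k ∈ Finset.range M, f k := fun hf n hn =>
    Finset.sum_le_sum_of_subset_of_nonneg (Finset.range_subset_range.2 hn)
      fun k hk _ => hf k (Finset.mem_range.1 hk)
  -- The induction runs over the sums of defects, with the current sum of step sizes in the
  -- exponent; only afterwards is the exponent replaced by its bound with `ℓ`.
  have key : ∀ {n}, n ≤ M → ∑ k ∈ Finset.range n, d k ≤
      C₂ * Real.exp (C₁ * S * ∑ k ∈ Finset.range n, h k) * ∑ k ∈ Finset.range n, q k →
      x n ≤ S * (C₂ * Real.exp (C₁ * S * ℓ)) * ∑ k ∈ Finset.range n, q k := by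
    intro n hn hsum
    refine (hx n hn).trans ?_
    rw [mul_assoc S]
    refine mul_le_mul_of_nonneg_left (hsum.trans ?_) hS
    have := (hmono hh hn).trans hℓ
    have := hqn hn
    gcongr
  refine key hn ?_
  induction n with
  | zero => simp
  | succ n ih =>
    have hnM : n < M := hn
    have h1 := ih hnM.le
    -- The bootstrap: the bound obtained so far is below `ε` by `hε`, which makes the recursive
    -- estimate available at `n`.
    have h2 : x n < ε := by
      refine ((key hnM.le h1).trans ?_).trans_lt hε
      have := hmono hq hnM.le
      gcongr
    have h3 := hd n hnM h2
    have h4 := hx n hnM.le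
    have hn0 := hh n hnM
    have hq0 := hq n hnM
    have h6 : 1 + C₁ * S * h n ≤ Real.exp (C₁ * S * h n) := by
      linarith [Real.add_one_le_exp (C₁ * S * h n)]
    have h7 : 1 ≤ Real.exp (C₁ * S * ∑ k ∈ Finset.range (n + 1), h k) := by
      refine Real.one_le_exp (mul_nonneg (mul_nonneg hC₁ hS) (Finset.sum_nonneg fun k hk => ?_))
      exact hh k ((Finset.mem_range.1 hk).trans_le hn)
    have h8 : 0 ≤ C₂ * Real.exp (C₁ * S * ∑ k ∈ Finset.range n, h k) *
        ∑ k ∈ Finset.range n, q k := by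
      have := hqn hnM.le
      positivity
    calc ∑ k ∈ Finset.range (n + 1), d k
        ≤ (1 + C₁ * S * h n) * ∑ k ∈ Finset.range n, d k + C₂ * q n := by
          rw [Finset.sum_range_succ]
          have : C₁ * h n * x n ≤ C₁ * h n * (S * ∑ k ∈ Finset.range n, d k) := by gcongr
          linarith
      _ ≤ (1 + C₁ * S * h n) * (C₂ * Real.exp (C₁ * S * ∑ k ∈ Finset.range n, h k) *
            ∑ k ∈ Finset.range n, q k) + C₂ * q n := by gcongr
      _ ≤ Real.exp (C₁ * S * h n) * (C₂ * Real.exp (C₁ * S * ∑ k ∈ Finset.range n, h k) *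
            ∑ k ∈ Finset.range n, q k)
          + C₂ * Real.exp (C₁ * S * ∑ k ∈ Finset.range (n + 1), h k) * q n := by
          refine add_le_add (mul_le_mul_of_nonneg_right h6 h8) ?_
          refine mul_le_mul_of_nonneg_right ?_ hq0
          exact le_mul_of_one_le_right hC₂ h7
      _ = _ := by
          rw [Finset.sum_range_succ, Finset.sum_range_succ, mul_add (C₁ * S), Real.exp_add]
          ring

theorem sum_pow_six_le {h : ℕ → ℝ} {n : ℕ} {H ℓ : ℝ} (h0 : ∀ k < n, 0 ≤ h k)
    (hH : ∀ k < n, h k ≤ H) (hH0 : 0 ≤ H) (hℓ : ∑ k ∈ Finset.range n, h k ≤ ℓ) :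
    ∑ k ∈ Finset.range n, h k ^ 6 ≤ H ^ 5 * ℓ := by
  refine le_trans ?_ (mul_le_mul_of_nonneg_left hℓ (pow_nonneg hH0 5))
  rw [Finset.mul_sum]
  refine Finset.sum_le_sum fun k hk => ?_
  have hk := Finset.mem_range.1 hk
  rw [pow_succ]
  exact mul_le_mul_of_nonneg_right (pow_le_pow_left₀ (h0 k hk) (hH k hk) 5) (h0 k hk)

variable [CompleteSpace X]

theorem SmoothSolution.error_bound {L : X →ₗ.[ℝ] X} {N : X → X} {t₀ T : ℝ} {u : ℝ → X}
    {m : Method} (hu : SmoothSolution L N t₀ T u) (hL : GeneratesC0Semigroup L) (hT : t₀ < T)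
    (hcoeff : m.CoeffRestriction) (hreg : AdditionalRegularity m L N t₀ T u)
    (hord : m.SimplifiedOrderConditions) (Cs : ℝ) :
    ∃ h₀ > 0, ∃ C : ℝ, 0 ≤ C ∧ ∀ (M : ℕ) (h : ℕ → ℝ), (∀ n < M, 0 < h n ∧ h n ≤ h₀) →
      gridTime t₀ h M ≤ T → Stable L N t₀ u M h Cs →
      ∀ v : ℕ → X, m.IsNumericalSolution L N (u t₀) M h v → ∀ n ≤ M,
        ‖v n - u (gridTime t₀ h n)‖ ≤ C * ∑ ν ∈ Finset.range n, h ν ^ 6 := by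
  obtain ⟨η₂, hη₂, C₂, hC₂, hloc⟩ := hu.local_error hL hT hreg hord
  obtain ⟨η₁, hη₁, ε, hε, C₁, hC₁, hprop⟩ := hu.propagation hL hT hcoeff
  set S := max Cs 1
  have hS : 0 ≤ S := zero_le_one.trans (le_max_right _ _)
  set C := S * (C₂ * Real.exp (C₁ * S * (T - t₀))) with hCdef
  have hC : 0 ≤ C := by positivity
  have hℓ : 0 < T - t₀ := sub_pos.2 hT
  have hC' : 0 < C * (T - t₀) + 1 := by positivity
  -- Halving yields strict inequalities. `h₀ ≤ 1` gives `h₀⁵ ≤ h₀`, and the last entry then makes `C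
  -- ∑ h⁶ ≤ C h₀ (T - t₀) < ε`, as the bootstrap requires.
  refine ⟨min (min (η₁ / 2) (η₂ / 2)) (min 1 (ε / 2 / (C * (T - t₀) + 1))), by positivity, C, hC,
    fun M h hh hM hs v hv n hn => ?_⟩
  set h₀ := min (min (η₁ / 2) (η₂ / 2)) (min 1 (ε / 2 / (C * (T - t₀) + 1)))
  have hh₀η₁ : h₀ < η₁ := ((min_le_left _ _).trans (min_le_left _ _)).trans_lt (half_lt_self hη₁)
  have hh₀η₂ : h₀ < η₂ := ((min_le_left _ _).trans (min_le_right _ _)).trans_lt (half_lt_self hη₂)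
  have hh₀1 : h₀ ≤ 1 := (min_le_right _ _).trans (min_le_left _ _)
  have hh₀ε : h₀ ≤ ε / 2 / (C * (T - t₀) + 1) := (min_le_right _ _).trans (min_le_right _ _)
  have hh₀ : 0 < h₀ := by positivity
  have hsum : ∑ k ∈ Finset.range M, h k ≤ T - t₀ := by
    rw [gridTime] at hM
    linarith
  have hpos : ∀ n < M, 0 < h n := fun n hn => (hh n hn).1
  have hsmall : C * ∑ k ∈ Finset.range M, h k ^ 6 < ε := by
    have h1 := sum_pow_six_le (fun k hk => (hpos k hk).le) (fun k hk => (hh k hk).2) hh₀.le hsum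
    have h2 : h₀ ^ 5 ≤ h₀ := pow_le_of_le_one hh₀.le hh₀1 (by norm_num)
    rw [le_div_iff₀ hC'] at hh₀ε
    calc C * ∑ k ∈ Finset.range M, h k ^ 6 ≤ C * (h₀ ^ 5 * (T - t₀)) := by gcongr
      _ ≤ C * (h₀ * (T - t₀)) := by gcongr
      _ ≤ h₀ * (C * (T - t₀) + 1) := by linarith
      _ < ε := by linarith
  refine sum_le_of_recursive_bound (x := fun n => ‖v n - u (gridTime t₀ h n)‖) (h := h)
    (q := fun n => h n ^ 6) hS hC₁ hC₂ (fun n hn => (hpos n hn).le)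
    (fun n hn => pow_nonneg (hpos n hn).le 6) hsum
    (fun n hn => hs.norm_le_sum_defect (e := fun n => v n - u (gridTime t₀ h n))
      (by simp [hv.1, gridTime]) hn) (fun n hn hx => ?_) hsmall hn
  obtain ⟨hdom, hstep⟩ := hv.2 n hn
  rw [m.isStep_iff hL N (hpos n hn).le] at hstep
  have ht : gridTime t₀ h n ∈ Icc t₀ T :=
    ⟨le_gridTime hpos hn.le, (gridTime_le_of_le hpos hn.le).trans hM⟩
  have ht' : gridTime t₀ h n + h n ≤ T := by
    rw [← gridTime_succ]
    exact (gridTime_le_of_le hpos hn).trans hM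
  -- The defect `e (n + 1) - e^{hJ} e n` is the propagation error of the step from `v n` plus the
  -- local error of the step from `u`.
  have h1 := hprop _ ht (h n) (hpos n hn) ((hh n hn).2.trans_lt hh₀η₁) ⟨v n, hdom⟩ hx
  have h2 := hloc _ ht (h n) (hpos n hn) ((hh n hn).2.trans_lt hh₀η₂) ht'
  refine le_trans (le_of_eq ?_) (norm_add_le_of_le h1 h2)
  rw [gridTime_succ, hstep]
  congr 1
  abel

/-- Each `φ_k(g τ A)` with `k ≥ 1` and `g τ > 0` is smoothing, whereas `φ_k(0)` is only a multiple
of the identity. -/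
theorem PhiComb.opL_mem_domain {A : X →ₗ.[ℝ] X} (hA : GeneratesC0Semigroup A) {τ : ℝ} (hτ : 0 < τ)
    {c : PhiComb} (hc : ∀ kg ∈ c.support, 0 < kg.2) (v : X) : PhiComb.opL A τ c v ∈ A.domain := by
  rw [PhiComb.opL_apply]
  refine Submodule.sum_mem _ fun kg hkg => Submodule.smul_mem _ _ ?_
  have := LinearPMap.mem_domain_of_mem_graph
    (phiL_succ_mem_graph hA (mul_pos (NNReal.coe_pos.2 (hc kg hkg)) hτ) kg.1.natPred v)
  rwa [PNat.natPred_add_one] at this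

/-- Only the outer operators matter: the internal stages enter through `remainder`, which makes
sense outside the domain. -/
theorem Method.step_mem_domain (m : Method) {A : X →ₗ.[ℝ] X} (hA : GeneratesC0Semigroup A)
    {h : ℝ} (hh : 0 < h) (hb : ∀ i ∈ Finset.Icc 2 m.s, ∀ kg ∈ (m.b i).support, 0 < kg.2)
    (N : X → X) {x : X} (hx : x ∈ A.domain) (f : X) : m.step A N h x f ∈ A.domain := by
  rw [Method.step]
  refine add_mem (add_mem hx (Submodule.smul_mem _ _ ?_)) (Submodule.smul_mem _ _
    (Submodule.sum_mem _ fun i hi => PhiComb.opL_mem_domain hA hh (hb i hi) _))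
  exact LinearPMap.mem_domain_of_mem_graph (phiL_succ_mem_graph hA hh 0 f)

theorem Method.exists_isNumericalSolution (m : Method) {L : X →ₗ.[ℝ] X}
    (hL : GeneratesC0Semigroup L) (N : X → X) {u₀ : X} (hu₀ : u₀ ∈ L.domain) {M : ℕ} {h : ℕ → ℝ}
    (hh : ∀ n < M, 0 < h n)
    (hb : ∀ i ∈ Finset.Icc 2 m.s, ∀ kg ∈ (m.b i).support, 0 < kg.2) :
    ∃ v : ℕ → X, m.IsNumericalSolution L N u₀ M h v := by
  have hstep : ∀ n (x : L.domain), ∃ y : L.domain, n < M → m.IsStep L N (h n) x y := by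
    intro n x
    by_cases hn : n < M
    · refine ⟨⟨_, m.step_mem_domain (generatesC0Semigroup_jacobian hL N x) (hh n hn) hb N x.2
        (rhs L N x)⟩, fun _ => ?_⟩
      rw [m.isStep_iff hL N (hh n hn).le]
    · exact ⟨x, fun h => absurd h hn⟩
  choose F hF using hstep
  let w : ℕ → L.domain := Nat.rec ⟨u₀, hu₀⟩ F
  exact ⟨fun n => (w n).1, rfl, fun n hn => ⟨(w n).2, hF n (w n) hn⟩⟩

end Convergence

end EPIRKConv

/-- Convergence of order five under the simplified stiff order conditions. The last conjunct records
that the numerical solution exists (i.e. stays in `D(L)`) if all `φ`-functions in the final stage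
have positive arguments `g h J`. -/
theorem mainTheorem2 {X : Type*} [NormedAddCommGroup X] [NormedSpace ℝ X] [CompleteSpace X]
    (L : X →ₗ.[ℝ] X) (N : X → X) (t₀ T : ℝ) (hT : t₀ < T) (u : ℝ → X) (m : EPIRKConv.Method)
    (hL : EPIRKConv.GeneratesC0Semigroup L)
    (hu : EPIRKConv.SmoothSolution L N t₀ T u)
    (hcoeff : m.CoeffRestriction)
    (hreg : EPIRKConv.AdditionalRegularity m L N t₀ T u)
    (hord : m.SimplifiedOrderConditions)
    (Cs : ℝ) :
    ∃ h₀ > 0, ∃ C : ℝ, ∀ (M : ℕ) (h : ℕ → ℝ),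
      (∀ n < M, 0 < h n ∧ h n ≤ h₀) →
      EPIRKConv.gridTime t₀ h M ≤ T →
      EPIRKConv.Stable L N t₀ u M h Cs →
      (∀ v : ℕ → X, m.IsNumericalSolution L N (u t₀) M h v →
        ∀ n ≤ M,
          ‖v n - u (EPIRKConv.gridTime t₀ h n)‖ ≤ C * ∑ ν ∈ Finset.range n, h ν ^ 6 ∧
          ∀ H : ℝ, 0 ≤ H → (∀ ν < M, h ν ≤ H) →
            ‖v n - u (EPIRKConv.gridTime t₀ h n)‖ ≤ C * H ^ 5) ∧
      ((∀ i ∈ Finset.Icc 2 m.s, ∀ kg ∈ (m.b i).support, 0 < kg.2) →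
        ∃ v : ℕ → X, m.IsNumericalSolution L N (u t₀) M h v) := by
  obtain ⟨h₀, hh₀, C, hC, hbound⟩ := hu.error_bound hL hT hcoeff hreg hord Cs
  have hℓ : 0 ≤ T - t₀ := (sub_pos.2 hT).le
  -- One constant for both estimates: the factor is at least `1` for the first, and at least `T -
  -- t₀` for `∑ h⁶ ≤ H⁵ (T - t₀)` in the second.
  refine ⟨h₀, hh₀, C * (1 + (T - t₀)), fun M h hh hM hs => ⟨fun v hv n hn => ?_, fun hb =>
    m.exists_isNumericalSolution hL N (hu.mem_domain (left_mem_Icc.2 hT.le))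
      (fun n hn => (hh n hn).1) hb⟩⟩
  have hpos : ∀ n < M, 0 < h n := fun n hn => (hh n hn).1
  have hpos' : ∀ k < n, 0 ≤ h k := fun k hk => (hpos k (hk.trans_le hn)).le
  have hsum : ∑ k ∈ Finset.range n, h k ≤ T - t₀ := by
    have := (EPIRKConv.gridTime_le_of_le (t₀ := t₀) hpos hn).trans hM
    rw [EPIRKConv.gridTime] at this
    linarith
  have hbase := hbound M h hh hM hs v hv n hn
  refine ⟨hbase.trans ?_, fun H hH0 hH => hbase.trans ?_⟩
  · refine mul_le_mul_of_nonneg_right (le_mul_of_one_le_right hC (by linarith))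
      (Finset.sum_nonneg fun k hk => pow_nonneg (hpos' k (Finset.mem_range.1 hk)) 6)
  · have := EPIRKConv.sum_pow_six_le hpos' (fun k hk => hH k (hk.trans_le hn)) hH0 hsum
    calc C * ∑ ν ∈ Finset.range n, h ν ^ 6 ≤ C * (H ^ 5 * (T - t₀)) := by gcongr
      _ ≤ C * (H ^ 5 * (T - t₀)) + C * H ^ 5 := le_add_of_nonneg_right (by positivity)
      _ = C * (1 + (T - t₀)) * H ^ 5 := by ring
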